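/- Let $d\ge 0$, let all function spaces be over $\mathbb K=\mathbb R$ or $\mathbb K=\mathbb C$, and let $\beta:\mathbb R^d\to\mathbb R^d$ be a locally integrable vector field whose distributional divergence is a locally integrable function, denoted $\operatorname{div}\beta$. Consider $L^{(\beta)}=\Delta+\beta\cdot\nabla$ with domain the Schwartz space $\mathcal S(\mathbb R^d)$. (i) Suppose that $\beta\cdot\nabla f\in L^2(\mathbb R^d)$ and $(\operatorname{div}\beta)f\in L^2(\mathbb R^d)$ for all $f\in\mathcal S(\mathbb R^d)$. Then $L^{(\beta)}$ is densely defined in $L^2(\mathbb R^d,dx)$ and its adjoint is $\Delta-\beta\cdot\nabla-\operatorname{div}\beta$: every $g\in\mathcal S(\mathbb R^d)$ lies in the domain of the adjoint, which maps it to $\Delta g-\beta\cdot\nabla g-(\operatorname{div}\beta)g$; and in general, for $u,v\in L^2(\mathbb R^d)$, $u$ lies in the domain of the adjoint and is mapped to $v$ if and only if $\Delta u-\operatorname{div}(\beta u)=v$ in the sense of distributions, i.e. $\int u\,(\Delta\psi+\beta\cdot\nabla\psi)\,dx=\int v\,\psi\,dx$ for all real $\psi\in C_c^\infty(\mathbb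 R^d)$. Now let $G:\mathbb R^d\to\mathbb R$ be a locally integrable function with $\beta=-\nabla G$ in the sense of distributions, such that $e^{-G}\in L^1(\mathbb R^d)$ and such that $f\,e^{-G}\,\nabla G$ and $f\,e^{-G}\,\Delta G$ (where $\Delta G=-\operatorname{div}\beta$) are integrable for all $f\in\mathcal S(\mathbb R^d)$. Put $\mu(dx)=e^{-G(x)}\,dx$. (ii) $\mu$ is infinitesimally invariant under $L^{(\beta)}$: for all $f\in\mathcal S(\mathbb R^d)$, $L^{(\beta)}f\in L^1(\mu)$ and $\int L^{(\beta)}f\,d\mu=0$. Assume moreover that $L^{(\beta)}$ is an operator in $L^2(\mathbb R^d,\mu)$, i.e. $\beta\cdot\nabla f\in L^2(\mu)$ for all $f\in\mathcal S(\mathbb R^d)$. (iii) $(L^{(\beta)},\mathcal S(\mathbb R^d))$ is densely defined and symmetric in $L^2(\mu)$, i.e. its adjoint in $L^2(\mu)$ coincides with $L^{(\beta)}$ on $\mathcal S(\mathbb R^d)$. Finally let $V=\tfrac14|\beta|^2+\tfrac12\operatorname{div}\beta$, and assume that $(\operatorname{div}\beta)f\in L^2(\mathbb R^d)$ and $Vf\in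 L^2(\mathbb R^d)$ for all $f\in\mathcal S(\mathbb R^d)$, that $e^{-G}$ is essentially bounded on every ball, and that the Schrödinger operator $-\Delta+V$ is essentially self-adjoint on $\mathcal S(\mathbb R^d)$ in $L^2(\mathbb R^d,dx)$. Then: (iv) $L^{(\beta)}$ is closable in $L^2(\mu)$, and its closure $\overline{L^{(\beta)}}$ is self-adjoint in $L^2(\mu)$. (v) There is exactly one strongly continuous semigroup $(e^{t\overline{L^{(\beta)}}})_{t\ge 0}$ of bounded operators on $L^2(\mu)$ with generator $\overline{L^{(\beta)}}$; it is a contraction semigroup, and $\mu$ is invariant under it: $\int e^{t\overline{L^{(\beta)}}}u\,d\mu=\int u\,d\mu$ for all $t\ge 0$ and $u\in L^2(\mu)$. -/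

import Mathlib

open MeasureTheory Filter Topology SchwartzMap
open scoped NNReal ENNReal InnerProductSpace ContDiff

noncomputable section

/-! ### Weak derivatives on `ℝᵈ` -/

/-- `b` is the distributional gradient of the locally integrable function `G`: for every real
test function `ψ` and every direction `e`, `∫ G ∂ₑψ = - ∫ ⟨b, e⟩ ψ`. -/
def IsWeakGradient {d : ℕ} (G : EuclideanSpace ℝ (Fin d) → ℝ)
    (b : EuclideanSpace ℝ (Fin d) → EuclideanSpace ℝ (Fin d)) : Prop :=
  LocallyIntegrable G ∧ LocallyIntegrable b ∧
    ∀ ψ : EuclideanSpace ℝ (Fin d) → ℝ, ContDiff ℝ ∞ ψ → HasCompactSupport ψ →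
      ∀ e : EuclideanSpace ℝ (Fin d),
        ∫ x, G x * fderiv ℝ ψ x e = - ∫ x, ⟪b x, e⟫_ℝ * ψ x

/-- The locally integrable function `D` is the distributional divergence of the locally integrable
vector field `b`: for every real test function `ψ`, `∫ b · ∇ψ = - ∫ D ψ`. Here
`b(x) · ∇ψ(x)` is written as the derivative of `ψ` at `x` in the direction `b(x)`. -/
def IsWeakDivergence {d : ℕ} (b : EuclideanSpace ℝ (Fin d) → EuclideanSpace ℝ (Fin d))
    (D : EuclideanSpace ℝ (Fin d) → ℝ) : Prop :=
  LocallyIntegrable b ∧ LocallyIntegrable D ∧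
    ∀ ψ : EuclideanSpace ℝ (Fin d) → ℝ, ContDiff ℝ ∞ ψ → HasCompactSupport ψ →
      ∫ x, fderiv ℝ ψ x (b x) = - ∫ x, D x * ψ x

/-! ### Differential operators on Schwartz functions and their realizations in `L²(μ)` -/

/-- The differential expression `f ↦ a Δf + b · ∇f + c f` on Schwartz functions, with a real number
`a`, a real vector field `b` and a real function `c`. The value is a pointwise defined function. -/
def diffExpr (𝕜 : Type*) [RCLike 𝕜] {d : ℕ} (a : ℝ)
    (b : EuclideanSpace ℝ (Fin d) → EuclideanSpace ℝ (Fin d))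
    (c : EuclideanSpace ℝ (Fin d) → ℝ) :
    𝓢(EuclideanSpace ℝ (Fin d), 𝕜) →ₗ[𝕜] (EuclideanSpace ℝ (Fin d) → 𝕜) where
  toFun f := fun x =>
    (a : 𝕜) * Laplacian.laplacian (f : EuclideanSpace ℝ (Fin d) → 𝕜) x
      + fderiv ℝ f x (b x) + (c x : 𝕜) * f x
  map_add' f g := by
    funext x
    have h1 : Laplacian.laplacian (⇑(f + g) : EuclideanSpace ℝ (Fin d) → 𝕜) x =
        Laplacian.laplacian (⇑f : EuclideanSpace ℝ (Fin d) → 𝕜) x +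
          Laplacian.laplacian (⇑g : EuclideanSpace ℝ (Fin d) → 𝕜) x := by
      rw [← SchwartzMap.laplacian_apply, ← SchwartzMap.laplacian_apply,
        ← SchwartzMap.laplacian_apply]
      simp only [← SchwartzMap.laplacianCLM_eq (𝕜 := ℝ), map_add, add_apply]
    have h2 : fderiv ℝ (⇑(f + g)) x = fderiv ℝ (⇑f) x + fderiv ℝ (⇑g) x :=
      fderiv_add f.differentiableAt g.differentiableAt
    simp only [h1, h2, Pi.add_apply, add_apply]
    ring
  map_smul' r f := by
    funext x
    have h1 : Laplacian.laplacian (⇑(r • f) : EuclideanSpace ℝ (Fin d) → 𝕜) x =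
        r • Laplacian.laplacian (⇑f : EuclideanSpace ℝ (Fin d) → 𝕜) x := by
      rw [← SchwartzMap.laplacian_apply, ← SchwartzMap.laplacian_apply]
      simp only [← SchwartzMap.laplacianCLM_eq (𝕜 := 𝕜), map_smul, smul_apply]
    have h2 : fderiv ℝ (⇑(r • f)) x = r • fderiv ℝ (⇑f) x :=
      fderiv_const_smul f.differentiableAt r
    simp only [h1, h2, Pi.smul_apply, smul_apply,
      smul_eq_mul, RingHom.id_apply]
    ring

/-- The operator `L^(β) = Δ + β · ∇` on Schwartz functions. -/
def driftExpr (𝕜 : Type*) [RCLike 𝕜] {d : ℕ}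
    (β : EuclideanSpace ℝ (Fin d) → EuclideanSpace ℝ (Fin d)) :
    𝓢(EuclideanSpace ℝ (Fin d), 𝕜) →ₗ[𝕜] (EuclideanSpace ℝ (Fin d) → 𝕜) :=
  diffExpr 𝕜 1 β (fun _ => 0)

/-- The operator `Δ - β · ∇ - D` on Schwartz functions. -/
def driftAdjointExpr (𝕜 : Type*) [RCLike 𝕜] {d : ℕ}
    (β : EuclideanSpace ℝ (Fin d) → EuclideanSpace ℝ (Fin d))
    (D : EuclideanSpace ℝ (Fin d) → ℝ) :
    𝓢(EuclideanSpace ℝ (Fin d), 𝕜) →ₗ[𝕜] (EuclideanSpace ℝ (Fin d) → 𝕜) :=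
  diffExpr 𝕜 1 (fun x => - β x) (fun x => - D x)

/-- The Schrödinger operator `-Δ + V` on Schwartz functions. -/
def schrodingerExpr (𝕜 : Type*) [RCLike 𝕜] {d : ℕ} (V : EuclideanSpace ℝ (Fin d) → ℝ) :
    𝓢(EuclideanSpace ℝ (Fin d), 𝕜) →ₗ[𝕜] (EuclideanSpace ℝ (Fin d) → 𝕜) :=
  diffExpr 𝕜 (-1) (fun _ => 0) V

/-- The set of pairs `(u, v)` in `L²(μ) × L²(μ)` such that, for some Schwartz function `f`, `u` is
the class of `f` and `v` is the class of `T f`. -/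
def schwartzGraph {𝕜 : Type*} [RCLike 𝕜] {d : ℕ} (μ : Measure (EuclideanSpace ℝ (Fin d)))
    (T : 𝓢(EuclideanSpace ℝ (Fin d), 𝕜) →ₗ[𝕜] (EuclideanSpace ℝ (Fin d) → 𝕜)) :
    Submodule 𝕜 (Lp 𝕜 2 μ × Lp 𝕜 2 μ) where
  carrier := {p | ∃ f : 𝓢(EuclideanSpace ℝ (Fin d), 𝕜),
    (p.1 : EuclideanSpace ℝ (Fin d) → 𝕜) =ᵐ[μ] f ∧
    (p.2 : EuclideanSpace ℝ (Fin d) → 𝕜) =ᵐ[μ] T f}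
  add_mem' := by
    rintro p q ⟨f, hf1, hf2⟩ ⟨g, hg1, hg2⟩
    refine ⟨f + g, ?_, ?_⟩
    · filter_upwards [Lp.coeFn_add p.1 q.1, hf1, hg1] with x h h1 h2
      rw [Prod.fst_add, h, Pi.add_apply, h1, h2, add_apply]
    · filter_upwards [Lp.coeFn_add p.2 q.2, hf2, hg2] with x h h1 h2
      rw [Prod.snd_add, h, Pi.add_apply, h1, h2, map_add, Pi.add_apply]
  zero_mem' := by
    refine ⟨0, ?_, ?_⟩
    · filter_upwards [Lp.coeFn_zero 𝕜 2 μ] with x h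
      rw [Prod.fst_zero, h, Pi.zero_apply, zero_apply]
    · filter_upwards [Lp.coeFn_zero 𝕜 2 μ] with x h
      rw [Prod.snd_zero, h, map_zero]
  smul_mem' := by
    rintro c p ⟨f, hf1, hf2⟩
    refine ⟨c • f, ?_, ?_⟩
    · filter_upwards [Lp.coeFn_smul c p.1, hf1] with x h h1
      rw [Prod.smul_fst, h, Pi.smul_apply, h1, smul_apply]
    · filter_upwards [Lp.coeFn_smul c p.2, hf2] with x h h1
      rw [Prod.smul_snd, h, Pi.smul_apply, h1, map_smul, Pi.smul_apply]

/-- The unbounded operator in `L²(μ)` given by `T` on Schwartz functions. Its domain consists of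
the classes of the Schwartz functions `f` with `T f` in `L²(μ)`, hence is all of the Schwartz
space if `T` maps Schwartz functions into `L²(μ)`. The graph is single-valued as soon as
`μ` charges every nonempty open set. -/
def schwartzOp {𝕜 : Type*} [RCLike 𝕜] {d : ℕ} (μ : Measure (EuclideanSpace ℝ (Fin d)))
    (T : 𝓢(EuclideanSpace ℝ (Fin d), 𝕜) →ₗ[𝕜] (EuclideanSpace ℝ (Fin d) → 𝕜)) :
    Lp 𝕜 2 μ →ₗ.[𝕜] Lp 𝕜 2 μ :=
  (schwartzGraph μ T).toLinearPMap

/-- The measure `e^{-G} dx`. -/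
def gibbsMeasure {d : ℕ} (G : EuclideanSpace ℝ (Fin d) → ℝ) :
    Measure (EuclideanSpace ℝ (Fin d)) :=
  volume.withDensity (fun x => ENNReal.ofReal (Real.exp (- G x)))

/-- `μ` is infinitesimally invariant under `T` on Schwartz functions: `∫ T f dμ = 0`
for all Schwartz functions `f`, all these integrals being absolutely convergent. -/
def IsInfinitesimallyInvariant {𝕜 : Type*} [RCLike 𝕜] {d : ℕ}
    (μ : Measure (EuclideanSpace ℝ (Fin d)))
    (T : 𝓢(EuclideanSpace ℝ (Fin d), 𝕜) →ₗ[𝕜] (EuclideanSpace ℝ (Fin d) → 𝕜)) : Prop :=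
  ∀ f : 𝓢(EuclideanSpace ℝ (Fin d), 𝕜), Integrable (T f) μ ∧ ∫ x, T f x ∂μ = 0

/-! ### Symmetric and essentially self-adjoint operators, semigroups -/

section Operators

variable {𝕜 : Type*} [RCLike 𝕜] {H : Type*} [NormedAddCommGroup H] [InnerProductSpace 𝕜 H]
  [CompleteSpace H]

/-- A densely defined operator is symmetric if its adjoint extends it. -/
def IsSymmetricOp (A : H →ₗ.[𝕜] H) : Prop :=
  Dense (A.domain : Set H) ∧ A ≤ A.adjoint

/-- A densely defined closable operator is essentially self-adjoint if its closure is
self-adjoint. -/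
def IsEssentiallySelfAdjoint (A : H →ₗ.[𝕜] H) : Prop :=
  Dense (A.domain : Set H) ∧ A.IsClosable ∧ IsSelfAdjoint A.closure

/-- Strongly continuous one-parameter semigroups of bounded operators. -/
structure IsC0Semigroup (T : ℝ≥0 → H →L[𝕜] H) : Prop where
  map_zero : T 0 = ContinuousLinearMap.id 𝕜 H
  map_add : ∀ s t : ℝ≥0, T (s + t) = (T s).comp (T t)
  strong_continuous : ∀ u : H, Continuous fun t : ℝ≥0 => T t u

/-- `A` is the infinitesimal generator of `T`: its graph is the set of all `(u, v)` such that
`(T_t u - u) / t → v` in norm as `t ↓ 0`. -/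
def IsGeneratorOf (A : H →ₗ.[𝕜] H) (T : ℝ≥0 → H →L[𝕜] H) : Prop :=
  ∀ u v : H, (u, v) ∈ A.graph ↔
    Tendsto (fun t : ℝ≥0 => ((((t : ℝ)⁻¹ : ℝ) : 𝕜)) • (T t u - u)) (𝓝[>] 0) (𝓝 v)

end Operators

end

/-! Write `L = Δ + β · ∇`. When `β = -∇G`, the operator is in divergence form, `L f = e^{G}
div(e^{-G} ∇f)`, and integration by parts gives the Dirichlet form `∫ ⟨L f, g⟩ dμ = -∑ᵢ ∫ ⟨∂ᵢf, ∂ᵢg⟩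
dμ` (`IsGibbsDrift.integral_inner_driftExpr`). Taking `g = 1` gives infinitesimal invariance,
exchanging `f` and `g` gives symmetry, and `g = f` gives nonpositivity. Since `G` is only weakly
differentiable, `e^{-G}` must first be given a weak gradient (`IsGibbsDrift.isWeakDivergence`): the
chain rule for bounded functions of `G` follows by mollification, and `e^{-s}` is the limit of the
bounded functions `1 / (e^s + c)` as `c → 0`.

The Lebesgue adjoint in (i) comes from the divergence theorem with cutoffs. The error term contains
`|β| |f|`, whereas only `β · ∇f` is assumed square integrable; testing with `f sin⟨e, x⟩` and `f
cos⟨e, x⟩` closes the gap (`memLp_norm_mul_norm_of_forall_fderiv`). The same bound carries weak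
identities from compactly supported test functions to Schwartz functions.

Self-adjointness in (iv) is the ground state transformation. Multiplication by `e^{G/2}` is a
unitary map from `L²(dx)` onto `L²(μ)`, and formally `L (e^{G/2} f) = e^{G/2} (Δ f - V f)`. As
`e^{G/2} f` need not be smooth, the identity is established in the closure of the graph of `L`
(`IsGibbsDrift.inGraphClosure_exp_half`), by approximation with `F(G_n) χ f`, where `F` is a bounded
regularization of `e^{s/2}`, `G_n` a mollification of `G` and `χ` a cutoff. So the closure of `L` is
a symmetric extension of an operator unitarily equivalent to minus the self-adjoint closure of `-Δ +
V`, and a self-adjoint operator has no proper symmetric extension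
(`IsSymmetricOp.isEssentiallySelfAdjoint_of_transplant`).

For (v), a nonpositive self-adjoint graph generates a symmetric contraction semigroup, the limit of
the exponentials of its Yosida approximations (`exists_contraction_semigroup`); an energy estimate
gives uniqueness. Infinitesimal invariance places `(1, 0)` in the graph of the adjoint, which is
that of the closure, so the semigroup fixes `1`; by symmetry it preserves `∫ u dμ = ⟨1, u⟩`. -/

noncomputable section

/-! ### Adjoint graphs and transplantation of essential self-adjointness. -/

section AbstractOperators

variable {𝕜 : Type*} [RCLike 𝕜] {H : Type*} [NormedAddCommGroup H] [InnerProductSpace 𝕜 H]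
  [CompleteSpace H]

theorem LinearPMap.mem_adjoint_graph_iff {A : H →ₗ.[𝕜] H} (hA : Dense (A.domain : Set H))
    (u v : H) :
    (u, v) ∈ A.adjoint.graph ↔ ∀ p ∈ A.graph, ⟪p.2, u⟫_𝕜 = ⟪p.1, v⟫_𝕜 := by
  rw [LinearPMap.adjoint_graph_eq_graph_adjoint hA, Submodule.mem_adjoint_iff]
  simp only [sub_eq_zero, Prod.forall]

/-- The pairing condition defining the adjoint passes to the closure of a graph. -/
theorem inner_eq_inner_of_mem_closure {Γ : Submodule 𝕜 (H × H)} {u v : H}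
    (h : ∀ p ∈ Γ, ⟪p.2, u⟫_𝕜 = ⟪p.1, v⟫_𝕜) :
    ∀ p ∈ Γ.topologicalClosure, ⟪p.2, u⟫_𝕜 = ⟪p.1, v⟫_𝕜 := by
  have hc : IsClosed {p : H × H | ⟪p.2, u⟫_𝕜 = ⟪p.1, v⟫_𝕜} :=
    isClosed_eq (by fun_prop) (by fun_prop)
  intro p hp
  exact closure_minimal h hc hp

/-- A symmetric operator to whose closure an essentially self-adjoint operator can be transplanted
by a surjective isometry is itself essentially self-adjoint. -/
theorem IsSymmetricOp.isEssentiallySelfAdjoint_of_transplant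
    {K : Type*} [NormedAddCommGroup K] [InnerProductSpace 𝕜 K] [CompleteSpace K]
    {A : H →ₗ.[𝕜] H} (hA : IsSymmetricOp A) {B : K →ₗ.[𝕜] K} (hB : IsEssentiallySelfAdjoint B)
    (U : K →ₗᵢ[𝕜] H) (hU : Function.Surjective U)
    (h : ∀ p ∈ B.graph, (U p.1, -U p.2) ∈ A.graph.topologicalClosure) :
    IsEssentiallySelfAdjoint A := by
  obtain ⟨hd, hsym⟩ := hA
  obtain ⟨hBd, hBc, hBs⟩ := hB
  have hclosable : A.IsClosable :=
    (LinearPMap.adjoint_isClosed hd).isClosable.leIsClosable hsym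
  have hg := hclosable.graph_closure_eq_closure_graph
  have hd' : Dense (A.closure.domain : Set H) := hd.mono A.le_closure.1
  have hBd' : Dense (B.closure.domain : Set K) := hBd.mono B.le_closure.1
  have hUc : ∀ p ∈ B.closure.graph, (U p.1, -U p.2) ∈ A.graph.topologicalClosure := by
    rw [← hBc.graph_closure_eq_closure_graph]
    have hcl : IsClosed {p : K × K | (U p.1, -U p.2) ∈ A.graph.topologicalClosure} :=
      A.graph.isClosed_topologicalClosure.preimage
        ((U.continuous.comp continuous_fst).prodMk (U.continuous.comp continuous_snd).neg)
    intro p hp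
    exact closure_minimal h hcl hp
  have hcl : A.closure.graph ≤ A.adjoint.graph := by
    rw [← hg]
    exact Submodule.topologicalClosure_minimal _ (LinearPMap.le_graph_of_le hsym)
      (LinearPMap.adjoint_isClosed hd)
  refine ⟨hd, hclosable, ?_⟩
  rw [LinearPMap.isSelfAdjoint_def]
  apply LinearPMap.eq_of_eq_graph
  ext ⟨u, v⟩
  rw [LinearPMap.mem_adjoint_graph_iff hd']
  constructor
  · intro huv
    obtain ⟨x, rfl⟩ := hU u
    obtain ⟨y, rfl⟩ := hU v
    -- Pulled back through `U`, the adjoint relation for the closure of `A` becomes the one for the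
    -- closure of `B`, up to a sign in the second slot; that closure is its own adjoint.
    have : (x, -y) ∈ B.closure.graph := by
      rw [← LinearPMap.isSelfAdjoint_def.1 hBs, LinearPMap.mem_adjoint_graph_iff hBd']
      intro p hp
      have := huv _ (hg ▸ hUc p hp)
      simp only [inner_neg_left, LinearIsometry.inner_map_map] at this
      rw [inner_neg_right, ← this, neg_neg]
    have := hUc _ this
    rw [← hg]
    simpa using this
  · intro huv
    rw [← hg]
    exact inner_eq_inner_of_mem_closure ((LinearPMap.mem_adjoint_graph_iff hd _ _).1 (hcl huv))

/-! ### Resolvents of nonpositive self-adjoint graphs -/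

section Resolvent

variable {Γ : Submodule 𝕜 (H × H)}

/-- Dissipativity: pair `l • p.1 - p.2` with `p.1` and apply Cauchy–Schwarz. -/
theorem mul_norm_le_of_nonpos {l : ℝ} {p : H × H} (hp : RCLike.re ⟪p.2, p.1⟫_𝕜 ≤ 0) :
    l * ‖p.1‖ ≤ ‖(l : 𝕜) • p.1 - p.2‖ := by
  rcases eq_or_ne p.1 0 with h0 | h0
  · simp [h0]
  have h1 : l * ‖p.1‖ ^ 2 ≤ RCLike.re ⟪(l : 𝕜) • p.1 - p.2, p.1⟫_𝕜 := by
    rw [inner_sub_left, inner_smul_left, map_sub, RCLike.conj_ofReal, RCLike.re_ofReal_mul,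
      inner_self_eq_norm_sq]
    linarith
  have h2 := h1.trans (re_inner_le_norm _ _)
  have h3 : 0 < ‖p.1‖ := norm_pos_iff.2 h0
  nlinarith

/-- Here `hadj` says that `Γ` is its own adjoint graph. By dissipativity `p ↦ l • p.1 - p.2` is
bounded below on the complete space `Γ`, so its range is closed; a vector `y` orthogonal to the
range satisfies `(y, l • y) ∈ Γ`, and nonpositivity forces `y = 0`. -/
theorem exists_resolvent
    (hadj : ∀ u v : H, (u, v) ∈ Γ ↔ ∀ p ∈ Γ, ⟪p.2, u⟫_𝕜 = ⟪p.1, v⟫_𝕜)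
    (hneg : ∀ p ∈ Γ, RCLike.re ⟪p.2, p.1⟫_𝕜 ≤ 0) {l : ℝ} (hl : 0 < l) :
    ∃ R : H →L[𝕜] H, (∀ h, (R h, (l : 𝕜) • R h - h) ∈ Γ) ∧
      (∀ p ∈ Γ, R ((l : 𝕜) • p.1 - p.2) = p.1) ∧ ∀ h, l * ‖R h‖ ≤ ‖h‖ := by
  have hclosed : IsClosed (Γ : Set (H × H)) := by
    have : (Γ : Set (H × H)) = ⋂ p ∈ Γ, {q : H × H | ⟪p.2, q.1⟫_𝕜 = ⟪p.1, q.2⟫_𝕜} := by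
      ext ⟨u, v⟩
      simp only [Set.mem_iInter, Set.mem_ofPred_eq]
      exact hadj u v
    rw [this]
    exact isClosed_biInter fun p _ => isClosed_eq (by fun_prop) (by fun_prop)
  let L : Γ →L[𝕜] H := ((l : 𝕜) • ContinuousLinearMap.fst 𝕜 H H -
    ContinuousLinearMap.snd 𝕜 H H).comp Γ.subtypeL
  have hL : ∀ p : Γ, L p = (l : 𝕜) • p.1.1 - p.1.2 := fun p => rfl
  have hL1 : ∀ p : Γ, l * ‖p.1.1‖ ≤ ‖L p‖ := fun p => mul_norm_le_of_nonpos (hneg p.1 p.2)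
  have hL2 : ∀ p : Γ, ‖p.1.2‖ ≤ 2 * ‖L p‖ := fun p => by
    have h1 : p.1.2 = (l : 𝕜) • p.1.1 - L p := by rw [hL]; abel
    calc ‖p.1.2‖ ≤ ‖(l : 𝕜) • p.1.1‖ + ‖L p‖ := by
          conv_lhs => rw [h1]
          exact norm_sub_le _ _
      _ ≤ 2 * ‖L p‖ := by
          rw [norm_smul, RCLike.norm_ofReal, abs_of_pos hl]
          linarith [hL1 p]
  -- The norm on `Γ` is the maximum of the two coordinate norms: `l⁻¹` controls the first, `2` the
  -- second, and their sum both.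
  have hanti : AntilipschitzWith (l⁻¹ + 2).toNNReal L := by
    refine AddMonoidHomClass.antilipschitz_of_bound L fun p => ?_
    rw [Real.coe_toNNReal _ (by positivity)]
    have h0 := norm_nonneg (L p)
    have h1 : ‖p.1.1‖ ≤ l⁻¹ * ‖L p‖ := by
      rw [inv_mul_eq_div, le_div_iff₀ hl, mul_comm]; exact hL1 p
    have h2 : 0 ≤ l⁻¹ * ‖L p‖ := by positivity
    change ‖p.1‖ ≤ _
    rw [Prod.norm_def, max_le_iff]
    constructor
    · linarith
    · linarith [hL2 p]
  have : CompleteSpace Γ := hclosed.completeSpace_coe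
  have hrange : IsClosed (Set.range L) := hanti.isClosed_range L.uniformContinuous
  have hsurj : L.range = ⊤ := by
    have : CompleteSpace L.range :=
      (show IsClosed (L.range : Set H) from hrange).completeSpace_coe
    rw [← Submodule.orthogonal_eq_bot_iff, Submodule.eq_bot_iff]
    intro y hy
    rw [Submodule.mem_orthogonal] at hy
    have hyΓ : (y, (l : 𝕜) • y) ∈ Γ := by
      rw [hadj]
      intro p hp
      have h1 := hy (L ⟨p, hp⟩) ⟨⟨p, hp⟩, rfl⟩
      rw [hL, inner_sub_left, inner_smul_left, RCLike.conj_ofReal, sub_eq_zero] at h1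
      rw [inner_smul_right, ← h1]
    have h2 := hneg _ hyΓ
    simp only [inner_smul_left, RCLike.conj_ofReal, RCLike.re_ofReal_mul,
      inner_self_eq_norm_sq] at h2
    have h3 : ‖y‖ ^ 2 ≤ 0 := by nlinarith [sq_nonneg ‖y‖]
    have h4 : ‖y‖ = 0 := by nlinarith [sq_nonneg ‖y‖, norm_nonneg y]
    exact norm_eq_zero.1 h4
  let e : Γ ≃ₗ[𝕜] H := LinearEquiv.ofBijective L.toLinearMap
    ⟨hanti.injective, LinearMap.range_eq_top.1 hsurj⟩
  have he : ∀ p, e p = L p := fun p => rfl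
  have heb : ∀ h, l * ‖((e.symm h : Γ) : H × H).1‖ ≤ ‖h‖ := fun h => by
    have := hL1 (e.symm h)
    rwa [← he, e.apply_symm_apply] at this
  refine ⟨LinearMap.mkContinuous ((LinearMap.fst 𝕜 H H).comp (Γ.subtype.comp e.symm.toLinearMap))
    l⁻¹ fun h => ?_, fun h => ?_, fun p hp => ?_, fun h => ?_⟩
  · rw [inv_mul_eq_div, le_div_iff₀ hl, mul_comm]
    exact heb h
  · have h1 : (l : 𝕜) • (e.symm h : H × H).1 - h = (e.symm h : H × H).2 := by
      have := hL (e.symm h)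
      rw [← he, e.apply_symm_apply] at this
      conv_lhs => enter [2]; rw [this]
      abel
    have h2 := (e.symm h).2
    change ((e.symm h : H × H).1, (l : 𝕜) • (e.symm h : H × H).1 - h) ∈ Γ
    rw [h1]
    exact h2
  · change (e.symm (e ⟨p, hp⟩) : H × H).1 = p.1
    rw [e.symm_apply_apply]
  · exact heb h

end Resolvent

/-! ### Bounded approximations -/

section BoundedSemigroup

theorem norm_exp_le_exp_norm_of_clm (x : H →L[𝕜] H) : ‖NormedSpace.exp x‖ ≤ Real.exp ‖x‖ := by
  rcases subsingleton_or_nontrivial H with hs | hn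
  · have : NormedSpace.exp x = 0 := Subsingleton.elim _ _
    rw [this, norm_zero]
    positivity
  · have hsum : HasSum (fun n : ℕ => ‖x‖ ^ n / (n.factorial : ℝ)) (Real.exp ‖x‖) := by
      rw [Real.exp_eq_exp_ℝ]
      exact NormedSpace.expSeries_div_hasSum_exp ‖x‖
    rw [NormedSpace.exp_eq_tsum 𝕜]
    refine tsum_of_norm_bounded hsum fun n => ?_
    rw [norm_smul, norm_inv, RCLike.norm_natCast, inv_mul_eq_div]
    gcongr
    exact norm_pow_le x n

/-- `e^{r(J-1)} = e^{-r} e^{rJ}`, and the second factor has norm at most `e^r`. With `r = t (n + 1)`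
this is contractivity of the Yosida semigroups. -/
theorem norm_exp_smul_sub_one_le_one {J : H →L[𝕜] H} (hJ : ‖J‖ ≤ 1) {r : ℝ} (hr : 0 ≤ r) :
    ‖NormedSpace.exp ((r : 𝕜) • (J - 1))‖ ≤ 1 := by
  let : NormedAlgebra ℚ (H →L[𝕜] H) := NormedAlgebra.restrictScalars ℚ 𝕜 _
  have h1 : (r : 𝕜) • (J - 1) = (r : 𝕜) • J + algebraMap 𝕜 (H →L[𝕜] H) (-(r : 𝕜)) := by
    rw [smul_sub, map_neg, Algebra.algebraMap_eq_smul_one, sub_eq_add_neg]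
  have h2 : NormedSpace.exp (algebraMap 𝕜 (H →L[𝕜] H) (-(r : 𝕜))) =
      algebraMap 𝕜 (H →L[𝕜] H) ((Real.exp (-r) : ℝ) : 𝕜) := by
    rw [← NormedSpace.algebraMap_exp_comm]
    congr 1
    rw [Real.exp_eq_exp_ℝ]
    let : NormedAlgebra ℚ 𝕜 := NormedAlgebra.restrictScalars ℚ ℝ 𝕜
    have := NormedSpace.algebraMap_exp_comm (𝕂 := ℝ) (𝔸 := 𝕜) (-r)
    rw [RCLike.algebraMap_eq_ofReal] at this
    rw [this]
    simp
  rw [h1, NormedSpace.exp_add_of_commute (Algebra.commutes _ _).symm, h2]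
  calc _ ≤ ‖NormedSpace.exp ((r : 𝕜) • J)‖ * ‖algebraMap 𝕜 (H →L[𝕜] H) ((Real.exp (-r) : ℝ) : 𝕜)‖ :=
        norm_mul_le _ _
    _ ≤ Real.exp r * Real.exp (-r) := by
        gcongr
        · refine (norm_exp_le_exp_norm_of_clm _).trans ?_
          rw [norm_smul, RCLike.norm_ofReal, abs_of_nonneg hr]
          gcongr
          nlinarith
        · rw [Algebra.algebraMap_eq_smul_one, norm_smul, RCLike.norm_ofReal,
            abs_of_pos (Real.exp_pos _)]
          have := ContinuousLinearMap.norm_id_le (𝕜 := 𝕜) (E := H)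
          have h3 := Real.exp_pos (-r)
          change _ * ‖ContinuousLinearMap.id 𝕜 H‖ ≤ _
          nlinarith
    _ = 1 := by rw [← Real.exp_add]; simp

variable [NormedSpace ℝ H] [IsScalarTower ℝ 𝕜 H]

theorem hasDerivAt_exp_smul_apply (B C : H →L[𝕜] H) (u : H) (t : ℝ) :
    HasDerivAt (fun s : ℝ => NormedSpace.exp ((s : 𝕜) • B) (C u))
      (NormedSpace.exp ((t : 𝕜) • B) (B (C u))) t := by
  have h1 := (hasDerivAt_exp_smul_const (𝕂 := 𝕜) B (t : 𝕜))
  have h2 : HasDerivAt (fun s : 𝕜 => NormedSpace.exp (s • B) (C u))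
      ((NormedSpace.exp ((t : 𝕜) • B) * B) (C u)) (t : 𝕜) :=
    ((ContinuousLinearMap.apply 𝕜 H (C u)).hasFDerivAt.comp_hasDerivAt (t : 𝕜) h1)
  have h3 : HasDerivAt (fun s : ℝ => (s : 𝕜)) 1 t := by
    simpa using (RCLike.ofRealCLM (K := 𝕜)).hasDerivAt (x := t)
  have h4 := h2.scomp t h3
  rwa [one_smul] at h4

/-- The curve `s ↦ e^{sB} e^{(t-s)C} u` joins `e^{tC} u` to `e^{tB} u`, and its derivative `e^{sB}
e^{(t-s)C} (B - C) u` has norm at most `‖B u - C u‖`. Writing the curve as `e^{s(B-C)} e^{tC} u`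
leaves a single exponential to differentiate. -/
theorem norm_exp_sub_exp_le {B C : H →L[𝕜] H} (hBC : Commute B C)
    (hB : ∀ t : ℝ, 0 ≤ t → ‖NormedSpace.exp ((t : 𝕜) • B)‖ ≤ 1)
    (hC : ∀ t : ℝ, 0 ≤ t → ‖NormedSpace.exp ((t : 𝕜) • C)‖ ≤ 1) {t : ℝ} (ht : 0 ≤ t) (u : H) :
    ‖NormedSpace.exp ((t : 𝕜) • B) u - NormedSpace.exp ((t : 𝕜) • C) u‖ ≤ ‖B u - C u‖ * t := by
  let : NormedAlgebra ℚ (H →L[𝕜] H) := NormedAlgebra.restrictScalars ℚ 𝕜 _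
  have hcomm : ∀ s t : ℝ, Commute ((s : 𝕜) • B) ((t : 𝕜) • C) := fun s t =>
    (hBC.smul_left _).smul_right _
  have key : ∀ s : ℝ, NormedSpace.exp ((s : 𝕜) • (B - C)) * NormedSpace.exp ((t : 𝕜) • C) =
      NormedSpace.exp ((s : 𝕜) • B) * NormedSpace.exp (((t - s : ℝ) : 𝕜) • C) := fun s => by
    have hc1 : Commute ((s : 𝕜) • (B - C)) ((t : 𝕜) • C) :=
      ((hBC.sub_left (Commute.refl C)).smul_left _).smul_right _
    rw [← NormedSpace.exp_add_of_commute hc1, ← NormedSpace.exp_add_of_commute (hcomm _ _)]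
    congr 1
    push_cast
    module
  have hder : ∀ s ∈ Set.Icc (0 : ℝ) t, HasDerivWithinAt
      (fun s : ℝ => NormedSpace.exp ((s : 𝕜) • (B - C)) (NormedSpace.exp ((t : 𝕜) • C) u))
      (NormedSpace.exp ((s : 𝕜) • (B - C)) ((B - C) (NormedSpace.exp ((t : 𝕜) • C) u)))
      (Set.Icc 0 t) s := fun s _ => (hasDerivAt_exp_smul_apply (B - C) _ u s).hasDerivWithinAt
  have hcomm2 : Commute (B - C) (NormedSpace.exp ((t : 𝕜) • C)) :=
    ((hBC.sub_left (Commute.refl C)).smul_right (t : 𝕜)).exp_right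
  have hbound : ∀ s ∈ Set.Ico (0 : ℝ) t,
      ‖NormedSpace.exp ((s : 𝕜) • (B - C)) ((B - C) (NormedSpace.exp ((t : 𝕜) • C) u))‖ ≤
        ‖B u - C u‖ := fun s hs => by
    have h1 : (B - C) (NormedSpace.exp ((t : 𝕜) • C) u) =
        NormedSpace.exp ((t : 𝕜) • C) ((B - C) u) := by
      rw [← mul_apply_eq_comp, hcomm2.eq, mul_apply_eq_comp]
    rw [h1, ← mul_apply_eq_comp, key s, ← sub_apply]
    refine (ContinuousLinearMap.le_opNorm _ _).trans ?_
    refine mul_le_of_le_one_left (norm_nonneg _) ((norm_mul_le _ _).trans ?_)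
    exact mul_le_one₀ (hB s hs.1) (norm_nonneg _) (hC _ (by linarith [hs.2]))
  have := norm_image_sub_le_of_norm_deriv_le_segment' hder hbound t (Set.right_mem_Icc.2 ht)
  rw [← mul_apply_eq_comp, key t, ← mul_apply_eq_comp, key 0] at this
  simpa using this

theorem norm_exp_sub_self_le {B : H →L[𝕜] H}
    (hB : ∀ t : ℝ, 0 ≤ t → ‖NormedSpace.exp ((t : 𝕜) • B)‖ ≤ 1) {t : ℝ} (ht : 0 ≤ t) (u : H) :
    ‖NormedSpace.exp ((t : 𝕜) • B) u - u‖ ≤ ‖B u‖ * t := by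
  have h := norm_exp_sub_exp_le (Commute.zero_right B) hB (fun s _ => by
    simpa using! ContinuousLinearMap.norm_id_le (𝕜 := 𝕜) (E := H)) ht u
  simpa using h

/-- The derivative of `e^{sB} u - s v` is `e^{sB} B u - v`. The operator enters the bound only
through `M`, so the estimate survives the limit along Yosida approximations. -/
theorem norm_exp_sub_self_sub_le {B : H →L[𝕜] H} {t M : ℝ} (ht : 0 ≤ t) (u v : H)
    (hM : ∀ s ∈ Set.Ico (0 : ℝ) t, ‖NormedSpace.exp ((s : 𝕜) • B) (B u) - v‖ ≤ M) :
    ‖NormedSpace.exp ((t : 𝕜) • B) u - u - t • v‖ ≤ M * t := by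
  have hder : ∀ s ∈ Set.Icc (0 : ℝ) t, HasDerivWithinAt
      (fun s : ℝ => NormedSpace.exp ((s : 𝕜) • B) u - s • v)
      (NormedSpace.exp ((s : 𝕜) • B) (B u) - v) (Set.Icc 0 t) s := fun s _ => by
    have h1 := hasDerivAt_exp_smul_apply B (ContinuousLinearMap.id 𝕜 H) u s
    have h2 : HasDerivAt (fun s : ℝ => s • v) v s := by
      simpa using (hasDerivAt_id s).smul_const v
    exact (h1.sub h2).hasDerivWithinAt
  have := norm_image_sub_le_of_norm_deriv_le_segment' hder hM t (Set.right_mem_Icc.2 ht)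
  simp only [map_zero, zero_smul, NormedSpace.exp_zero, sub_zero] at this
  convert this using 2
  simp only [one_apply_eq_self]
  abel

end BoundedSemigroup
end AbstractOperators

/-! ### Yosida approximation and the contraction semigroup. -/

section Generation

variable {𝕜 : Type*} [RCLike 𝕜] {H : Type*} [NormedAddCommGroup H] [InnerProductSpace 𝕜 H]
  [CompleteSpace H]

theorem ContinuousLinearMap.dist_le_of_opNorm_le_one {S : H →L[𝕜] H} (hS : ‖S‖ ≤ 1) (u : H) :
    ‖S u‖ ≤ ‖u‖ :=
  (S.le_opNorm u).trans (mul_le_of_le_one_left (norm_nonneg _) hS)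

/-- Strong Cauchy convergence of contractions can be checked on a dense set. -/
theorem cauchySeq_apply_of_dense {D : Set H} (hD : Dense D) {f : ℕ → H →L[𝕜] H}
    (hf : ∀ n, ‖f n‖ ≤ 1) (h : ∀ u ∈ D, CauchySeq fun n => f n u) (u : H) :
    CauchySeq fun n => f n u := by
  rw [Metric.cauchySeq_iff]
  intro ε hε
  obtain ⟨w, hw, hwu⟩ := Metric.dense_iff.1 hD u (ε / 4) (by positivity)
  obtain ⟨N, hN⟩ := Metric.cauchySeq_iff.1 (h _ hwu) (ε / 4) (by positivity)
  refine ⟨N, fun m hm n hn => ?_⟩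
  have h1 : ∀ k, dist (f k u) (f k w) ≤ dist w u := fun k => by
    rw [dist_eq_norm, ← map_sub, dist_comm, dist_eq_norm]
    exact ContinuousLinearMap.dist_le_of_opNorm_le_one (hf k) _
  have h2 := dist_triangle4 (f m u) (f m w) (f n w) (f n u)
  have h3 := h1 n
  rw [dist_comm] at h3
  have h4 := hN m hm n hn
  have h5 : dist w u < ε / 4 := hw
  linarith [h1 m]

/-- Strong convergence of contractions can be checked on a dense set. -/
theorem tendsto_apply_of_dense {ι : Type*} {l : Filter ι} {D : Set H} (hD : Dense D)
    {f : ι → H →L[𝕜] H} (hf : ∀ n, ‖f n‖ ≤ 1) {g : H →L[𝕜] H} (hg : ‖g‖ ≤ 1)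
    (h : ∀ u ∈ D, Tendsto (fun n => f n u) l (𝓝 (g u))) (u : H) :
    Tendsto (fun n => f n u) l (𝓝 (g u)) := by
  rw [Metric.tendsto_nhds]
  intro ε hε
  obtain ⟨w, hw, hwu⟩ := Metric.dense_iff.1 hD u (ε / 4) (by positivity)
  filter_upwards [Metric.tendsto_nhds.1 (h _ hwu) (ε / 4) (by positivity)] with n hn
  have h1 : ∀ k : H →L[𝕜] H, ‖k‖ ≤ 1 → dist (k u) (k w) ≤ dist w u := fun k hk => by
    rw [dist_eq_norm, ← map_sub, dist_comm, dist_eq_norm]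
    exact ContinuousLinearMap.dist_le_of_opNorm_le_one hk _
  have h2 := dist_triangle4 (f n u) (f n w) (g w) (g u)
  have h3 := h1 g hg
  rw [dist_comm] at h3
  have h5 : dist w u < ε / 4 := hw
  linarith [h1 _ (hf n)]

variable {Γ : Submodule 𝕜 (H × H)}

/-- A nonpositive self-adjoint graph is approximated by bounded symmetric generators of
contraction semigroups, namely its Yosida approximations. -/
theorem exists_bounded_approximation
    (hadj : ∀ u v : H, (u, v) ∈ Γ ↔ ∀ p ∈ Γ, ⟪p.2, u⟫_𝕜 = ⟪p.1, v⟫_𝕜)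
    (hneg : ∀ p ∈ Γ, RCLike.re ⟪p.2, p.1⟫_𝕜 ≤ 0)
    (hdense : Dense {u : H | ∃ v, (u, v) ∈ Γ}) :
    ∃ B : ℕ → H →L[𝕜] H, (∀ n m, Commute (B n) (B m)) ∧
      (∀ n x y, ⟪B n x, y⟫_𝕜 = ⟪x, B n y⟫_𝕜) ∧
      (∀ n (t : ℝ), 0 ≤ t → ‖NormedSpace.exp ((t : 𝕜) • B n)‖ ≤ 1) ∧
      (∀ u v, (u, v) ∈ Γ → Tendsto (fun n => B n u) atTop (𝓝 v)) ∧
      ∀ u v, (u, v) ∈ Γ → ∀ n, ‖B n u‖ ≤ ‖v‖ := by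
  have hpos : ∀ n : ℕ, (0 : ℝ) < n + 1 := fun n => by positivity
  choose R hR1 hR2 hR3 using fun n : ℕ => exists_resolvent hadj hneg (hpos n)
  -- Adding the two resolvent identities, for `R n` after `R m` and for `R m` after `R n`, gives `(n
  -- - m) (R n R m - R m R n) = 0`.
  have hRcomm : ∀ n m, Commute (R n) (R m) := fun n m => by
    rcases eq_or_ne n m with rfl | hnm
    · exact Commute.refl _
    ext h
    have h1 := hR2 n _ (hR1 m h)
    have h2 := hR2 m _ (hR1 n h)
    simp only [map_sub, map_smul] at h1 h2
    have h3 : (((n : ℝ) - m : ℝ) : 𝕜) • (R n (R m h) - R m (R n h)) = 0 := by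
      have h4 : (((n : ℝ) - m : ℝ) : 𝕜) • (R n (R m h) - R m (R n h)) =
        ((((n : ℝ) + 1 : ℝ) : 𝕜) • R n (R m h) - ((((m : ℝ) + 1 : ℝ) : 𝕜) • R n (R m h) - R n h)) +
        ((((m : ℝ) + 1 : ℝ) : 𝕜) • R m (R n h) - ((((n : ℝ) + 1 : ℝ) : 𝕜) • R m (R n h) - R m h))
          - R m h - R n h := by
        push_cast
        module
      rw [h4, h1, h2]
      abel
    have h5 : (((n : ℝ) - m : ℝ) : 𝕜) ≠ 0 := by
      rw [Ne, RCLike.ofReal_eq_zero, sub_eq_zero]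
      exact_mod_cast hnm
    exact sub_eq_zero.1 ((smul_eq_zero.1 h3).resolve_left h5)
  have hRsymm : ∀ n x y, ⟪R n x, y⟫_𝕜 = ⟪x, R n y⟫_𝕜 := fun n x y => by
    have h1 := (hadj _ _).1 (hR1 n y) _ (hR1 n x)
    simp only [inner_sub_left, inner_sub_right, inner_smul_left, inner_smul_right,
      RCLike.conj_ofReal] at h1
    exact (sub_right_inj.1 h1).symm
  -- `J n` is a contraction. For `(u, v) ∈ Γ` one has `J n u - u = R n v`, of norm at most `‖v‖ / (n
  -- + 1)`, so `J n` tends strongly to the identity.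
  let J : ℕ → H →L[𝕜] H := fun n => (((n : ℝ) + 1 : ℝ) : 𝕜) • R n
  have hJ : ∀ n, ‖J n‖ ≤ 1 := fun n => by
    refine ContinuousLinearMap.opNorm_le_bound _ zero_le_one fun h => ?_
    change ‖(((n : ℝ) + 1 : ℝ) : 𝕜) • R n h‖ ≤ _
    rw [norm_smul, RCLike.norm_ofReal, abs_of_pos (hpos n), one_mul]
    exact hR3 n h
  have hJΓ : ∀ u v, (u, v) ∈ Γ → ∀ n, J n u - u = R n v := fun u v huv n => by
    have h1 := hR2 n _ huv
    simp only [map_sub, map_smul] at h1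
    change (((n : ℝ) + 1 : ℝ) : 𝕜) • R n u - u = R n v
    conv_lhs => enter [2]; rw [← h1]
    abel
  have hJlim : ∀ v, Tendsto (fun n => J n v) atTop (𝓝 v) := fun v => by
    refine tendsto_apply_of_dense hdense hJ (g := ContinuousLinearMap.id 𝕜 H)
      ContinuousLinearMap.norm_id_le ?_ v
    rintro u ⟨w, huw⟩
    rw [tendsto_iff_norm_sub_tendsto_zero]
    have hlim : Tendsto (fun n : ℕ => ‖w‖ * (1 / ((n : ℝ) + 1))) atTop (𝓝 0) := by
      simpa using tendsto_one_div_add_atTop_nhds_zero_nat.const_mul ‖w‖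
    refine squeeze_zero (fun _ => norm_nonneg _) (fun n => ?_) hlim
    rw [ContinuousLinearMap.id_apply, hJΓ u w huw n, mul_one_div, le_div_iff₀ (hpos n), mul_comm]
    exact hR3 n w
  -- The Yosida approximation: for `(u, v) ∈ Γ` it satisfies `B n u = J n v`, which tends to `v`
  -- with norm at most `‖v‖`.
  let B : ℕ → H →L[𝕜] H := fun n => (((n : ℝ) + 1 : ℝ) : 𝕜) • (J n - 1)
  have hBΓ : ∀ u v, (u, v) ∈ Γ → ∀ n, B n u = J n v := fun u v huv n => by
    change (((n : ℝ) + 1 : ℝ) : 𝕜) • (J n u - u) = _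
    rw [hJΓ u v huv n]
    rfl
  refine ⟨B, fun n m => ?_, fun n x y => ?_, fun n t ht => ?_, fun u v huv => ?_,
    fun u v huv n => ?_⟩
  · have h1 : Commute (J n) (J m) := ((hRcomm n m).smul_left _).smul_right _
    exact ((((h1.sub_left (Commute.one_left _))).sub_right
      (Commute.one_right _)).smul_left _).smul_right _
  · change ⟪(((n : ℝ) + 1 : ℝ) : 𝕜) • ((((n : ℝ) + 1 : ℝ) : 𝕜) • R n x - x), y⟫_𝕜 =
      ⟪x, (((n : ℝ) + 1 : ℝ) : 𝕜) • ((((n : ℝ) + 1 : ℝ) : 𝕜) • R n y - y)⟫_𝕜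
    simp only [inner_sub_left, inner_sub_right, inner_smul_left, inner_smul_right,
      RCLike.conj_ofReal, hRsymm]
  · have h1 : (t : 𝕜) • B n = ((t * ((n : ℝ) + 1) : ℝ) : 𝕜) • (J n - 1) := by
      change (t : 𝕜) • ((((n : ℝ) + 1 : ℝ) : 𝕜) • (J n - 1)) = _
      rw [smul_smul, RCLike.ofReal_mul]
    rw [h1]
    exact norm_exp_smul_sub_one_le_one (hJ n) (mul_nonneg ht (hpos n).le)
  · simp only [hBΓ u v huv]
    exact hJlim v
  · rw [hBΓ u v huv]
    exact ContinuousLinearMap.dist_le_of_opNorm_le_one (hJ n) v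

variable [NormedSpace ℝ H] [IsScalarTower ℝ 𝕜 H]

/-- A nonpositive self-adjoint graph generates a symmetric contraction semigroup. -/
theorem exists_contraction_semigroup
    (hadj : ∀ u v : H, (u, v) ∈ Γ ↔ ∀ p ∈ Γ, ⟪p.2, u⟫_𝕜 = ⟪p.1, v⟫_𝕜)
    (hneg : ∀ p ∈ Γ, RCLike.re ⟪p.2, p.1⟫_𝕜 ≤ 0)
    (hdense : Dense {u : H | ∃ v, (u, v) ∈ Γ}) :
    ∃ T : ℝ≥0 → H →L[𝕜] H, IsC0Semigroup T ∧ (∀ t, ‖T t‖ ≤ 1) ∧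
      (∀ t x y, ⟪T t x, y⟫_𝕜 = ⟪x, T t y⟫_𝕜) ∧
      ∀ u v : H, (u, v) ∈ Γ ↔ Tendsto (fun t : ℝ≥0 => ((((t : ℝ)⁻¹ : ℝ) : 𝕜)) • (T t u - u))
        (𝓝[>] 0) (𝓝 v) := by
  let : NormedAlgebra ℚ (H →L[𝕜] H) := NormedAlgebra.restrictScalars ℚ 𝕜 _
  obtain ⟨B, hcomm, hsymm, hexp, hlim, hbd⟩ := exists_bounded_approximation hadj hneg hdense
  let S : ℕ → ℝ≥0 → H →L[𝕜] H := fun n t => NormedSpace.exp (((t : ℝ) : 𝕜) • B n)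
  have hS : ∀ n t, ‖S n t‖ ≤ 1 := fun n t => hexp n t t.2
  have hcauchy : ∀ t u, CauchySeq fun n => S n t u := fun t u => by
    refine cauchySeq_apply_of_dense hdense (fun n => hS n t) ?_ u
    rintro w ⟨v, hwv⟩
    have h1 := (hlim w v hwv).cauchySeq
    rw [Metric.cauchySeq_iff] at h1 ⊢
    intro ε hε
    -- Dividing by `t + 1` rather than `t` includes the case `t = 0`.
    have ht : (0 : ℝ) < t + 1 := by positivity
    obtain ⟨N, hN⟩ := h1 (ε / (t + 1)) (by positivity)
    refine ⟨N, fun m hm n hn => ?_⟩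
    have h2 := norm_exp_sub_exp_le (hcomm m n) (hexp m) (hexp n) t.2 w
    have h3 := hN m hm n hn
    rw [dist_eq_norm, lt_div_iff₀ ht] at h3
    rw [dist_eq_norm]
    have h4 : ‖S m t w - S n t w‖ ≤ ‖B m w - B n w‖ * t := h2
    nlinarith [norm_nonneg (B m w - B n w)]
  choose f hf using fun t u => cauchySeq_tendsto_of_complete (hcauchy t u)
  let T : ℝ≥0 → H →L[𝕜] H := fun t =>
    continuousLinearMapOfTendsto (fun n => S n t) (f := f t) (tendsto_pi_nhds.2 (hf t))
  have hT : ∀ t u, Tendsto (fun n => S n t u) atTop (𝓝 (T t u)) := hf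
  have hT1 : ∀ t, ‖T t‖ ≤ 1 := fun t => by
    refine ContinuousLinearMap.opNorm_le_bound _ zero_le_one fun u => ?_
    rw [one_mul]
    exact le_of_tendsto (hT t u).norm (Eventually.of_forall fun n =>
      ContinuousLinearMap.dist_le_of_opNorm_le_one (hS n t) u)
  have hTsymm : ∀ t x y, ⟪T t x, y⟫_𝕜 = ⟪x, T t y⟫_𝕜 := fun t x y => by
    refine tendsto_nhds_unique ((hT t x).inner tendsto_const_nhds)
      (Tendsto.congr (fun n => ?_) (tendsto_const_nhds.inner (hT t y)))
    have h1 : IsSelfAdjoint (((t : ℝ) : 𝕜) • B n) := by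
      rw [ContinuousLinearMap.isSelfAdjoint_iff_isSymmetric]
      intro x y
      change ⟪((t : ℝ) : 𝕜) • B n x, y⟫_𝕜 = ⟪x, ((t : ℝ) : 𝕜) • B n y⟫_𝕜
      rw [inner_smul_left, inner_smul_right, RCLike.conj_ofReal, hsymm]
    exact ((ContinuousLinearMap.isSelfAdjoint_iff_isSymmetric.1 h1.exp) x y).symm
  have hTadd : ∀ s t, T (s + t) = (T s).comp (T t) := fun s t => by
    ext u
    refine tendsto_nhds_unique (hT (s + t) u) ?_
    have h1 : ∀ n, S n (s + t) u = S n s (S n t u) := fun n => by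
      change (NormedSpace.exp _ : H →L[𝕜] H) u =
        ((NormedSpace.exp _ : H →L[𝕜] H) * (NormedSpace.exp _ : H →L[𝕜] H)) u
      rw [← NormedSpace.exp_add_of_commute
        (((Commute.refl (B n)).smul_left _).smul_right _)]
      congr 2
      push_cast
      module
    simp only [h1]
    rw [tendsto_iff_norm_sub_tendsto_zero]
    have h2 := (tendsto_iff_norm_sub_tendsto_zero.1 (hT t u)).add
      (tendsto_iff_norm_sub_tendsto_zero.1 (hT s (T t u)))
    rw [add_zero] at h2
    refine squeeze_zero (fun _ => norm_nonneg _) (fun n => ?_) h2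
    calc ‖S n s (S n t u) - T s (T t u)‖
        ≤ ‖S n s (S n t u - T t u)‖ + ‖S n s (T t u) - T s (T t u)‖ := by
          rw [map_sub]; exact norm_sub_le_norm_sub_add_norm_sub _ _ _
      _ ≤ _ := by
          gcongr
          exact ContinuousLinearMap.dist_le_of_opNorm_le_one (hS n s) _
  have hT0 : T 0 = ContinuousLinearMap.id 𝕜 H := by
    ext u
    refine tendsto_nhds_unique (hT 0 u) ?_
    simp [S, NormedSpace.exp_zero]
  have hTlip : ∀ u v, (u, v) ∈ Γ → ∀ t, ‖T t u - u‖ ≤ ‖v‖ * t := fun u v huv t => by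
    refine le_of_tendsto ((hT t u).sub_const u).norm (Eventually.of_forall fun n => ?_)
    exact (norm_exp_sub_self_le (hexp n) t.2 u).trans (by gcongr; exacts [t.2, hbd u v huv n, le_rfl])
  have hcont : ∀ u, Continuous fun t : ℝ≥0 => T t u := fun u => by
    rw [continuous_iff_continuousAt]
    intro s
    refine tendsto_apply_of_dense hdense hT1 (hT1 s) ?_ u
    rintro w ⟨v, hwv⟩
    have h1 : ∀ a b : ℝ≥0, a ≤ b → ‖T b w - T a w‖ ≤ ‖v‖ * dist b a := fun a b hab => by
      obtain ⟨c, rfl⟩ := exists_add_of_le hab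
      rw [hTadd, ContinuousLinearMap.comp_apply, ← map_sub]
      refine (ContinuousLinearMap.dist_le_of_opNorm_le_one (hT1 a) _).trans ?_
      have h2 : dist (a + c) a = c := by
        rw [NNReal.dist_eq]; push_cast; rw [add_sub_cancel_left, NNReal.abs_eq]
      rw [h2]
      exact hTlip w v hwv c
    rw [tendsto_iff_norm_sub_tendsto_zero]
    have h3 : Tendsto (fun t : ℝ≥0 => ‖v‖ * dist t s) (𝓝 s) (𝓝 0) := by
      have : Tendsto (fun t : ℝ≥0 => dist t s) (𝓝 s) (𝓝 0) := tendsto_iff_dist_tendsto_zero.1 tendsto_id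
      simpa using this.const_mul ‖v‖
    refine squeeze_zero (fun _ => norm_nonneg _) (fun t => ?_) h3
    rcases le_total s t with h | h
    · exact h1 s t h
    · rw [norm_sub_rev, dist_comm]; exact h1 t s h
  have hgen : ∀ u v, (u, v) ∈ Γ → Tendsto
      (fun t : ℝ≥0 => ((((t : ℝ)⁻¹ : ℝ) : 𝕜)) • (T t u - u)) (𝓝[>] 0) (𝓝 v) := fun u v huv => by
    rw [Metric.tendsto_nhdsWithin_nhds]
    intro ε hε
    -- Since `v` may lie outside the domain, it is replaced by a nearby `w` in the domain, for which
    -- `‖Q w - w‖ ≤ ‖w'‖ t` holds uniformly in the approximation index.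
    obtain ⟨w, hw, w', hww'⟩ := Metric.dense_iff.1 hdense v (ε / 4) (by positivity)
    have hwv : ‖v - w‖ < ε / 4 := by rw [← dist_eq_norm, dist_comm]; exact hw
    have hest : ∀ t : ℝ≥0, ‖T t u - u - (t : ℝ) • v‖ ≤ (2 * (ε / 4) + ‖w'‖ * t) * t := fun t => by
      have h1 : Tendsto (fun n => (‖B n u - v‖ + (2 * (ε / 4) + ‖w'‖ * t)) * t) atTop
          (𝓝 ((0 + (2 * (ε / 4) + ‖w'‖ * t)) * t)) :=
        (((tendsto_iff_norm_sub_tendsto_zero.1 (hlim u v huv)).add_const _).mul_const _)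
      rw [zero_add] at h1
      refine le_of_tendsto_of_tendsto (((hT t u).sub_const u).sub_const _).norm h1
        (Eventually.of_forall fun n => ?_)
      refine norm_exp_sub_self_sub_le t.2 u v fun s hs => ?_
      have h2 := hexp n s hs.1
      set Q := NormedSpace.exp ((s : 𝕜) • B n) with hQ
      have h3 : ‖Q w - w‖ ≤ ‖w'‖ * t := by
        refine (norm_exp_sub_self_le (hexp n) hs.1 w).trans ?_
        gcongr
        · exact hs.1
        · exact hbd w w' hww' n
        · exact hs.2.le
      have h4 : Q (B n u) - v = Q (B n u - v) + (Q (v - w) + (Q w - w) - (v - w)) := by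
        simp only [map_sub]; abel
      rw [h4]
      refine (norm_add_le _ _).trans (add_le_add
        (ContinuousLinearMap.dist_le_of_opNorm_le_one h2 _) ?_)
      refine (norm_sub_le _ _).trans ?_
      have h5 := norm_add_le (Q (v - w)) (Q w - w)
      have h6 := ContinuousLinearMap.dist_le_of_opNorm_le_one h2 (v - w)
      linarith
    -- This radius makes `‖w'‖ t < ε / 4`, so the bound in `hest` stays below `(3/4) ε t`.
    refine ⟨ε / (4 * (‖w'‖ + 1)), by positivity, fun {t} ht htd => ?_⟩
    have ht0 : (0 : ℝ) < t := ht
    have htd' : (t : ℝ) * (4 * (‖w'‖ + 1)) < ε := by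
      rw [NNReal.dist_eq, NNReal.coe_zero, sub_zero, abs_of_pos ht0] at htd
      rwa [lt_div_iff₀ (by positivity)] at htd
    have h1 : ((((t : ℝ)⁻¹ : ℝ) : 𝕜)) • (T t u - u) - v =
        ((((t : ℝ)⁻¹ : ℝ) : 𝕜)) • (T t u - u - (t : ℝ) • v) := by
      rw [smul_sub _ (T t u - u), ← RCLike.real_smul_eq_coe_smul (K := 𝕜) (t : ℝ)⁻¹ ((t : ℝ) • v),
        smul_smul, inv_mul_cancel₀ ht0.ne', one_smul]
    rw [dist_eq_norm, h1, norm_smul, RCLike.norm_ofReal, abs_of_pos (inv_pos.2 ht0),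
      inv_mul_eq_div, div_lt_iff₀ ht0]
    refine (hest t).trans_lt ?_
    gcongr
    nlinarith [norm_nonneg w']
  refine ⟨T, ⟨hT0, hTadd, hcont⟩, hT1, hTsymm, fun u v => ⟨hgen u v, fun h => ?_⟩⟩
  -- Conversely, the generator of a symmetric semigroup is symmetric, so each of its pairs lies in
  -- the adjoint graph of `Γ`, which is `Γ`.
  rw [hadj]
  intro p hp
  have h1 := hgen p.1 p.2 hp
  refine tendsto_nhds_unique (h1.inner tendsto_const_nhds)
    (Tendsto.congr (fun t => ?_) (tendsto_const_nhds.inner h))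
  simp only [inner_smul_left, inner_smul_right, RCLike.conj_ofReal, inner_sub_left,
    inner_sub_right, hTsymm]

end Generation

/-! ### Differentiation of orbits and uniqueness of the semigroup. -/

section Uniqueness

variable {𝕜 : Type*} [RCLike 𝕜] {H : Type*} [NormedAddCommGroup H] [InnerProductSpace 𝕜 H]
  [CompleteSpace H] {Γ : Submodule 𝕜 (H × H)} {T : ℝ≥0 → H →L[𝕜] H}

theorem IsC0Semigroup.map_mem_generator (hT : IsC0Semigroup T)
    (hgen : ∀ u v : H, (u, v) ∈ Γ ↔
      Tendsto (fun t : ℝ≥0 => ((((t : ℝ)⁻¹ : ℝ) : 𝕜)) • (T t u - u)) (𝓝[>] 0) (𝓝 v))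
    {u v : H} (huv : (u, v) ∈ Γ) (s : ℝ≥0) : (T s u, T s v) ∈ Γ := by
  rw [hgen] at huv ⊢
  refine Tendsto.congr (fun t => ?_) (((T s).continuous.tendsto v).comp huv)
  rw [Function.comp_apply, map_smul, map_sub, ← ContinuousLinearMap.comp_apply, ← hT.map_add,
    add_comm, hT.map_add, ContinuousLinearMap.comp_apply]

theorem IsC0Semigroup.continuous_toNNReal (hT : IsC0Semigroup T) (u : H) :
    Continuous fun r : ℝ => T r.toNNReal u :=
  (hT.strong_continuous u).comp continuous_real_toNNReal

variable [NormedSpace ℝ H] [IsScalarTower ℝ 𝕜 H]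

/-- The definition of the generator yields right derivatives only; at time `s` it is applied to the
pair `(T s u, T s v)`. One-sided derivatives suffice for the comparison arguments. -/
theorem IsC0Semigroup.hasDerivWithinAt (hT : IsC0Semigroup T)
    (hgen : ∀ u v : H, (u, v) ∈ Γ ↔
      Tendsto (fun t : ℝ≥0 => ((((t : ℝ)⁻¹ : ℝ) : 𝕜)) • (T t u - u)) (𝓝[>] 0) (𝓝 v))
    {u v : H} (huv : (u, v) ∈ Γ) {s : ℝ} (hs : 0 ≤ s) :
    HasDerivWithinAt (fun r : ℝ => T r.toNNReal u) (T s.toNNReal v) (Set.Ici s) s := by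
  rw [← hasDerivWithinAt_Ioi_iff_Ici, hasDerivWithinAt_iff_tendsto_slope' (by simp)]
  have h1 := (hgen _ _).1 (hT.map_mem_generator hgen huv s.toNNReal)
  have h2 : Tendsto (fun r : ℝ => (r - s).toNNReal) (𝓝[>] s) (𝓝[>] 0) := by
    refine tendsto_nhdsWithin_iff.2 ⟨?_, ?_⟩
    · have : Continuous fun r : ℝ => (r - s).toNNReal := by fun_prop
      simpa using (this.tendsto s).mono_left nhdsWithin_le_nhds
    · filter_upwards [self_mem_nhdsWithin] with r hr
      simpa using hr
  refine Tendsto.congr' ?_ (h1.comp h2)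
  filter_upwards [self_mem_nhdsWithin] with r hr
  have hr' : s < r := hr
  have h3 : (r - s).toNNReal + s.toNNReal = r.toNNReal := by
    rw [← Real.toNNReal_add (by linarith) hs, sub_add_cancel]
  rw [Function.comp_apply, ← ContinuousLinearMap.comp_apply, ← hT.map_add, h3, slope_def_module,
    Real.coe_toNNReal _ (by linarith), ← RCLike.real_smul_eq_coe_smul (K := 𝕜)]

/-- Two semigroups with the same nonpositive, densely defined generator coincide. -/
theorem IsC0Semigroup.eq_of_generator_eq (hneg : ∀ p ∈ Γ, RCLike.re ⟪p.2, p.1⟫_𝕜 ≤ 0)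
    (hdense : Dense {u : H | ∃ v, (u, v) ∈ Γ}) {T' : ℝ≥0 → H →L[𝕜] H}
    (hT : IsC0Semigroup T) (hT' : IsC0Semigroup T')
    (hgen : ∀ u v : H, (u, v) ∈ Γ ↔
      Tendsto (fun t : ℝ≥0 => ((((t : ℝ)⁻¹ : ℝ) : 𝕜)) • (T t u - u)) (𝓝[>] 0) (𝓝 v))
    (hgen' : ∀ u v : H, (u, v) ∈ Γ ↔
      Tendsto (fun t : ℝ≥0 => ((((t : ℝ)⁻¹ : ℝ) : 𝕜)) • (T' t u - u)) (𝓝[>] 0) (𝓝 v)) :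
    T' = T := by
  funext t
  apply ContinuousLinearMap.coeFn_injective
  refine (T' t).continuous.ext_on hdense (T t).continuous ?_
  rintro u ⟨v, huv⟩
  -- Energy argument: `‖w‖²` vanishes at `0` and has right derivative `2 Re ⟨w', w⟩ ≤ 0`, because
  -- the pair `(w, w')` stays in `Γ`.
  set w : ℝ → H := fun r => T' r.toNNReal u - T r.toNNReal u with hw
  set w' : ℝ → H := fun r => T' r.toNNReal v - T r.toNNReal v with hw'
  have hwΓ : ∀ r, (w r, w' r) ∈ Γ := fun r =>
    Γ.sub_mem (hT'.map_mem_generator hgen' huv _) (hT.map_mem_generator hgen huv _)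
  have hwc : Continuous w := (hT'.continuous_toNNReal u).sub (hT.continuous_toNNReal u)
  have hder : ∀ r ∈ Set.Ico (0 : ℝ) t, HasDerivWithinAt (fun r => RCLike.re ⟪w r, w r⟫_𝕜)
      (RCLike.re (⟪w r, w' r⟫_𝕜 + ⟪w' r, w r⟫_𝕜)) (Set.Ici r) r := fun r hr => by
    have h1 : HasDerivWithinAt w (w' r) (Set.Ici r) r :=
      (hT'.hasDerivWithinAt hgen' huv hr.1).sub (hT.hasDerivWithinAt hgen huv hr.1)
    exact (RCLike.reCLM (K := 𝕜)).hasFDerivAt.comp_hasDerivWithinAt r (h1.inner 𝕜 h1)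
  have hle := image_le_of_deriv_right_le_deriv_boundary
    (f := fun r => RCLike.re ⟪w r, w r⟫_𝕜) (a := 0) (b := t) (B := fun _ => 0) (B' := fun _ => 0)
    (RCLike.continuous_re.comp (hwc.inner hwc)).continuousOn hder ?_ continuousOn_const
    (fun _ _ => hasDerivWithinAt_const _ _ _) (fun r _ => ?_) (Set.right_mem_Icc.2 t.2)
  · have h1 : w t = 0 := by
      have h2 : ‖w t‖ ^ 2 ≤ 0 := by rw [← inner_self_eq_norm_sq (𝕜 := 𝕜)]; exact hle
      rw [← norm_eq_zero]
      nlinarith [norm_nonneg (w t)]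
    rw [hw] at h1
    simpa [sub_eq_zero] using h1
  · simp [hw, hT.map_zero, hT'.map_zero]
  · have h1 := hneg _ (hwΓ r)
    have h2 := inner_re_symm (𝕜 := 𝕜) (w r) (w' r)
    rw [_root_.map_add, h2]
    simp only at h1
    linarith

theorem IsC0Semigroup.apply_eq_self_of_mem_ker (hT : IsC0Semigroup T)
    (hgen : ∀ u v : H, (u, v) ∈ Γ ↔
      Tendsto (fun t : ℝ≥0 => ((((t : ℝ)⁻¹ : ℝ) : 𝕜)) • (T t u - u)) (𝓝[>] 0) (𝓝 v))
    {u : H} (hu : (u, 0) ∈ Γ) (t : ℝ≥0) : T t u = u := by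
  have h := constant_of_has_deriv_right_zero (f := fun r : ℝ => T r.toNNReal u) (a := 0) (b := t)
    (hT.continuous_toNNReal u).continuousOn
    (fun r hr => by simpa using hT.hasDerivWithinAt hgen hu hr.1) t (Set.right_mem_Icc.2 t.2)
  simpa [hT.map_zero] using h

end Uniqueness

/-! ### The semigroup of an essentially self-adjoint operator. -/

section SelfAdjoint

variable {𝕜 : Type*} [RCLike 𝕜] {H : Type*} [NormedAddCommGroup H] [InnerProductSpace 𝕜 H]
  [CompleteSpace H] [NormedSpace ℝ H] [IsScalarTower ℝ 𝕜 H]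

/-- The closure of an essentially self-adjoint nonpositive operator generates a unique semigroup,
which is contractive and preserves the pairing with every vector annihilated by the adjoint. -/
theorem IsEssentiallySelfAdjoint.existsUnique_semigroup {A : H →ₗ.[𝕜] H}
    (hA : IsEssentiallySelfAdjoint A) (hneg : ∀ p ∈ A.graph, RCLike.re ⟪p.2, p.1⟫_𝕜 ≤ 0) :
    ∃ T : ℝ≥0 → H →L[𝕜] H, IsC0Semigroup T ∧ IsGeneratorOf A.closure T ∧
      (∀ T' : ℝ≥0 → H →L[𝕜] H, IsC0Semigroup T' → IsGeneratorOf A.closure T' → T' = T) ∧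
      (∀ t, ‖T t‖ ≤ 1) ∧
      ∀ e : H, (∀ p ∈ A.graph, ⟪p.2, e⟫_𝕜 = 0) → ∀ t u, ⟪e, T t u⟫_𝕜 = ⟪e, u⟫_𝕜 := by
  obtain ⟨hd, hc, hs⟩ := hA
  have hd' : Dense (A.closure.domain : Set H) := hd.mono A.le_closure.1
  have hg := hc.graph_closure_eq_closure_graph
  have hadj : ∀ u v : H, (u, v) ∈ A.closure.graph ↔
      ∀ p ∈ A.closure.graph, ⟪p.2, u⟫_𝕜 = ⟪p.1, v⟫_𝕜 := fun u v => by
    rw [← LinearPMap.mem_adjoint_graph_iff hd', LinearPMap.isSelfAdjoint_def.1 hs]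
  have hneg' : ∀ p ∈ A.closure.graph, RCLike.re ⟪p.2, p.1⟫_𝕜 ≤ 0 := by
    rw [← hg]
    have hcl : IsClosed {p : H × H | RCLike.re ⟪p.2, p.1⟫_𝕜 ≤ 0} :=
      isClosed_le (RCLike.continuous_re.comp (by fun_prop)) continuous_const
    intro p hp
    exact closure_minimal hneg hcl hp
  have hdense : Dense {u : H | ∃ v, (u, v) ∈ A.closure.graph} := by
    refine hd'.mono fun u hu => ⟨A.closure ⟨u, hu⟩, ?_⟩
    exact A.closure.mem_graph ⟨u, hu⟩
  obtain ⟨T, hT, hT1, hTs, hgen⟩ := exists_contraction_semigroup hadj hneg' hdense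
  refine ⟨T, hT, hgen, fun T' hT' hgen' => hT.eq_of_generator_eq hneg' hdense hT' hgen hgen',
    hT1, fun e he t u => ?_⟩
  -- The annihilation condition says that `(e, 0)` is in the adjoint graph, that is, in the graph of
  -- the closure. Hence the semigroup fixes `e`, and its symmetry gives the claim.
  have he0 : (e, (0 : H)) ∈ A.closure.graph := by
    rw [hadj, ← hg]
    exact inner_eq_inner_of_mem_closure fun p hp => by rw [he p hp, inner_zero_right]
  rw [← hTs, hT.apply_eq_self_of_mem_ker hgen he0]

end SelfAdjoint

/-! ### Measure-theoretic preliminaries -/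

section LIntegral

variable {α : Type*} [MeasurableSpace α] {μ : Measure α}

/-- Generalized dominated convergence to zero: the dominating functions may vary, provided that
their integrals converge to the integral of their limit. -/
theorem tendsto_lintegral_zero_of_le_of_tendsto {h k : ℕ → α → ℝ≥0∞} {K : α → ℝ≥0∞}
    (hh : ∀ n, AEMeasurable (h n) μ) (hk : ∀ n, AEMeasurable (k n) μ)
    (hle : ∀ n, ∀ᵐ x ∂μ, h n x ≤ k n x)
    (h0 : ∀ᵐ x ∂μ, Tendsto (fun n => h n x) atTop (𝓝 0))
    (hK : ∀ᵐ x ∂μ, Tendsto (fun n => k n x) atTop (𝓝 (K x)))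
    (hint : Tendsto (fun n => ∫⁻ x, k n x ∂μ) atTop (𝓝 (∫⁻ x, K x ∂μ)))
    (hfin : ∫⁻ x, K x ∂μ ≠ ⊤) :
    Tendsto (fun n => ∫⁻ x, h n x ∂μ) atTop (𝓝 0) := by
  have hle' : ∀ n, ∫⁻ x, h n x ∂μ ≤ ∫⁻ x, k n x ∂μ := fun n => lintegral_mono_ae (hle n)
  rcases eq_or_ne (∫⁻ x, K x ∂μ) 0 with hz | hz
  · rw [hz] at hint
    exact tendsto_of_tendsto_of_tendsto_of_le_of_le tendsto_const_nhds hint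
      (fun _ => zero_le) hle'
  -- Fatou's lemma for `k n - h n`, which tends to `K`: this difference retains asymptotically all
  -- the mass of `k n`, leaving none for `h n`.
  have hfatou : ∫⁻ x, K x ∂μ ≤ liminf (fun n => ∫⁻ x, (k n x - h n x) ∂μ) atTop := by
    refine le_trans (lintegral_mono_ae ?_) (lintegral_liminf_le' fun n => (hk n).sub (hh n))
    filter_upwards [h0, hK] with x hx0 hxK
    have := (ENNReal.Tendsto.sub hxK hx0 (Or.inr ENNReal.zero_ne_top)).liminf_eq
    rw [this, tsub_zero]
  have hadd : ∀ n, ∫⁻ x, (k n x - h n x) ∂μ + ∫⁻ x, h n x ∂μ = ∫⁻ x, k n x ∂μ := fun n => by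
    rw [← lintegral_add_right' _ (hh n)]
    refine lintegral_congr_ae ?_
    filter_upwards [hle n] with x hx using tsub_add_cancel_of_le hx
  rw [ENNReal.tendsto_nhds_zero]
  intro ε hε
  rcases eq_or_ne ε ⊤ with rfl | hε'
  · exact Eventually.of_forall fun _ => le_top
  have hε2 : ε / 2 ≠ 0 := (ENNReal.half_pos hε.ne').ne'
  have h1 : ∀ᶠ n in atTop, ∫⁻ x, K x ∂μ - ε / 2 < ∫⁻ x, (k n x - h n x) ∂μ :=
    eventually_lt_of_lt_liminf ((ENNReal.sub_lt_self hfin hz hε2).trans_le hfatou)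
  have h2 : ∀ᶠ n in atTop, ∫⁻ x, k n x ∂μ < ∫⁻ x, K x ∂μ + ε / 2 :=
    hint.eventually_lt_const (ENNReal.lt_add_right hfin hε2)
  filter_upwards [h1, h2] with n hn1 hn2
  have h3 : ∫⁻ x, (k n x - h n x) ∂μ ≠ ⊤ :=
    ne_top_of_le_ne_top hn2.ne_top ((hadd n) ▸ le_self_add)
  have h4 : ∫⁻ x, K x ∂μ ≤ ∫⁻ x, (k n x - h n x) ∂μ + ε / 2 := by
    have := tsub_le_iff_right.1 hn1.le
    exact this
  rw [← ENNReal.add_le_add_iff_left h3, hadd]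
  calc ∫⁻ x, k n x ∂μ ≤ ∫⁻ x, K x ∂μ + ε / 2 := hn2.le
    _ ≤ (∫⁻ x, (k n x - h n x) ∂μ + ε / 2) + ε / 2 := by gcongr
    _ = _ := by rw [add_assoc, ENNReal.add_halves]

/-- Jensen's inequality, read off from monotonicity of `Lᵖ` norms on a probability space. -/
theorem lintegral_pow_le_lintegral_pow [IsProbabilityMeasure μ] {f : α → ℝ≥0∞}
    (hf : AEMeasurable f μ) {p : ℕ} (hp : 1 ≤ p) : (∫⁻ x, f x ∂μ) ^ p ≤ ∫⁻ x, f x ^ p ∂μ := by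
  have h := eLpNorm'_le_eLpNorm'_of_exponent_le (p := 1) (q := p) one_pos (by exact_mod_cast hp) μ
    hf.aestronglyMeasurable
  simp only [eLpNorm', enorm_eq_self, ENNReal.rpow_one, one_div, inv_one, ENNReal.rpow_natCast] at h
  have hp0 : (p : ℝ) ≠ 0 := by positivity
  calc (∫⁻ x, f x ∂μ) ^ p ≤ ((∫⁻ x, f x ^ p ∂μ) ^ (p : ℝ)⁻¹) ^ p := by gcongr
    _ = _ := by rw [← ENNReal.rpow_natCast, ← ENNReal.rpow_mul, inv_mul_cancel₀ hp0,
      ENNReal.rpow_one]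

end LIntegral

/-! ### Mollification -/

section Mollify

variable {E : Type*} [NormedAddCommGroup E] [InnerProductSpace ℝ E] [FiniteDimensional ℝ E]
  [MeasurableSpace E] [BorelSpace E]
  {F : Type*} [NormedAddCommGroup F] [NormedSpace ℝ F]

variable (E) in
/-- The bump function supported in the ball of radius `1 / (n + 1)`. -/
def mollifierBump (n : ℕ) : ContDiffBump (0 : E) where
  rIn := 1 / ((n : ℝ) + 1) / 2
  rOut := 1 / ((n : ℝ) + 1)
  rIn_pos := by positivity
  rIn_lt_rOut := half_lt_self (by positivity)

variable (E) in
/-- The normalized mollifier supported in the ball of radius `1 / (n + 1)`. -/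
def mollifier (n : ℕ) : E → ℝ := (mollifierBump E n).normed volume

/-- The mollification of a function at scale `1 / (n + 1)`. -/
def mollify (n : ℕ) (h : E → F) : E → F :=
  convolution (mollifier E n) h (ContinuousLinearMap.lsmul ℝ ℝ) volume

theorem mollify_apply (n : ℕ) (h : E → F) (x : E) :
    mollify n h x = ∫ y, mollifier E n (x - y) • h y :=
  convolution_lsmul_swap

theorem mollify_apply' (n : ℕ) (h : E → F) (x : E) :
    mollify n h x = ∫ y, mollifier E n y • h (x - y) :=
  convolution_lsmul

theorem contDiff_mollifier (n : ℕ) : ContDiff ℝ ∞ (mollifier E n) :=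
  (mollifierBump E n).contDiff_normed

theorem hasCompactSupport_mollifier (n : ℕ) : HasCompactSupport (mollifier E n) :=
  (mollifierBump E n).hasCompactSupport_normed

theorem mollifier_nonneg (n : ℕ) (x : E) : 0 ≤ mollifier E n x :=
  (mollifierBump E n).nonneg_normed x

theorem mollifier_eq_zero {n : ℕ} {x : E} (hx : 1 ≤ ‖x‖) : mollifier E n x = 0 := by
  have h : x ∉ Function.support (mollifier E n) := by
    rw [mollifier, (mollifierBump E n).support_normed_eq, mem_ball_zero_iff, not_lt]
    refine le_trans ?_ hx
    change 1 / ((n : ℝ) + 1) ≤ 1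
    rw [div_le_one (by positivity)]
    linarith [n.cast_nonneg (α := ℝ)]
  simpa using h

theorem lintegral_enorm_mollifier (n : ℕ) : ∫⁻ x : E, ‖mollifier E n x‖ₑ = 1 := by
  have h1 : Integrable (mollifier E n) := (mollifierBump E n).integrable_normed
  have h2 : ∫ x, mollifier E n x = 1 := (mollifierBump E n).integral_normed
  have h3 : ∀ x : E, ‖mollifier E n x‖ₑ = ENNReal.ofReal (mollifier E n x) := fun x =>
    Real.enorm_eq_ofReal (mollifier_nonneg n x)
  simp_rw [h3]
  rw [← ofReal_integral_eq_lintegral_ofReal h1 (Eventually.of_forall (mollifier_nonneg n)), h2,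
    ENNReal.ofReal_one]

theorem contDiff_mollify (n : ℕ) {h : E → F} (hh : LocallyIntegrable h) :
    ContDiff ℝ ∞ (mollify n h) :=
  (hasCompactSupport_mollifier n).contDiff_convolution_left (n := (⊤ : ℕ∞)) _
    (contDiff_mollifier n) hh

theorem ae_tendsto_mollify [CompleteSpace F] {h : E → F} (hh : LocallyIntegrable h) :
    ∀ᵐ x, Tendsto (fun n => mollify n h x) atTop (𝓝 (h x)) := by
  refine ContDiffBump.ae_convolution_tendsto_right_of_locallyIntegrable (K := 2)
    (φ := mollifierBump E) ?_ (Eventually.of_forall fun n => ?_) hh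
  · exact tendsto_one_div_add_atTop_nhds_zero_nat
  · change 1 / ((n : ℝ) + 1) ≤ 2 * (1 / ((n : ℝ) + 1) / 2)
    linarith

/-- Young's inequality for mollifications. -/
theorem lintegral_enorm_mollify_pow_le (n : ℕ) {h : E → F} (hh : AEStronglyMeasurable h)
    {p : ℕ} (hp : 1 ≤ p) : ∫⁻ x, ‖mollify n h x‖ₑ ^ p ≤ ∫⁻ x, ‖h x‖ₑ ^ p := by
  have hm : Measurable fun x : E => ‖mollifier E n x‖ₑ :=
    (contDiff_mollifier n).continuous.enorm.measurable
  -- With the mollifier as a probability measure `ν`, mollifying averages translates of `h`; Jensen,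
  -- Tonelli and translation invariance give the bound.
  set ν : Measure E := volume.withDensity fun x => ‖mollifier E n x‖ₑ with hν
  have hprob : IsProbabilityMeasure ν := ⟨by
    rw [hν, withDensity_apply _ MeasurableSet.univ, Measure.restrict_univ,
      lintegral_enorm_mollifier]⟩
  have hac : ν ≪ volume := withDensity_absolutelyContinuous _ _
  have hmeas : AEStronglyMeasurable (fun q : E × E => h (q.1 - q.2))
      ((volume : Measure E).prod volume) :=
    hh.comp_quasiMeasurePreserving (quasiMeasurePreserving_sub volume volume)
  have hmeasν : AEStronglyMeasurable (fun q : E × E => h (q.1 - q.2))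
      ((volume : Measure E).prod ν) := hmeas.mono_ac (Measure.AbsolutelyContinuous.rfl.prod hac)
  have hsec : ∀ x : E, AEStronglyMeasurable (fun y => h (x - y)) (volume : Measure E) := fun x =>
    hh.comp_quasiMeasurePreserving (quasiMeasurePreserving_sub_left volume x)
  calc ∫⁻ x, ‖mollify n h x‖ₑ ^ p ≤ ∫⁻ x, ∫⁻ y, ‖h (x - y)‖ₑ ^ p ∂ν := by
        refine lintegral_mono fun x => ?_
        refine le_trans ?_ (lintegral_pow_le_lintegral_pow ((hsec x).mono_ac hac).enorm hp)
        gcongr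
        rw [mollify_apply', hν, lintegral_withDensity_eq_lintegral_mul₀ hm.aemeasurable
          (hsec x).enorm]
        refine (enorm_integral_le_lintegral_enorm _).trans (le_of_eq ?_)
        simp only [enorm_smul, Pi.mul_apply]
    _ = ∫⁻ y, (∫⁻ x, ‖h (x - y)‖ₑ ^ p) ∂ν := by
        rw [lintegral_lintegral_swap]
        exact hmeasν.enorm.pow_const p
    _ = ∫⁻ _, (∫⁻ x, ‖h x‖ₑ ^ p) ∂ν := by
        refine lintegral_congr fun y => ?_
        exact lintegral_sub_right_eq_self (fun x => ‖h x‖ₑ ^ p) y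
    _ = _ := by simp

/-- Fatou from below, Young from above. This lets powers of mollifications serve as the varying
dominating functions in `tendsto_lintegral_zero_of_le_of_tendsto`. -/
theorem tendsto_lintegral_enorm_mollify_pow [CompleteSpace F] {h : E → F} (hh : LocallyIntegrable h)
    {p : ℕ} (hp : 1 ≤ p) :
    Tendsto (fun n => ∫⁻ x, ‖mollify n h x‖ₑ ^ p) atTop (𝓝 (∫⁻ x, ‖h x‖ₑ ^ p)) := by
  refine tendsto_of_le_liminf_of_limsup_le ?_ ?_
  · refine le_trans (lintegral_mono_ae ?_) (lintegral_liminf_le' fun n =>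
      (contDiff_mollify n hh).continuous.enorm.measurable.aemeasurable.pow_const p)
    filter_upwards [ae_tendsto_mollify hh] with x hx
    exact ((ENNReal.continuous_pow p).tendsto _ |>.comp hx.enorm).liminf_eq.ge
  · refine limsup_le_of_le (by isBoundedDefault) (Eventually.of_forall fun n => ?_)
    exact lintegral_enorm_mollify_pow_le n hh.aestronglyMeasurable hp

theorem fderiv_mollify (n : ℕ) {h : E → F} (hh : LocallyIntegrable h) (x e : E) :
    fderiv ℝ (mollify n h) x e = ∫ y, fderiv ℝ (mollifier E n) (x - y) e • h y := by
  have h1 := (hasCompactSupport_mollifier (E := E) n).hasFDerivAt_convolution_left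
    (ContinuousLinearMap.lsmul ℝ ℝ) ((contDiff_mollifier n).of_le (by norm_num)) hh x
  have h2 := ((hasCompactSupport_mollifier (E := E) n).fderiv ℝ).convolutionExists_left
    ((ContinuousLinearMap.lsmul ℝ ℝ : ℝ →L[ℝ] F →L[ℝ] F).precompL E)
    ((contDiff_mollifier n).continuous_fderiv (by norm_num)) hh x
  rw [show fderiv ℝ (mollify n h) x = _ from h1.fderiv, convolution_eq_swap,
    ContinuousLinearMap.integral_apply h2.integrable_swap]
  rfl

/-- All mollifiers vanish outside the unit ball, so one enlargement of the radius by `1` serves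
every `n`. -/
theorem mollify_congr_of_ball (n : ℕ) {h k : E → F} {R : ℝ} {x : E} (hx : ‖x‖ ≤ R)
    (hhk : ∀ y, ‖y‖ ≤ R + 1 → h y = k y) : mollify n h x = mollify n k x := by
  rw [mollify_apply', mollify_apply']
  refine integral_congr_ae (Eventually.of_forall fun y => ?_)
  rcases le_or_gt 1 ‖y‖ with hy | hy
  · simp [mollifier_eq_zero hy]
  · simp only
    rw [hhk]
    exact (norm_sub_le x y).trans (by linarith)

end Mollify

/-! ### Product and chain rules for the Laplacian -/

section Calculus

variable {E : Type*} [NormedAddCommGroup E] [InnerProductSpace ℝ E] [FiniteDimensional ℝ E]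
  {F : Type*} [NormedAddCommGroup F] [NormedSpace ℝ F]

theorem ContDiff.differentiable_fderiv_apply {f : E → F} (hf : ContDiff ℝ 2 f) (e : E) :
    Differentiable ℝ fun y => fderiv ℝ f y e :=
  ((hf.fderiv_right (m := 1) (by norm_num)).differentiable (by norm_num)).clm_apply
    (differentiable_const e)

theorem ContDiff.laplacian_eq_sum_fderiv {ι : Type*} [Fintype ι] {f : E → F} (hf : ContDiff ℝ 2 f)
    (b : OrthonormalBasis ι ℝ E) (x : E) :
    Laplacian.laplacian f x = ∑ i, fderiv ℝ (fun y => fderiv ℝ f y (b i)) x (b i) := by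
  rw [InnerProductSpace.laplacian_eq_iteratedFDeriv_orthonormalBasis f b]
  refine Finset.sum_congr rfl fun i _ => ?_
  have hd : DifferentiableAt ℝ (fderiv ℝ f) x :=
    (hf.fderiv_right (m := 1) (by norm_num)).differentiable (by norm_num) x
  rw [iteratedFDeriv_two_apply, fderiv_clm_apply hd (differentiableAt_const _)]
  simp

theorem OrthonormalBasis.sum_inner_smul_apply {ι : Type*} [Fintype ι]
    (b : OrthonormalBasis ι ℝ E) (L : E →L[ℝ] F) (v : E) :
    ∑ i, ⟪v, b i⟫_ℝ • L (b i) = L v := by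
  conv_rhs => rw [← b.sum_repr' v, map_sum]
  refine Finset.sum_congr rfl fun i _ => ?_
  rw [map_smul, real_inner_comm]

theorem fderiv_smul_apply' {a : E → ℝ} {φ : E → F} {x : E} (ha : DifferentiableAt ℝ a x)
    (hφ : DifferentiableAt ℝ φ x) (e : E) :
    fderiv ℝ (fun y => a y • φ y) x e = a x • fderiv ℝ φ x e + fderiv ℝ a x e • φ x := by
  rw [fderiv_fun_smul ha hφ]
  simp

/-- The gradient of `a` enters as any vector representing its derivative, so a mollified weak
gradient can be inserted directly. -/
theorem laplacian_smul_apply_of_gradient {a : E → ℝ} {φ : E → F} (ha : ContDiff ℝ 2 a)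
    (hφ : ContDiff ℝ 2 φ) {x v : E} (hv : ∀ e, fderiv ℝ a x e = ⟪v, e⟫_ℝ) :
    Laplacian.laplacian (fun y => a y • φ y) x = a x • Laplacian.laplacian φ x +
      (2 : ℝ) • fderiv ℝ φ x v + Laplacian.laplacian a x • φ x := by
  have hda := ha.differentiable (by norm_num)
  have hdφ := hφ.differentiable (by norm_num)
  set b := stdOrthonormalBasis ℝ E
  have hprod : ContDiff ℝ 2 fun y => a y • φ y := ha.smul hφ
  rw [hprod.laplacian_eq_sum_fderiv b, hφ.laplacian_eq_sum_fderiv b,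
    ha.laplacian_eq_sum_fderiv b]
  have h1 : ∀ i, fderiv ℝ (fun y => fderiv ℝ (fun z => a z • φ z) y (b i)) x (b i) =
      a x • fderiv ℝ (fun y => fderiv ℝ φ y (b i)) x (b i) +
        (2 : ℝ) • (⟪v, b i⟫_ℝ • fderiv ℝ φ x (b i)) +
        fderiv ℝ (fun y => fderiv ℝ a y (b i)) x (b i) • φ x := fun i => by
    have h2 : (fun y => fderiv ℝ (fun z => a z • φ z) y (b i)) =
        fun y => a y • fderiv ℝ φ y (b i) + fderiv ℝ a y (b i) • φ y :=
      funext fun y => fderiv_smul_apply' (hda y) (hdφ y) _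
    have d1 := ha.differentiable_fderiv_apply (b i)
    have d2 := hφ.differentiable_fderiv_apply (b i)
    have e1 : DifferentiableAt ℝ (fun y => a y • fderiv ℝ φ y (b i)) x := (hda x).smul (d2 x)
    have e2 : DifferentiableAt ℝ (fun y => fderiv ℝ a y (b i) • φ y) x := (d1 x).smul (hdφ x)
    rw [h2, fderiv_fun_add e1 e2, add_apply,
      fderiv_smul_apply' (hda x) (d2 x), fderiv_smul_apply' (d1 x) (hdφ x), hv]
    module
  simp only [h1, Finset.sum_add_distrib, ← Finset.smul_sum, ← Finset.sum_smul]
  rw [b.sum_inner_smul_apply]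

theorem fderiv_comp_apply_of_gradient {f : ℝ → ℝ} {g : E → ℝ} (hf : ContDiff ℝ 2 f)
    (hg : ContDiff ℝ 2 g) (x e : E) :
    fderiv ℝ (fun y => f (g y)) x e = deriv f (g x) * fderiv ℝ g x e := by
  have h := fderiv_comp x (hf.differentiable (by norm_num) (g x)) (hg.differentiable (by norm_num) x)
  rw [show (fun y => f (g y)) = f ∘ g from rfl, h, ContinuousLinearMap.comp_apply,
    fderiv_eq_smul_deriv, smul_eq_mul, mul_comm]

theorem laplacian_comp_of_gradient {f : ℝ → ℝ} {g : E → ℝ} (hf : ContDiff ℝ 2 f)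
    (hg : ContDiff ℝ 2 g) {x v : E} (hv : ∀ e, fderiv ℝ g x e = ⟪v, e⟫_ℝ) :
    Laplacian.laplacian (fun y => f (g y)) x =
      deriv (deriv f) (g x) * ‖v‖ ^ 2 + deriv f (g x) * Laplacian.laplacian g x := by
  have hdg := hg.differentiable (by norm_num)
  have hf' : ContDiff ℝ 1 (deriv f) := by
    have := (contDiff_succ_iff_deriv (n := 1)).1 (by simpa [one_add_one_eq_two] using hf)
    exact this.2.2
  have hdf' := hf'.differentiable (by norm_num)
  set b := stdOrthonormalBasis ℝ E
  have hcomp : ContDiff ℝ 2 fun y => f (g y) := hf.comp hg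
  rw [hcomp.laplacian_eq_sum_fderiv b, hg.laplacian_eq_sum_fderiv b]
  have h1 : ∀ i, fderiv ℝ (fun y => fderiv ℝ (fun z => f (g z)) y (b i)) x (b i) =
      deriv (deriv f) (g x) * ‖⟪b i, v⟫_ℝ‖ ^ 2 +
        deriv f (g x) * fderiv ℝ (fun y => fderiv ℝ g y (b i)) x (b i) := fun i => by
    have h2 : (fun y => fderiv ℝ (fun z => f (g z)) y (b i)) =
        fun y => deriv f (g y) • fderiv ℝ g y (b i) :=
      funext fun y => fderiv_comp_apply_of_gradient hf hg y (b i)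
    have d1 := hg.differentiable_fderiv_apply (b i)
    have h3 : fderiv ℝ (fun y => deriv f (g y)) x (b i) =
        deriv (deriv f) (g x) * fderiv ℝ g x (b i) := by
      have h := fderiv_comp x (hdf' (g x)) (hdg x)
      rw [show (fun y => deriv f (g y)) = deriv f ∘ g from rfl, h, ContinuousLinearMap.comp_apply,
        fderiv_eq_smul_deriv, smul_eq_mul, mul_comm]
    have e1 : DifferentiableAt ℝ (fun y => deriv f (g y)) x := (hdf' (g x)).comp x (hdg x)
    rw [h2, fderiv_smul_apply' e1 (d1 x), h3, hv, smul_eq_mul,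
      smul_eq_mul, Real.norm_eq_abs, sq_abs, real_inner_comm]
    ring
  simp only [h1, Finset.sum_add_distrib, ← Finset.mul_sum]
  rw [b.sum_sq_norm_inner_right]

end Calculus

/-! ### Mollification of weakly differentiable functions -/

section WeakDerivatives

variable {d : ℕ}

local notation "𝔼" => EuclideanSpace ℝ (Fin d)

theorem contDiff_mollifier_sub (n : ℕ) (x : 𝔼) : ContDiff ℝ ∞ fun y => mollifier 𝔼 n (x - y) :=
  (contDiff_mollifier n).comp (contDiff_const.sub contDiff_id)

theorem hasCompactSupport_mollifier_sub (n : ℕ) (x : 𝔼) :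
    HasCompactSupport fun y => mollifier 𝔼 n (x - y) :=
  (hasCompactSupport_mollifier n).comp_homeomorph (Homeomorph.subLeft x)

theorem fderiv_mollifier_sub (n : ℕ) (x y e : 𝔼) :
    fderiv ℝ (fun y => mollifier 𝔼 n (x - y)) y e = - fderiv ℝ (mollifier 𝔼 n) (x - y) e := by
  have h1 : DifferentiableAt ℝ (mollifier 𝔼 n) (x - y) :=
    (contDiff_mollifier n).differentiable (by norm_num) _
  have h2 := h1.hasFDerivAt.comp y ((hasFDerivAt_id y).const_sub x)
  rw [show (fun y => mollifier 𝔼 n (x - y)) = mollifier 𝔼 n ∘ fun y => x - y from rfl, h2.fderiv]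
  simp

/-- The test function is the reflected mollifier `y ↦ η(x - y)`; the sign from the reflection
cancels the sign of the integration by parts. -/
theorem fderiv_mollify_of_isWeakGradient {G : 𝔼 → ℝ} {b : 𝔼 → 𝔼} (h : IsWeakGradient G b)
    (n : ℕ) (x e : 𝔼) : fderiv ℝ (mollify n G) x e = ⟪mollify n b x, e⟫_ℝ := by
  obtain ⟨hG, hb, hw⟩ := h
  have h1 := hw _ (contDiff_mollifier_sub n x) (hasCompactSupport_mollifier_sub n x) e
  have hint : Integrable fun y => mollifier 𝔼 n (x - y) • b y :=
    ((hasCompactSupport_mollifier n).convolutionExists_left (ContinuousLinearMap.lsmul ℝ ℝ)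
      (contDiff_mollifier n).continuous hb x).integrable_swap
  simp only [fderiv_mollifier_sub, mul_neg, integral_neg, neg_inj] at h1
  rw [fderiv_mollify n hG, mollify_apply, real_inner_comm, ← integral_inner hint]
  simp only [smul_eq_mul, inner_smul_right, mul_comm (fderiv ℝ _ _ _)]
  rw [h1]
  refine integral_congr_ae (Eventually.of_forall fun y => ?_)
  simp only [real_inner_comm, mul_comm]

/-- The Laplacian of the mollification is the divergence of the mollified `b`, identified by testing
with the reflected mollifier. Individual second derivatives of `G` never enter, only their trace. -/
theorem laplacian_mollify_of_isWeakGradient {G : 𝔼 → ℝ} {b : 𝔼 → 𝔼} {D : 𝔼 → ℝ}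
    (h : IsWeakGradient G b) (hD : IsWeakDivergence b D) (n : ℕ) (x : 𝔼) :
    Laplacian.laplacian (mollify n G) x = mollify n D x := by
  obtain ⟨hb, -, hw⟩ := hD
  have h1 := hw _ (contDiff_mollifier_sub n x) (hasCompactSupport_mollifier_sub n x)
  simp only [fderiv_mollifier_sub, integral_neg, neg_inj] at h1
  set e := stdOrthonormalBasis ℝ 𝔼
  have hmb : Differentiable ℝ (mollify n b) := (contDiff_mollify n hb).differentiable (by norm_num)
  have hint : ∀ i, Integrable fun y => fderiv ℝ (mollifier 𝔼 n) (x - y) (e i) • b y := fun i => by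
    refine (((hasCompactSupport_mollifier (E := 𝔼) n).fderiv_apply ℝ (e i)).convolutionExists_left
      (ContinuousLinearMap.lsmul ℝ ℝ) ?_ hb x).integrable_swap
    exact ((contDiff_mollifier n).continuous_fderiv (by norm_num)).clm_apply continuous_const
  rw [((contDiff_mollify n h.1).of_le (by norm_cast)).laplacian_eq_sum_fderiv e]
  have h2 : ∀ i, fderiv ℝ (fun y => fderiv ℝ (mollify n G) y (e i)) x (e i) =
      ∫ y, ⟪b y, e i⟫_ℝ • fderiv ℝ (mollifier 𝔼 n) (x - y) (e i) := fun i => by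
    simp only [fderiv_mollify_of_isWeakGradient h]
    rw [fderiv_inner_apply ℝ (hmb x) (differentiableAt_const _), fderiv_mollify n hb]
    simp only [fderiv_fun_const, Pi.zero_apply, zero_apply, inner_zero_right, zero_add]
    rw [real_inner_comm, ← integral_inner (hint i)]
    refine integral_congr_ae (Eventually.of_forall fun y => ?_)
    simp only [inner_smul_right, smul_eq_mul]
    rw [real_inner_comm, mul_comm]
  simp only [h2]
  rw [← integral_finsetSum]
  · simp only [e.sum_inner_smul_apply]
    rw [h1, mollify_apply]
    simp only [smul_eq_mul, mul_comm]
  · intro i _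
    refine ((hint i).inner_const (e i)).congr (Eventually.of_forall fun y => ?_)
    simp only [inner_smul_left, smul_eq_mul]
    exact mul_comm _ _

theorem IsWeakDivergence.neg {b : 𝔼 → 𝔼} {D : 𝔼 → ℝ} (h : IsWeakDivergence b D) :
    IsWeakDivergence (fun x => -b x) (fun x => -D x) := by
  obtain ⟨hb, hD, hw⟩ := h
  refine ⟨hb.neg, hD.neg, fun ψ hψ hc => ?_⟩
  simp only [map_neg, integral_neg, hw ψ hψ hc, neg_mul]

end WeakDerivatives

/-! ### Smooth cutoffs -/

section Cutoff

variable {E : Type*} [NormedAddCommGroup E] [InnerProductSpace ℝ E] [FiniteDimensional ℝ E]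

variable (E) in
/-- A fixed smooth bump equal to `1` on the unit ball. -/
def unitCutoff : ContDiffBump (0 : E) where
  rIn := 1
  rOut := 2
  rIn_pos := one_pos
  rIn_lt_rOut := one_lt_two

variable (E) in
/-- A smooth cutoff equal to `1` on the ball of radius `n + 1`. -/
def cutoff (n : ℕ) (x : E) : ℝ := unitCutoff E ((1 / ((n : ℝ) + 1)) • x)

theorem contDiff_cutoff (n : ℕ) : ContDiff ℝ ∞ (cutoff E n) :=
  (unitCutoff E).contDiff.comp (contDiff_const_smul _)

theorem hasCompactSupport_cutoff (n : ℕ) : HasCompactSupport (cutoff E n) :=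
  (unitCutoff E).hasCompactSupport.comp_smul (by positivity)

theorem abs_cutoff_le_one (n : ℕ) (x : E) : |cutoff E n x| ≤ 1 := by
  rw [abs_of_nonneg (show 0 ≤ cutoff E n x from (unitCutoff E).nonneg' _)]
  exact (unitCutoff E).le_one

theorem cutoff_eq_one {n : ℕ} {x : E} (hx : ‖x‖ ≤ n + 1) : cutoff E n x = 1 := by
  refine (unitCutoff E).one_of_mem_closedBall ?_
  rw [mem_closedBall_zero_iff, norm_smul, Real.norm_of_nonneg (by positivity), one_div,
    inv_mul_le_iff₀ (by positivity)]
  change ‖x‖ ≤ ((n : ℝ) + 1) * 1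
  linarith

/-- Equality holds on a neighbourhood of `x`, so that the derivatives of the cutoffs at `x` vanish
eventually as well. -/
theorem eventually_cutoff_eq_one (x : E) : ∀ᶠ n in atTop, cutoff E n =ᶠ[𝓝 x] fun _ => 1 := by
  obtain ⟨N, hN⟩ := exists_nat_gt ‖x‖
  filter_upwards [eventually_ge_atTop N] with n hn
  have h1 : ∀ᶠ y in 𝓝 x, ‖y‖ < N := continuous_norm.continuousAt.eventually_lt_const hN
  filter_upwards [h1] with y hy
  refine cutoff_eq_one ?_
  have : (N : ℝ) ≤ n := by exact_mod_cast hn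
  linarith

theorem SchwartzMap.exists_norm_le {F : Type*} [NormedAddCommGroup F] [NormedSpace ℝ F]
    (f : 𝓢(E, F)) : ∃ C, 0 ≤ C ∧ ∀ x, ‖f x‖ ≤ C := by
  obtain ⟨C, hC, h⟩ := f.decay 0 0
  exact ⟨C, hC.le, fun x => by simpa using h x⟩

theorem SchwartzMap.exists_norm_fderiv_le {F : Type*} [NormedAddCommGroup F] [NormedSpace ℝ F]
    (f : 𝓢(E, F)) : ∃ C, 0 ≤ C ∧ ∀ x, ‖fderiv ℝ f x‖ ≤ C :=
  (SchwartzMap.fderivCLM ℝ E F f).exists_norm_le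

theorem SchwartzMap.exists_norm_laplacian_le {F : Type*} [NormedAddCommGroup F] [NormedSpace ℝ F]
    (f : 𝓢(E, F)) : ∃ C, 0 ≤ C ∧ ∀ x, ‖Laplacian.laplacian (f : E → F) x‖ ≤ C := by
  obtain ⟨C, hC, h⟩ := (Laplacian.laplacian f : 𝓢(E, F)).exists_norm_le
  exact ⟨C, hC, fun x => by rw [← SchwartzMap.laplacian_apply]; exact h x⟩

theorem fderiv_comp_smul_apply {F : Type*} [NormedAddCommGroup F] [NormedSpace ℝ F] {f : E → F}
    (hf : Differentiable ℝ f) (c : ℝ) (x e : E) :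
    fderiv ℝ (fun y => f (c • y)) x e = c • fderiv ℝ f (c • x) e := by
  have h := (hf (c • x)).hasFDerivAt.comp x ((hasFDerivAt_id x).const_smul c)
  rw [show (fun y => f (c • y)) = f ∘ fun y => c • y from rfl]
  rw [HasFDerivAt.fderiv h]
  simp

theorem laplacian_comp_smul_apply {F : Type*} [NormedAddCommGroup F] [NormedSpace ℝ F] {f : E → F}
    (hf : ContDiff ℝ 2 f) (c : ℝ) (x : E) :
    Laplacian.laplacian (fun y => f (c • y)) x = c ^ 2 • Laplacian.laplacian f (c • x) := by
  have hfc : ContDiff ℝ 2 fun y => f (c • y) := hf.comp (contDiff_const_smul c)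
  rw [hfc.laplacian_eq_sum_fderiv (stdOrthonormalBasis ℝ E),
    hf.laplacian_eq_sum_fderiv (stdOrthonormalBasis ℝ E), Finset.smul_sum]
  refine Finset.sum_congr rfl fun i _ => ?_
  have hd := hf.differentiable_fderiv_apply (stdOrthonormalBasis ℝ E i)
  simp only [fderiv_comp_smul_apply (hf.differentiable (by norm_num))]
  have hdc : Differentiable ℝ fun y => fderiv ℝ f (c • y) (stdOrthonormalBasis ℝ E i) :=
    hd.comp (differentiable_id.const_smul c)
  rw [fderiv_fun_const_smul (hdc x), smul_apply, fderiv_comp_smul_apply hd, smul_smul, sq]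

theorem cutoff_scale_mem (n : ℕ) : (0 : ℝ) ≤ 1 / ((n : ℝ) + 1) ∧ 1 / ((n : ℝ) + 1) ≤ 1 := by
  refine ⟨by positivity, ?_⟩
  rw [div_le_one (by positivity)]
  linarith [n.cast_nonneg (α := ℝ)]

-- Each cutoff is the fixed bump dilated by `1 / (n + 1) ≤ 1`, which only shrinks derivatives; hence
-- the bound is uniform in `n`.
variable (E) in
theorem exists_norm_fderiv_cutoff_le : ∃ C, 0 ≤ C ∧ ∀ n (x : E), ‖fderiv ℝ (cutoff E n) x‖ ≤ C := by
  obtain ⟨C, hC, h⟩ := ((unitCutoff E).hasCompactSupport.toSchwartzMap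
    (unitCutoff E).contDiff).exists_norm_fderiv_le
  refine ⟨C, hC, fun n x => ContinuousLinearMap.opNorm_le_bound _ hC fun e => ?_⟩
  obtain ⟨h0, h1⟩ := cutoff_scale_mem n
  rw [show cutoff E n = fun y => unitCutoff E ((1 / ((n : ℝ) + 1)) • y) from rfl,
    fderiv_comp_smul_apply ((unitCutoff E).contDiff.differentiable (n := 1) (by norm_num)),
    norm_smul, Real.norm_of_nonneg h0]
  have h2 := ((fderiv ℝ (unitCutoff E) ((1 / ((n : ℝ) + 1)) • x)).le_opNorm e).trans
    (mul_le_mul_of_nonneg_right (h _) (norm_nonneg e))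
  have h3 := norm_nonneg (fderiv ℝ (unitCutoff E) ((1 / ((n : ℝ) + 1)) • x) e)
  exact (mul_le_of_le_one_left h3 h1).trans h2

variable (E) in
theorem exists_abs_laplacian_cutoff_le :
    ∃ C, 0 ≤ C ∧ ∀ n (x : E), |Laplacian.laplacian (cutoff E n) x| ≤ C := by
  obtain ⟨C, hC, h⟩ := ((unitCutoff E).hasCompactSupport.toSchwartzMap
    (unitCutoff E).contDiff).exists_norm_laplacian_le
  refine ⟨C, hC, fun n x => ?_⟩
  obtain ⟨h0, h1⟩ := cutoff_scale_mem n
  rw [show cutoff E n = fun y => unitCutoff E ((1 / ((n : ℝ) + 1)) • y) from rfl,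
    laplacian_comp_smul_apply (unitCutoff E).contDiff, smul_eq_mul, abs_mul,
    abs_of_nonneg (by positivity)]
  have h3 := abs_nonneg (Laplacian.laplacian (unitCutoff E : E → ℝ) ((1 / ((n : ℝ) + 1)) • x))
  exact (mul_le_of_le_one_left h3 (pow_le_one₀ h0 h1)).trans (h _)

theorem exists_gradient (a : E → ℝ) (x : E) :
    ∃ v : E, (∀ e, fderiv ℝ a x e = ⟪v, e⟫_ℝ) ∧ ‖v‖ = ‖fderiv ℝ a x‖ :=
  ⟨(InnerProductSpace.toDual ℝ E).symm (fderiv ℝ a x),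
    fun _ => (InnerProductSpace.toDual_symm_apply).symm, LinearIsometryEquiv.norm_map _ _⟩

theorem tendsto_cutoff (x : E) : Tendsto (fun n => cutoff E n x) atTop (𝓝 1) :=
  tendsto_const_nhds.congr' ((eventually_cutoff_eq_one x).mono fun _ hn => hn.eq_of_nhds.symm)

theorem tendsto_fderiv_cutoff (x : E) :
    Tendsto (fun n => fderiv ℝ (cutoff E n) x) atTop (𝓝 0) :=
  tendsto_const_nhds.congr' ((eventually_cutoff_eq_one x).mono fun n hn => by
    simp only [hn.fderiv_eq, fderiv_fun_const, Pi.zero_apply])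

theorem tendsto_laplacian_cutoff (x : E) :
    Tendsto (fun n => Laplacian.laplacian (cutoff E n) x) atTop (𝓝 0) :=
  tendsto_const_nhds.congr' ((eventually_cutoff_eq_one x).mono fun n hn => by
    change 0 = Laplacian.laplacian (cutoff E n) x
    rw [(InnerProductSpace.laplacian_congr_nhds hn).eq_of_nhds]
    simp)

end Cutoff

/-! ### The divergence theorem for weak divergences -/

section Divergence

variable {d : ℕ} {𝕜 : Type*} [RCLike 𝕜]

local notation "𝔼" => EuclideanSpace ℝ (Fin d)

theorem MeasureTheory.AEStronglyMeasurable.clm_apply_continuous {E F : Type*}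
    [NormedAddCommGroup E] [NormedSpace ℝ E] [NormedAddCommGroup F] [NormedSpace ℝ F]
    {α : Type*} [TopologicalSpace α] [MeasurableSpace α] [OpensMeasurableSpace α]
    [SecondCountableTopology α] {μ : Measure α} {b : α → E} (hb : AEStronglyMeasurable b μ)
    {A : α → E →L[ℝ] F} (hA : AEStronglyMeasurable A μ) :
    AEStronglyMeasurable (fun x => A x (b x)) μ :=
  isBoundedBilinearMap_apply.continuous.comp_aestronglyMeasurable (hA.prodMk hb)

theorem integrable_fderiv_apply_of_hasCompactSupport {F : Type*} [NormedAddCommGroup F]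
    [NormedSpace ℝ F] {b : 𝔼 → 𝔼} (hb : LocallyIntegrable b) {h : 𝔼 → F} (hh : ContDiff ℝ ∞ h)
    (hc : HasCompactSupport h) : Integrable fun x => fderiv ℝ h x (b x) := by
  have hcont := hh.continuous_fderiv (by norm_num)
  refine ((hb.mono hb.aestronglyMeasurable.norm (Eventually.of_forall fun x => (norm_norm _).le) :
    LocallyIntegrable fun x => ‖b x‖).integrable_smul_left_of_hasCompactSupport hcont.norm
    (hc.fderiv ℝ).norm).mono'
    (hb.aestronglyMeasurable.clm_apply_continuous hcont.aestronglyMeasurable)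
    (Eventually.of_forall fun x => ?_)
  exact (fderiv ℝ h x).le_opNorm _

/-- The real identity is applied to `L ∘ h` for the real-linear functionals `re` and `im`. -/
theorem IsWeakDivergence.integral_of_hasCompactSupport {b : 𝔼 → 𝔼} {D : 𝔼 → ℝ}
    (hD : IsWeakDivergence b D) {h : 𝔼 → 𝕜} (hh : ContDiff ℝ ∞ h) (hc : HasCompactSupport h) :
    ∫ x, fderiv ℝ h x (b x) = -∫ x, D x • h x := by
  obtain ⟨hb, hDl, hw⟩ := hD
  have h1 := integrable_fderiv_apply_of_hasCompactSupport hb hh hc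
  have h2 : Integrable fun x => D x • h x :=
    hDl.integrable_smul_right_of_hasCompactSupport hh.continuous hc
  have hdiff : Differentiable ℝ h := hh.differentiable (by norm_num)
  have key : ∀ L : 𝕜 →L[ℝ] ℝ, L (∫ x, fderiv ℝ h x (b x)) = L (-∫ x, D x • h x) := fun L => by
    have h3 := hw (L ∘ h) (L.contDiff.comp hh) (hc.comp_left L.map_zero)
    rw [map_neg, ← L.integral_comp_comm h1, ← L.integral_comp_comm h2]
    refine Eq.trans (integral_congr_ae (Eventually.of_forall fun x => ?_)) (h3.trans (congrArg _
      (integral_congr_ae (Eventually.of_forall fun x => ?_))))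
    · simp only
      rw [fderiv_comp x L.differentiableAt (hdiff x), L.fderiv]
      rfl
    · simp
  refine RCLike.ext ?_ ?_
  · exact key RCLike.reCLM
  · exact key RCLike.imCLM

/-- The divergence theorem for smooth functions without compact support. -/
theorem IsWeakDivergence.integral_eq {b : 𝔼 → 𝔼} {D : 𝔼 → ℝ} (hD : IsWeakDivergence b D)
    {h : 𝔼 → 𝕜} (hh : ContDiff ℝ ∞ h) (h1 : Integrable fun x => fderiv ℝ h x (b x))
    (h2 : Integrable fun x => D x • h x) (h3 : Integrable fun x => ‖b x‖ * ‖h x‖) :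
    ∫ x, fderiv ℝ h x (b x) = -∫ x, D x • h x := by
  obtain ⟨C, hC, hCle⟩ := exists_norm_fderiv_cutoff_le 𝔼
  have hdiff : Differentiable ℝ h := hh.differentiable (by norm_num)
  have hcd : ∀ n, Differentiable ℝ (cutoff 𝔼 n) := fun n =>
    (contDiff_cutoff n).differentiable (by norm_num)
  have hsm : ∀ n, ContDiff ℝ ∞ fun x => cutoff 𝔼 n x • h x := fun n => (contDiff_cutoff n).smul hh
  have key : ∀ n, ∫ x, fderiv ℝ (fun x => cutoff 𝔼 n x • h x) x (b x) =
      -∫ x, D x • (cutoff 𝔼 n x • h x) := fun n =>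
    hD.integral_of_hasCompactSupport (hsm n) (hasCompactSupport_cutoff n).smul_right
  have hder : ∀ n x, fderiv ℝ (fun x => cutoff 𝔼 n x • h x) x (b x) =
      cutoff 𝔼 n x • fderiv ℝ h x (b x) + fderiv ℝ (cutoff 𝔼 n) x (b x) • h x := fun n x =>
    fderiv_smul_apply' (hcd n x) (hdiff x) _
  have lim1 : Tendsto (fun n => ∫ x, fderiv ℝ (fun x => cutoff 𝔼 n x • h x) x (b x)) atTop
      (𝓝 (∫ x, fderiv ℝ h x (b x))) := by
    -- The second dominating term absorbs the derivative falling on the cutoff, which is bounded by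
    -- `C` uniformly in `n` and tends to `0` pointwise.
    refine tendsto_integral_of_dominated_convergence
      (fun x => ‖fderiv ℝ h x (b x)‖ + C * (‖b x‖ * ‖h x‖)) (fun n => ?_)
      (h1.norm.add (h3.const_mul C)) (fun n => Eventually.of_forall fun x => ?_)
      (Eventually.of_forall fun x => ?_)
    · exact hD.1.aestronglyMeasurable.clm_apply_continuous
        ((hsm n).continuous_fderiv (by norm_num)).aestronglyMeasurable
    · rw [hder]
      refine (norm_add_le _ _).trans (add_le_add ?_ ?_)
      · rw [norm_smul]
        exact mul_le_of_le_one_left (norm_nonneg _) (abs_cutoff_le_one n x)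
      · rw [norm_smul, ← mul_assoc]
        gcongr
        exact ((fderiv ℝ (cutoff 𝔼 n) x).le_opNorm _).trans (by gcongr; exact hCle n x)
    · simp only [hder]
      have e1 := (tendsto_cutoff x).smul_const (fderiv ℝ h x (b x))
      have e2 : Tendsto (fun n => fderiv ℝ (cutoff 𝔼 n) x (b x)) atTop (𝓝 0) := by
        have := ((ContinuousLinearMap.apply ℝ ℝ (b x)).continuous.tendsto 0).comp
          (tendsto_fderiv_cutoff x)
        rwa [map_zero] at this
      simpa using e1.add (e2.smul_const (h x))
  have lim2 : Tendsto (fun n => -∫ x, D x • (cutoff 𝔼 n x • h x)) atTop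
      (𝓝 (-∫ x, D x • h x)) := by
    refine (tendsto_integral_of_dominated_convergence (fun x => ‖D x • h x‖) (fun n => ?_)
      h2.norm (fun n => Eventually.of_forall fun x => ?_)
      (Eventually.of_forall fun x => ?_)).neg
    · exact hD.2.1.aestronglyMeasurable.smul (hsm n).continuous.aestronglyMeasurable
    · rw [smul_comm, norm_smul]
      exact mul_le_of_le_one_left (norm_nonneg _) (abs_cutoff_le_one n x)
    · simpa using ((tendsto_cutoff x).smul_const (h x)).const_smul (D x)
  simp only [key] at lim1
  exact tendsto_nhds_unique lim1 lim2

end Divergence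

/-! ### Bounded oscillating multipliers -/

section Oscillation

theorem Real.abs_iteratedDeriv_sin_cos_le (n : ℕ) :
    ∀ x, |iteratedDeriv n Real.sin x| ≤ 1 ∧ |iteratedDeriv n Real.cos x| ≤ 1 := by
  induction n with
  | zero => exact fun x => ⟨by simpa using Real.abs_sin_le_one x, by simpa using Real.abs_cos_le_one x⟩
  | succ n ih =>
    intro x
    rw [Real.iteratedDeriv_add_one_sin, Real.iteratedDeriv_add_one_cos]
    exact ⟨(ih x).2, by simpa using (ih x).1⟩

theorem Real.hasTemperateGrowth_sin : Function.HasTemperateGrowth Real.sin :=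
  ⟨Real.contDiff_sin, fun n => ⟨0, 1, fun x => by
    simpa [norm_iteratedFDeriv_eq_norm_iteratedDeriv] using (Real.abs_iteratedDeriv_sin_cos_le n x).1⟩⟩

theorem Real.hasTemperateGrowth_cos : Function.HasTemperateGrowth Real.cos :=
  ⟨Real.contDiff_cos, fun n => ⟨0, 1, fun x => by
    simpa [norm_iteratedFDeriv_eq_norm_iteratedDeriv] using (Real.abs_iteratedDeriv_sin_cos_le n x).2⟩⟩

variable {d : ℕ} {𝕜 : Type*} [RCLike 𝕜]

local notation "𝔼" => EuclideanSpace ℝ (Fin d)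

variable {μ : Measure (EuclideanSpace ℝ (Fin d))}

/-- Leibniz for the Schwartz function `θ(⟨e, x⟩) f`: the hypothesis covers it, and it covers `θ(⟨e,
x⟩) β · ∇f` since `|θ| ≤ 1`. Their difference is the term in which `β` multiplies `f` itself. -/
theorem memLp_mul_inner_smul_of_multiplier {β : 𝔼 → 𝔼} {p : ℝ≥0∞}
    (hβ : ∀ f : 𝓢(𝔼, 𝕜), MemLp (fun x => fderiv ℝ f x (β x)) p μ)
    {θ : ℝ → ℝ} (hθ : Function.HasTemperateGrowth θ) (hθ1 : ∀ t, |θ t| ≤ 1) (f : 𝓢(𝔼, 𝕜)) (e : 𝔼) :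
    MemLp (fun x => (deriv θ ⟪e, x⟫_ℝ * ⟪e, β x⟫_ℝ) • f x) p μ := by
  have hcomp : Function.HasTemperateGrowth fun x : 𝔼 => θ ⟪e, x⟫_ℝ :=
    hθ.comp (Function.hasTemperateGrowth_inner_right e)
  set g : 𝓢(𝔼, 𝕜) := SchwartzMap.smulLeftCLM 𝕜 (fun x => θ ⟪e, x⟫_ℝ) f with hg
  have hgx : (g : 𝔼 → 𝕜) = fun x => θ ⟪e, x⟫_ℝ • f x :=
    funext fun x => SchwartzMap.smulLeftCLM_apply_apply hcomp f x
  have hθd : Differentiable ℝ θ := hθ.1.differentiable (by norm_num)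
  have hder : ∀ x, fderiv ℝ g x (β x) =
      θ ⟪e, x⟫_ℝ • fderiv ℝ f x (β x) + (deriv θ ⟪e, x⟫_ℝ * ⟪e, β x⟫_ℝ) • f x := fun x => by
    have h1 : HasFDerivAt (fun x : 𝔼 => θ ⟪e, x⟫_ℝ) _ x :=
      (hθd _).hasDerivAt.comp_hasFDerivAt x (innerSL ℝ e).hasFDerivAt
    rw [hgx, fderiv_smul_apply' h1.differentiableAt f.differentiableAt, h1.fderiv]
    simp
  have hθc : AEStronglyMeasurable (fun x : 𝔼 => θ ⟪e, x⟫_ℝ) μ :=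
    (hθd.continuous.comp (by fun_prop)).aestronglyMeasurable
  have h2 : MemLp (fun x => θ ⟪e, x⟫_ℝ • fderiv ℝ f x (β x)) p μ :=
    (hβ f).of_le (hθc.smul (hβ f).1) (Eventually.of_forall fun x => by
      rw [norm_smul]
      exact mul_le_of_le_one_left (norm_nonneg _) (hθ1 _))
  refine ((hβ g).sub h2).ae_eq (Eventually.of_forall fun x => ?_)
  simp [hder]

/-- If `β · ∇f ∈ Lᵖ` for all Schwartz functions `f`, then `|β| f ∈ Lᵖ` for all of them: apply the
hypothesis to products of `f` with sines and cosines. -/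
theorem memLp_norm_mul_norm_of_forall_fderiv {β : 𝔼 → 𝔼} (hβm : AEStronglyMeasurable β μ) {p : ℝ≥0∞}
    (hβ : ∀ f : 𝓢(𝔼, 𝕜), MemLp (fun x => fderiv ℝ f x (β x)) p μ) (f : 𝓢(𝔼, 𝕜)) :
    MemLp (fun x => ‖β x‖ * ‖f x‖) p μ := by
  have hcoord : ∀ e : 𝔼, MemLp (fun x => ⟪e, β x⟫_ℝ • f x) p μ := fun e => by
    have h1 := memLp_mul_inner_smul_of_multiplier hβ Real.hasTemperateGrowth_sin
      Real.abs_sin_le_one f e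
    have h2 := memLp_mul_inner_smul_of_multiplier hβ Real.hasTemperateGrowth_cos
      Real.abs_cos_le_one f e
    have h3 : MemLp (fun x => Real.cos ⟪e, x⟫_ℝ • ((deriv Real.sin ⟪e, x⟫_ℝ * ⟪e, β x⟫_ℝ) • f x))
        p μ := h1.of_le ((by fun_prop : Continuous fun x : 𝔼 => Real.cos ⟪e, x⟫_ℝ
          ).aestronglyMeasurable.smul h1.1) (Eventually.of_forall fun x => by
        rw [norm_smul]
        exact mul_le_of_le_one_left (norm_nonneg _) (Real.abs_cos_le_one _))
    have h4 : MemLp (fun x => Real.sin ⟪e, x⟫_ℝ • ((deriv Real.cos ⟪e, x⟫_ℝ * ⟪e, β x⟫_ℝ) • f x))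
        p μ := h2.of_le ((by fun_prop : Continuous fun x : 𝔼 => Real.sin ⟪e, x⟫_ℝ
          ).aestronglyMeasurable.smul h2.1) (Eventually.of_forall fun x => by
        rw [norm_smul]
        exact mul_le_of_le_one_left (norm_nonneg _) (Real.abs_sin_le_one _))
    -- `h3` carries `cos²` and `h4` carries `-sin²`, so their difference is `⟨e, β⟩ f` without
    -- oscillation.
    refine (h3.sub h4).ae_eq (Eventually.of_forall fun x => ?_)
    simp only [Pi.sub_apply, Real.deriv_sin, Real.deriv_cos, smul_smul, ← sub_smul]
    congr 1
    linear_combination ⟪e, β x⟫_ℝ * Real.cos_sq_add_sin_sq ⟪e, x⟫_ℝ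
  set b := stdOrthonormalBasis ℝ 𝔼
  have hsum : MemLp (fun x => ∑ i, ‖⟪b i, β x⟫_ℝ • f x‖) p μ :=
    memLp_finsetSum _ fun i _ => (hcoord (b i)).norm
  refine hsum.of_le (hβm.norm.mul f.continuous.norm.aestronglyMeasurable)
    (Eventually.of_forall fun x => ?_)
  rw [Real.norm_of_nonneg (by positivity), Real.norm_of_nonneg (by positivity)]
  simp only [norm_smul, ← Finset.sum_mul]
  gcongr
  conv_lhs => rw [← b.sum_repr' (β x)]
  refine (norm_sum_le _ _).trans (le_of_eq (Finset.sum_congr rfl fun i _ => ?_))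
  rw [norm_smul, b.norm_eq_one, mul_one]

end Oscillation

/-! ### Operators on Schwartz functions and their graphs -/

section SchwartzOp

variable {d : ℕ} {𝕜 : Type*} [RCLike 𝕜]

local notation "𝔼" => EuclideanSpace ℝ (Fin d)

theorem SchwartzMap.eq_of_ae_eq {F : Type*} [NormedAddCommGroup F] [NormedSpace ℝ F]
    {μ : Measure 𝔼} (hμ : (volume : Measure 𝔼) ≪ μ) {f g : 𝓢(𝔼, F)} (h : f =ᵐ[μ] g) : f = g := by
  have h1 : (f : 𝔼 → F) = g := (f.continuous.ae_eq_iff_eq volume g.continuous).1 (hμ.ae_le h)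
  exact DFunLike.coe_injective h1

/-- Single-valuedness: a Schwartz function vanishing `μ`-almost everywhere vanishes Lebesgue-almost
everywhere, hence identically by continuity. -/
theorem graph_schwartzOp {μ : Measure 𝔼} (hμ : (volume : Measure 𝔼) ≪ μ)
    (T : 𝓢(𝔼, 𝕜) →ₗ[𝕜] (𝔼 → 𝕜)) : (schwartzOp μ T).graph = schwartzGraph μ T := by
  refine Submodule.toLinearPMap_graph_eq _ ?_
  rintro ⟨u, v⟩ ⟨f, hf1, hf2⟩ hu
  simp only at hf1 hf2 hu ⊢
  subst hu
  have hf0 : f = 0 := by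
    refine SchwartzMap.eq_of_ae_eq hμ ?_
    filter_upwards [hf1, Lp.coeFn_zero 𝕜 2 μ] with x h1 h2
    rw [← h1, h2]
    rfl
  apply Lp.ext
  filter_upwards [hf2, Lp.coeFn_zero 𝕜 2 μ] with x h1 h2
  rw [h1, h2, hf0, map_zero]

theorem toLp_mem_schwartzGraph {μ : Measure 𝔼} {T : 𝓢(𝔼, 𝕜) →ₗ[𝕜] (𝔼 → 𝕜)} {f : 𝓢(𝔼, 𝕜)}
    (hf : MemLp f 2 μ) (hT : MemLp (T f) 2 μ) : (hf.toLp f, hT.toLp (T f)) ∈ schwartzGraph μ T :=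
  ⟨f, hf.coeFn_toLp, hT.coeFn_toLp⟩

theorem dense_domain_schwartzOp {μ : Measure 𝔼} [μ.HasTemperateGrowth]
    [IsFiniteMeasureOnCompacts μ] {T : 𝓢(𝔼, 𝕜) →ₗ[𝕜] (𝔼 → 𝕜)} (hT : ∀ f, MemLp (T f) 2 μ) :
    Dense ((schwartzOp μ T).domain : Set (Lp 𝕜 2 μ)) := by
  have h := SchwartzMap.denseRange_toLpCLM (E := 𝔼) (F := 𝕜) (p := 2) ENNReal.ofNat_ne_top (μ := μ)
  refine h.mono ?_
  rintro _ ⟨f, rfl⟩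
  rw [schwartzOp, Submodule.toLinearPMap_domain]
  exact ⟨_, toLp_mem_schwartzGraph (f.memLp 2 μ) (hT f), rfl⟩

theorem L2.inner_eq_integral_of_ae_eq {μ : Measure 𝔼} {u v : Lp 𝕜 2 μ} {f g : 𝔼 → 𝕜}
    (hu : u =ᵐ[μ] f) (hv : v =ᵐ[μ] g) : ⟪u, v⟫_𝕜 = ∫ x, ⟪f x, g x⟫_𝕜 ∂μ := by
  rw [L2.inner_def]
  refine integral_congr_ae ?_
  filter_upwards [hu, hv] with x h1 h2
  rw [h1, h2]

theorem mem_adjoint_graph_schwartzOp_iff {μ : Measure 𝔼} (hμ : (volume : Measure 𝔼) ≪ μ)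
    [μ.HasTemperateGrowth] [IsFiniteMeasureOnCompacts μ] {T : 𝓢(𝔼, 𝕜) →ₗ[𝕜] (𝔼 → 𝕜)}
    (hT : ∀ f, MemLp (T f) 2 μ) (u v : Lp 𝕜 2 μ) :
    (u, v) ∈ (schwartzOp μ T).adjoint.graph ↔
      ∀ f : 𝓢(𝔼, 𝕜), ∫ x, ⟪T f x, u x⟫_𝕜 ∂μ = ∫ x, ⟪f x, v x⟫_𝕜 ∂μ := by
  have hd := dense_domain_schwartzOp hT
  have key := LinearPMap.mem_adjoint_graph_iff (A := schwartzOp μ T) hd u v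
  rw [graph_schwartzOp hμ] at key
  rw [key]
  constructor
  · intro h f
    have h1 := h _ (toLp_mem_schwartzGraph (f.memLp 2 μ) (hT f))
    rwa [L2.inner_eq_integral_of_ae_eq (hT f).coeFn_toLp (ae_eq_refl _),
      L2.inner_eq_integral_of_ae_eq (f.memLp 2 μ).coeFn_toLp (ae_eq_refl _)] at h1
  · rintro h p ⟨f, hf1, hf2⟩
    rw [L2.inner_eq_integral_of_ae_eq hf2 (ae_eq_refl _),
      L2.inner_eq_integral_of_ae_eq hf1 (ae_eq_refl _)]
    exact h f

theorem MeasureTheory.MemLp.integrable_inner_of_two {α : Type*} [MeasurableSpace α]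
    {μ : Measure α} {f g : α → 𝕜} (hf : MemLp f 2 μ) (hg : MemLp g 2 μ) :
    Integrable (fun x => ⟪f x, g x⟫_𝕜) μ := by
  refine (L2.integrable_inner (𝕜 := 𝕜) (hf.toLp f) (hg.toLp g)).congr ?_
  filter_upwards [hf.coeFn_toLp, hg.coeFn_toLp] with x h1 h2
  rw [h1, h2]

/-- The function `Δh + β · ∇h`. -/
def driftFun {F : Type*} [NormedAddCommGroup F] [NormedSpace ℝ F] (β : 𝔼 → 𝔼) (h : 𝔼 → F)
    (x : 𝔼) : F :=
  Laplacian.laplacian h x + fderiv ℝ h x (β x)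

theorem driftExpr_apply (β : 𝔼 → 𝔼) (f : 𝓢(𝔼, 𝕜)) (x : 𝔼) :
    driftExpr 𝕜 β f x = driftFun β f x := by
  simp [driftExpr, diffExpr, driftFun]

theorem driftExpr_eq (β : 𝔼 → 𝔼) (f : 𝓢(𝔼, 𝕜)) : driftExpr 𝕜 β f = driftFun β f :=
  funext (driftExpr_apply β f)

theorem driftFun_smul {F : Type*} [NormedAddCommGroup F] [NormedSpace ℝ F] {β : 𝔼 → 𝔼}
    {a : 𝔼 → ℝ} {h : 𝔼 → F} (ha : ContDiff ℝ 2 a) (hh : ContDiff ℝ 2 h) {x v : 𝔼}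
    (hv : ∀ e, fderiv ℝ a x e = ⟪v, e⟫_ℝ) :
    driftFun β (fun y => a y • h y) x =
      a x • driftFun β h x + (2 : ℝ) • fderiv ℝ h x v + driftFun β a x • h x := by
  rw [driftFun, laplacian_smul_apply_of_gradient ha hh hv, fderiv_smul_apply'
    (ha.differentiable (by norm_num) x) (hh.differentiable (by norm_num) x), driftFun, driftFun]
  module

theorem driftFun_clm_comp {F F' : Type*} [NormedAddCommGroup F] [NormedSpace ℝ F]
    [NormedAddCommGroup F'] [NormedSpace ℝ F'] {β : 𝔼 → 𝔼} (L : F →L[ℝ] F') {h : 𝔼 → F}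
    (hh : ContDiff ℝ 2 h) (x : 𝔼) : driftFun β (fun y => L (h y)) x = L (driftFun β h x) := by
  have h1 : fderiv ℝ (L ∘ h) x (β x) = L (fderiv ℝ h x (β x)) := by
    rw [fderiv_comp x L.differentiableAt (hh.differentiable (by norm_num) x), L.fderiv]
    rfl
  change Laplacian.laplacian (L ∘ h) x + fderiv ℝ (L ∘ h) x (β x) = _
  rw [hh.contDiffAt.laplacian_CLM_comp_left, h1, driftFun, map_add]
  rfl

theorem SchwartzMap.memLp_laplacian {F : Type*} [NormedAddCommGroup F] [NormedSpace ℝ F]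
    (f : 𝓢(𝔼, F)) (μ : Measure 𝔼) [μ.HasTemperateGrowth] :
    MemLp (Laplacian.laplacian (f : 𝔼 → F)) 2 μ := by
  have h := (Laplacian.laplacian f : 𝓢(𝔼, F)).memLp 2 μ
  have h1 : ((Laplacian.laplacian f : 𝓢(𝔼, F)) : 𝔼 → F) = Laplacian.laplacian (f : 𝔼 → F) :=
    funext fun x => SchwartzMap.laplacian_apply f x
  rwa [h1] at h

theorem memLp_driftExpr {μ : Measure 𝔼} [μ.HasTemperateGrowth] {β : 𝔼 → 𝔼}
    (hβ : ∀ f : 𝓢(𝔼, 𝕜), MemLp (fun x => fderiv ℝ f x (β x)) 2 μ) (f : 𝓢(𝔼, 𝕜)) :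
    MemLp (driftExpr 𝕜 β f) 2 μ := by
  rw [driftExpr_eq]
  exact (f.memLp_laplacian μ).add (hβ f)

theorem ContDiff.two_of_infty {E F : Type*} [NormedAddCommGroup E] [NormedSpace ℝ E]
    [NormedAddCommGroup F] [NormedSpace ℝ F] {f : E → F} (hf : ContDiff ℝ ∞ f) : ContDiff ℝ 2 f :=
  hf.of_le (by norm_cast)

end SchwartzOp

/-! ### The adjoint with respect to Lebesgue measure -/

section LebesgueAdjoint

variable {d : ℕ} {𝕜 : Type*} [RCLike 𝕜]

local notation "𝔼" => EuclideanSpace ℝ (Fin d)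

theorem SchwartzMap.integral_inner_laplacian (f g : 𝓢(𝔼, 𝕜)) :
    ∫ x, ⟪Laplacian.laplacian (f : 𝔼 → 𝕜) x, g x⟫_𝕜 =
      ∫ x, ⟪f x, Laplacian.laplacian (g : 𝔼 → 𝕜) x⟫_𝕜 := by
  have h := SchwartzMap.integral_bilinear_laplacian_right_eq_left (μ := volume) f g
    ((ContinuousLinearMap.mul ℝ 𝕜).comp (RCLike.conjCLE (K := 𝕜) : 𝕜 →L[ℝ] 𝕜))
  simp only [ContinuousLinearMap.comp_apply, ContinuousLinearMap.mul_apply',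
    ContinuousLinearEquiv.coe_coe, RCLike.conjCLE_apply, SchwartzMap.laplacian_apply] at h
  simp only [RCLike.inner_apply, mul_comm _ ((starRingEnd 𝕜) _)]
  exact h.symm

/-- The divergence theorem for the function `⟨f, g⟩`, combined with Green's formula for Schwartz
functions. Integrability of `|β| |f| |g|`, in `i4`, is where the oscillation argument is used. -/
theorem integral_inner_driftExpr {β : 𝔼 → 𝔼} {D : 𝔼 → ℝ} (hD : IsWeakDivergence β D)
    (hβ : ∀ f : 𝓢(𝔼, 𝕜), MemLp (fun x => fderiv ℝ f x (β x)) 2 volume)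
    (hDf : ∀ f : 𝓢(𝔼, 𝕜), MemLp (fun x => (D x : 𝕜) * f x) 2 volume) (f g : 𝓢(𝔼, 𝕜)) :
    ∫ x, ⟪driftExpr 𝕜 β f x, g x⟫_𝕜 = ∫ x, ⟪f x, driftAdjointExpr 𝕜 β D g x⟫_𝕜 := by
  have hinner : ContDiff ℝ ∞ fun x => ⟪f x, g x⟫_𝕜 := f.smooth'.inner 𝕜 g.smooth'
  have hder : ∀ x e, fderiv ℝ (fun x => ⟪f x, g x⟫_𝕜) x e =
      ⟪f x, fderiv ℝ g x e⟫_𝕜 + ⟪fderiv ℝ f x e, g x⟫_𝕜 := fun x e =>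
    fderiv_inner_apply 𝕜 f.differentiableAt g.differentiableAt e
  have i1 : Integrable fun x => ⟪f x, fderiv ℝ g x (β x)⟫_𝕜 :=
    (f.memLp 2).integrable_inner_of_two (hβ g)
  have i2 : Integrable fun x => ⟪fderiv ℝ f x (β x), g x⟫_𝕜 :=
    (hβ f).integrable_inner_of_two (g.memLp 2)
  have i3 : Integrable fun x => D x • ⟪f x, g x⟫_𝕜 := by
    refine ((f.memLp 2).integrable_inner_of_two (hDf g)).congr (Eventually.of_forall fun x => ?_)
    simp only [RCLike.inner_apply, RCLike.real_smul_eq_coe_mul]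
    ring
  have i4 : Integrable fun x => ‖β x‖ * ‖⟪f x, g x⟫_𝕜‖ := by
    refine ((memLp_norm_mul_norm_of_forall_fderiv hD.1.aestronglyMeasurable hβ f).integrable_mul
      (g.memLp 2).norm).congr (Eventually.of_forall fun x => ?_)
    simp only [RCLike.inner_apply, Pi.mul_apply, norm_mul, RCLike.norm_conj]
    ring
  have i5 : Integrable fun x => ⟪Laplacian.laplacian (f : 𝔼 → 𝕜) x, g x⟫_𝕜 :=
    (f.memLp_laplacian volume).integrable_inner_of_two (g.memLp 2)
  have i6 : Integrable fun x => ⟪f x, Laplacian.laplacian (g : 𝔼 → 𝕜) x⟫_𝕜 :=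
    (f.memLp 2).integrable_inner_of_two (g.memLp_laplacian volume)
  have hdiv := hD.integral_eq hinner ((i1.add i2).congr (Eventually.of_forall fun x =>
    (hder x _).symm)) i3 i4
  simp only [hder] at hdiv
  rw [integral_add i1 i2] at hdiv
  have e1 : ∀ x, ⟪driftExpr 𝕜 β f x, g x⟫_𝕜 =
      ⟪Laplacian.laplacian (f : 𝔼 → 𝕜) x, g x⟫_𝕜 + ⟪fderiv ℝ f x (β x), g x⟫_𝕜 := fun x => by
    rw [driftExpr_apply, driftFun, inner_add_left]
  have e2 : ∀ x, ⟪f x, driftAdjointExpr 𝕜 β D g x⟫_𝕜 =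
      ⟪f x, Laplacian.laplacian (g : 𝔼 → 𝕜) x⟫_𝕜 -
        (⟪f x, fderiv ℝ g x (β x)⟫_𝕜 + D x • ⟪f x, g x⟫_𝕜) := fun x => by
    simp only [driftAdjointExpr, diffExpr, LinearMap.coe_mk, AddHom.coe_mk, RCLike.inner_apply,
      RCLike.real_smul_eq_coe_mul, map_neg, RCLike.ofReal_one]
    ring
  simp only [e1, e2]
  have i13 : Integrable fun x => ⟪f x, fderiv ℝ g x (β x)⟫_𝕜 + D x • ⟪f x, g x⟫_𝕜 := i1.add i3
  rw [integral_add i5 i2, integral_sub i6 i13, integral_add i1 i3,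
    SchwartzMap.integral_inner_laplacian]
  linear_combination hdiv

theorem driftAdjointExpr_le_adjoint {β : 𝔼 → 𝔼} {D : 𝔼 → ℝ} (hD : IsWeakDivergence β D)
    (hβ : ∀ f : 𝓢(𝔼, 𝕜), MemLp (fun x => fderiv ℝ f x (β x)) 2 volume)
    (hDf : ∀ f : 𝓢(𝔼, 𝕜), MemLp (fun x => (D x : 𝕜) * f x) 2 volume) :
    schwartzOp volume (driftAdjointExpr 𝕜 β D) ≤ (schwartzOp volume (driftExpr 𝕜 β)).adjoint := by
  apply LinearPMap.le_of_le_graph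
  rw [graph_schwartzOp Measure.AbsolutelyContinuous.rfl]
  rintro ⟨u, v⟩ ⟨g, hg1, hg2⟩
  rw [mem_adjoint_graph_schwartzOp_iff Measure.AbsolutelyContinuous.rfl (memLp_driftExpr hβ)]
  intro f
  refine Eq.trans (integral_congr_ae ?_) ((integral_inner_driftExpr hD hβ hDf f g).trans
    (integral_congr_ae ?_))
  · filter_upwards [hg1] with x hx
    rw [← hx]
  · filter_upwards [hg2] with x hx
    rw [← hx]

/-- Weak solutions tested against real test functions are weak solutions tested against smooth
compactly supported `𝕜`-valued functions. -/
theorem integral_inner_driftFun_of_real {β : 𝔼 → 𝔼}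
    (hβ : ∀ f : 𝓢(𝔼, 𝕜), MemLp (fun x => fderiv ℝ f x (β x)) 2 volume)
    {u v : Lp 𝕜 2 (volume : Measure 𝔼)}
    (h : ∀ ψ : 𝔼 → ℝ, ContDiff ℝ ∞ ψ → HasCompactSupport ψ →
      ∫ x, ((driftFun β ψ x : ℝ) : 𝕜) * u x = ∫ x, (ψ x : 𝕜) * v x)
    {f : 𝔼 → 𝕜} (hf : ContDiff ℝ ∞ f) (hc : HasCompactSupport f) :
    ∫ x, ⟪driftFun β f x, u x⟫_𝕜 = ∫ x, ⟪f x, v x⟫_𝕜 := by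
  have int1 : ∀ ψ : 𝔼 → ℝ, ContDiff ℝ ∞ ψ → HasCompactSupport ψ →
      Integrable fun x => ((driftFun β ψ x : ℝ) : 𝕜) * u x := fun ψ hψ hψc => by
    have hs : ContDiff ℝ ∞ fun x => (ψ x : 𝕜) := (RCLike.ofRealCLM (K := 𝕜)).contDiff.comp hψ
    have hsc : HasCompactSupport fun x => (ψ x : 𝕜) := hψc.comp_left (RCLike.ofReal_zero)
    refine ((memLp_driftExpr hβ (hsc.toSchwartzMap hs)).integrable_inner_of_two (Lp.memLp u)).congr
      (Eventually.of_forall fun x => ?_)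
    have h1 : driftFun β (fun x => (ψ x : 𝕜)) x = ((driftFun β ψ x : ℝ) : 𝕜) :=
      driftFun_clm_comp (RCLike.ofRealCLM (K := 𝕜)) hψ.two_of_infty x
    have h2 : driftExpr 𝕜 β (hsc.toSchwartzMap hs) x = ((driftFun β ψ x : ℝ) : 𝕜) := by
      rw [driftExpr_apply]
      exact h1
    simp only [h2, RCLike.inner_apply, RCLike.conj_ofReal]
    ring
  have int2 : ∀ ψ : 𝔼 → ℝ, ContDiff ℝ ∞ ψ → HasCompactSupport ψ →
      Integrable fun x => (ψ x : 𝕜) * v x := fun ψ hψ hψc => by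
    have hs : ContDiff ℝ ∞ fun x => (ψ x : 𝕜) := (RCLike.ofRealCLM (K := 𝕜)).contDiff.comp hψ
    have hsc : HasCompactSupport fun x => (ψ x : 𝕜) := hψc.comp_left (RCLike.ofReal_zero)
    refine (((hsc.toSchwartzMap hs).memLp 2).integrable_inner_of_two (Lp.memLp v)).congr
      (Eventually.of_forall fun x => ?_)
    simp only [HasCompactSupport.toSchwartzMap_toFun, RCLike.inner_apply]
    rw [RCLike.conj_ofReal]
    ring
  have hre : ContDiff ℝ ∞ fun x => RCLike.re (f x) := (RCLike.reCLM (K := 𝕜)).contDiff.comp hf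
  have him : ContDiff ℝ ∞ fun x => RCLike.im (f x) := (RCLike.imCLM (K := 𝕜)).contDiff.comp hf
  have hrec : HasCompactSupport fun x => RCLike.re (f x) := hc.comp_left (map_zero _)
  have himc : HasCompactSupport fun x => RCLike.im (f x) := hc.comp_left (map_zero _)
  -- The inner product is conjugate-linear in its first argument, hence the minus sign before `I`.
  have e1 : ∀ x, ⟪driftFun β f x, u x⟫_𝕜 =
      ((driftFun β (fun x => RCLike.re (f x)) x : ℝ) : 𝕜) * u x -
        RCLike.I * (((driftFun β (fun x => RCLike.im (f x)) x : ℝ) : 𝕜) * u x) := fun x => by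
    have a1 : driftFun β (fun x => RCLike.re (f x)) x = RCLike.re (driftFun β f x) :=
      driftFun_clm_comp (RCLike.reCLM (K := 𝕜)) hf.two_of_infty x
    have a2 : driftFun β (fun x => RCLike.im (f x)) x = RCLike.im (driftFun β f x) :=
      driftFun_clm_comp (RCLike.imCLM (K := 𝕜)) hf.two_of_infty x
    rw [a1, a2, RCLike.inner_apply, RCLike.conj_eq_re_sub_im]
    ring
  have e2 : ∀ x, ⟪f x, v x⟫_𝕜 = ((RCLike.re (f x) : ℝ) : 𝕜) * v x -
      RCLike.I * (((RCLike.im (f x) : ℝ) : 𝕜) * v x) := fun x => by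
    rw [RCLike.inner_apply, RCLike.conj_eq_re_sub_im]
    ring
  simp only [e1, e2]
  rw [integral_sub (int1 _ hre hrec) ((int1 _ him himc).const_mul _),
    integral_sub (int2 _ hre hrec) ((int2 _ him himc).const_mul _), integral_const_mul,
    integral_const_mul, h _ hre hrec, h _ him himc]

/-- For Schwartz `f` and cutoffs `χ`, `L(χ f) = χ L f + 2 ∇χ · ∇f + (L χ) f` is dominated by a fixed
`L²` function, the drift part of `L χ` being controlled by `|β| |f| ∈ L²`. So compactly supported
test functions determine the adjoint. -/
theorem mem_adjoint_graph_driftExpr_iff {β : 𝔼 → 𝔼} (hβl : LocallyIntegrable β)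
    (hβ : ∀ f : 𝓢(𝔼, 𝕜), MemLp (fun x => fderiv ℝ f x (β x)) 2 volume)
    (u v : Lp 𝕜 2 (volume : Measure 𝔼)) :
    (u, v) ∈ (schwartzOp volume (driftExpr 𝕜 β)).adjoint.graph ↔
      ∀ ψ : 𝔼 → ℝ, ContDiff ℝ ∞ ψ → HasCompactSupport ψ →
        ∫ x, ((driftFun β ψ x : ℝ) : 𝕜) * u x = ∫ x, (ψ x : 𝕜) * v x := by
  rw [mem_adjoint_graph_schwartzOp_iff Measure.AbsolutelyContinuous.rfl (memLp_driftExpr hβ)]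
  constructor
  · intro h ψ hψ hψc
    have hs : ContDiff ℝ ∞ fun x => (ψ x : 𝕜) := (RCLike.ofRealCLM (K := 𝕜)).contDiff.comp hψ
    have hsc : HasCompactSupport fun x => (ψ x : 𝕜) := hψc.comp_left (RCLike.ofReal_zero)
    refine Eq.trans (integral_congr_ae (Eventually.of_forall fun x => ?_))
      ((h (hsc.toSchwartzMap hs)).trans (integral_congr_ae (Eventually.of_forall fun x => ?_)))
    · have h1 : driftFun β (fun x => (ψ x : 𝕜)) x = ((driftFun β ψ x : ℝ) : 𝕜) :=
        driftFun_clm_comp (RCLike.ofRealCLM (K := 𝕜)) hψ.two_of_infty x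
      have h2 : driftExpr 𝕜 β (hsc.toSchwartzMap hs) x = ((driftFun β ψ x : ℝ) : 𝕜) := by
        rw [driftExpr_apply]
        exact h1
      simp only [h2, RCLike.inner_apply, RCLike.conj_ofReal]
      ring
    · change ⟪(ψ x : 𝕜), v x⟫_𝕜 = _
      rw [RCLike.inner_apply, RCLike.conj_ofReal, mul_comm]
  · intro h f
    obtain ⟨C, hC, hCle⟩ := exists_norm_fderiv_cutoff_le 𝔼
    obtain ⟨C', hC', hCle'⟩ := exists_abs_laplacian_cutoff_le 𝔼
    have hfn : ∀ n, ContDiff ℝ ∞ fun x => cutoff 𝔼 n x • f x := fun n =>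
      (contDiff_cutoff n).smul f.smooth'
    have hfc : ∀ n, HasCompactSupport fun x => cutoff 𝔼 n x • f x := fun n =>
      (hasCompactSupport_cutoff n).smul_right
    have key := fun n => integral_inner_driftFun_of_real hβ h (hfn n) (hfc n)
    have hL : ∀ n, driftFun β (fun x => cutoff 𝔼 n x • f x) =
        driftExpr 𝕜 β ((hfc n).toSchwartzMap (hfn n)) := fun n =>
      (driftExpr_eq β ((hfc n).toSchwartzMap (hfn n))).symm
    have hum : MemLp (fun x => ‖u x‖) 2 volume := (Lp.memLp u).norm
    have hβf := memLp_norm_mul_norm_of_forall_fderiv hβl.aestronglyMeasurable hβ f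
    have hdf : MemLp (fun x => ‖fderiv ℝ f x‖) 2 volume := by
      simpa only [SchwartzMap.fderivCLM_apply] using
        ((SchwartzMap.fderivCLM ℝ 𝔼 𝕜 f).memLp 2 volume).norm
    have hfs : ContDiff ℝ ∞ (f : 𝔼 → 𝕜) := f.smooth'
    have hbound : MemLp (fun x => ‖driftExpr 𝕜 β f x‖ + 2 * C * ‖fderiv ℝ f x‖ +
        (C' * ‖f x‖ + C * (‖β x‖ * ‖f x‖))) 2 volume :=
      ((memLp_driftExpr hβ f).norm.add (hdf.const_mul _)).add
        (((f.memLp 2).norm.const_mul _).add (hβf.const_mul _))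
    have hexp : ∀ n x, ∃ w : 𝔼, ‖w‖ = ‖fderiv ℝ (cutoff 𝔼 n) x‖ ∧
        driftFun β (fun x => cutoff 𝔼 n x • f x) x = cutoff 𝔼 n x • driftExpr 𝕜 β f x +
          (2 : ℝ) • fderiv ℝ f x w + driftFun β (cutoff 𝔼 n) x • f x := fun n x => by
      obtain ⟨w, hw, hwn⟩ := exists_gradient (cutoff 𝔼 n) x
      refine ⟨w, hwn, ?_⟩
      rw [driftFun_smul (contDiff_cutoff n).two_of_infty hfs.two_of_infty hw, driftExpr_apply]
    have lim1 : Tendsto (fun n => ∫ x, ⟪driftFun β (fun x => cutoff 𝔼 n x • f x) x, u x⟫_𝕜) atTop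
        (𝓝 (∫ x, ⟪driftExpr 𝕜 β f x, u x⟫_𝕜)) := by
      refine tendsto_integral_of_dominated_convergence _ (fun n => ?_)
        (hbound.integrable_mul hum) (fun n => Eventually.of_forall fun x => ?_)
        (Eventually.of_forall fun x => ?_)
      · rw [hL]
        exact (memLp_driftExpr hβ _).1.inner (Lp.aestronglyMeasurable u)
      · rw [Pi.mul_apply]
        refine (norm_inner_le_norm _ _).trans ?_
        gcongr
        obtain ⟨w, hwn, hw⟩ := hexp n x
        rw [hw]
        refine (norm_add_le _ _).trans (add_le_add ((norm_add_le _ _).trans (add_le_add ?_ ?_)) ?_)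
        · rw [norm_smul]
          exact mul_le_of_le_one_left (norm_nonneg _) (abs_cutoff_le_one n x)
        · rw [norm_smul, Real.norm_of_nonneg zero_le_two, mul_assoc]
          have := (fderiv ℝ f x).le_opNorm w
          have h2 : ‖w‖ ≤ C := hwn ▸ hCle n x
          nlinarith [norm_nonneg (fderiv ℝ f x)]
        · rw [norm_smul, ← mul_assoc, ← add_mul]
          gcongr
          refine (norm_add_le _ _).trans (add_le_add (hCle' n x) ?_)
          exact ((fderiv ℝ (cutoff 𝔼 n) x).le_opNorm _).trans (by gcongr; exact hCle n x)
      · refine Tendsto.inner ?_ tendsto_const_nhds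
        choose w hwn hw using fun n => hexp n x
        simp only [hw]
        have w0 : Tendsto w atTop (𝓝 0) := by
          rw [tendsto_zero_iff_norm_tendsto_zero]
          simp only [hwn]
          simpa using (tendsto_fderiv_cutoff x).norm
        have t1 := (tendsto_cutoff x).smul_const (driftExpr 𝕜 β f x)
        have t2 : Tendsto (fun n => (2 : ℝ) • fderiv ℝ f x (w n)) atTop (𝓝 ((2 : ℝ) • 0)) := by
          have := ((fderiv ℝ f x).continuous.tendsto 0).comp w0
          rw [map_zero] at this
          exact this.const_smul _
        have t3 : Tendsto (fun n => driftFun β (cutoff 𝔼 n) x) atTop (𝓝 0) := by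
          have := ((ContinuousLinearMap.apply ℝ ℝ (β x)).continuous.tendsto 0).comp
            (tendsto_fderiv_cutoff x)
          rw [map_zero] at this
          simpa using! (tendsto_laplacian_cutoff x).add this
        simpa using (t1.add t2).add (t3.smul_const (f x))
    have lim2 : Tendsto (fun n => ∫ x, ⟪cutoff 𝔼 n x • f x, v x⟫_𝕜) atTop
        (𝓝 (∫ x, ⟪f x, v x⟫_𝕜)) := by
      refine tendsto_integral_of_dominated_convergence _ (fun n => ?_)
        ((f.memLp 2).norm.integrable_mul (Lp.memLp v).norm) (fun n => Eventually.of_forall fun x => ?_)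
        (Eventually.of_forall fun x => ?_)
      · exact (hfn n).continuous.aestronglyMeasurable.inner (Lp.aestronglyMeasurable v)
      · rw [Pi.mul_apply]
        refine (norm_inner_le_norm _ _).trans ?_
        gcongr
        rw [norm_smul]
        exact mul_le_of_le_one_left (norm_nonneg _) (abs_cutoff_le_one n x)
      · refine Tendsto.inner ?_ tendsto_const_nhds
        simpa using (tendsto_cutoff x).smul_const (f x)
    simp only [key] at lim1
    exact tendsto_nhds_unique lim1 lim2

end LebesgueAdjoint

/-! ### Bounded regularizations of the exponential function -/

section RegExp

/-- The bounded smooth approximation `1 / (e^{as} + c)` of `e^{-as}`. -/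
def regExp (a c s : ℝ) : ℝ := (Real.exp (a * s) + c)⁻¹

variable {a c : ℝ}

theorem regExp_den_pos (hc : 0 < c) (s : ℝ) : 0 < Real.exp (a * s) + c :=
  add_pos (Real.exp_pos _) hc

theorem contDiff_regExp (hc : 0 < c) : ContDiff ℝ ∞ (regExp a c) :=
  ((Real.contDiff_exp.comp (contDiff_const.mul contDiff_id)).add contDiff_const).inv
    fun s => (regExp_den_pos hc s).ne'

theorem regExp_pos (hc : 0 < c) (s : ℝ) : 0 < regExp a c s := inv_pos.2 (regExp_den_pos hc s)

theorem regExp_le_inv (hc : 0 < c) (s : ℝ) : regExp a c s ≤ c⁻¹ :=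
  inv_anti₀ hc (le_add_of_nonneg_left (Real.exp_pos _).le)

theorem regExp_le_exp (hc : 0 < c) (s : ℝ) : regExp a c s ≤ Real.exp (-(a * s)) := by
  rw [Real.exp_neg]
  exact inv_anti₀ (Real.exp_pos _) (le_add_of_nonneg_right hc.le)

/-- With `F = regExp a c` and `θ = e^{as} F(s) ∈ [0, 1]` one has `F' = -a θ F` and `F'' = a² θ (2θ -
1) F`. Both are therefore bounded for fixed `c`, dominated by multiples of `e^{-as}` uniformly in
`c`, and convergent as `c → 0` because `θ → 1`. -/
theorem exp_mul_regExp_mem (hc : 0 < c) (s : ℝ) :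
    0 ≤ Real.exp (a * s) * regExp a c s ∧ Real.exp (a * s) * regExp a c s ≤ 1 := by
  refine ⟨mul_nonneg (Real.exp_pos _).le (regExp_pos hc s).le, ?_⟩
  rw [regExp, ← div_eq_mul_inv, div_le_one (regExp_den_pos hc s)]
  exact le_add_of_nonneg_right hc.le

theorem hasDerivAt_exp_mul (a s : ℝ) :
    HasDerivAt (fun s => Real.exp (a * s)) (a * Real.exp (a * s)) s := by
  have h := ((hasDerivAt_id s).const_mul a).exp
  simpa [mul_comm] using h

theorem hasDerivAt_regExp (hc : 0 < c) (s : ℝ) :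
    HasDerivAt (regExp a c) (-(a * (Real.exp (a * s) * regExp a c s) * regExp a c s)) s := by
  have h := ((hasDerivAt_exp_mul a s).add_const c).inv (regExp_den_pos hc s).ne'
  refine HasDerivAt.congr_deriv (f := regExp a c) h ?_
  simp only [regExp]
  have := (regExp_den_pos (a := a) hc s).ne'
  field_simp

theorem deriv_regExp (hc : 0 < c) : deriv (regExp a c) =
    fun s => -(a * (Real.exp (a * s) * regExp a c s) * regExp a c s) :=
  funext fun s => (hasDerivAt_regExp hc s).deriv

theorem deriv_deriv_regExp (hc : 0 < c) (s : ℝ) : deriv (deriv (regExp a c)) s =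
    a ^ 2 * ((Real.exp (a * s) * regExp a c s) * (2 * (Real.exp (a * s) * regExp a c s) - 1)) *
      regExp a c s := by
  rw [deriv_regExp hc]
  have h0 := hasDerivAt_regExp (a := a) hc s
  have h := (((((hasDerivAt_exp_mul a s).mul h0).const_mul a).mul h0).neg).deriv
  simp only [Pi.mul_apply] at h
  refine (Eq.trans (congrArg (fun f => deriv f s) ?_) h).trans ?_
  · rfl
  · ring

theorem abs_regExp_le (hc : 0 < c) (s : ℝ) : |regExp a c s| ≤ Real.exp (-(a * s)) := by
  rw [abs_of_pos (regExp_pos hc s)]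
  exact regExp_le_exp hc s

theorem abs_deriv_regExp_le (hc : 0 < c) (s : ℝ) :
    |deriv (regExp a c) s| ≤ |a| * regExp a c s := by
  obtain ⟨h0, h1⟩ := exp_mul_regExp_mem (a := a) hc s
  simp only [deriv_regExp hc]
  rw [abs_neg, abs_mul, abs_mul, abs_of_nonneg h0, abs_of_pos (regExp_pos hc s)]
  have := regExp_pos (a := a) hc s
  gcongr
  exact mul_le_of_le_one_right (abs_nonneg _) h1

theorem abs_deriv_deriv_regExp_le (hc : 0 < c) (s : ℝ) :
    |deriv (deriv (regExp a c)) s| ≤ a ^ 2 * regExp a c s := by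
  obtain ⟨h0, h1⟩ := exp_mul_regExp_mem (a := a) hc s
  rw [deriv_deriv_regExp hc, abs_mul, abs_mul, abs_of_nonneg (sq_nonneg a),
    abs_of_pos (regExp_pos hc s)]
  have := regExp_pos (a := a) hc s
  gcongr
  refine mul_le_of_le_one_right (sq_nonneg a) ?_
  rw [abs_le]
  constructor <;> nlinarith

theorem exists_bound_regExp (a : ℝ) (hc : 0 < c) : ∃ C, 0 ≤ C ∧ (∀ s, |regExp a c s| ≤ C) ∧
    (∀ s, |deriv (regExp a c) s| ≤ C) ∧ ∀ s, |deriv (deriv (regExp a c)) s| ≤ C := by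
  have hc' : 0 ≤ c⁻¹ := (inv_pos.2 hc).le
  refine ⟨(1 + |a| + a ^ 2) * c⁻¹, by positivity, fun s => ?_, fun s => ?_, fun s => ?_⟩
  · rw [abs_of_pos (regExp_pos hc s)]
    nlinarith [regExp_le_inv (a := a) hc s, mul_nonneg (abs_nonneg a) hc',
      mul_nonneg (sq_nonneg a) hc']
  · refine (abs_deriv_regExp_le hc s).trans ?_
    nlinarith [mul_le_mul_of_nonneg_left (regExp_le_inv (a := a) hc s) (abs_nonneg a),
      mul_nonneg (sq_nonneg a) hc']
  · refine (abs_deriv_deriv_regExp_le hc s).trans ?_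
    nlinarith [mul_le_mul_of_nonneg_left (regExp_le_inv (a := a) hc s) (sq_nonneg a),
      mul_nonneg (abs_nonneg a) hc']

theorem tendsto_regExp (a s : ℝ) :
    Tendsto (fun k : ℕ => regExp a (1 / ((k : ℝ) + 1)) s) atTop (𝓝 (Real.exp (-(a * s)))) := by
  rw [Real.exp_neg]
  refine Tendsto.inv₀ ?_ (Real.exp_pos _).ne'
  simpa using (tendsto_const_nhds (x := Real.exp (a * s))).add
    (tendsto_one_div_add_atTop_nhds_zero_nat (𝕜 := ℝ))

theorem tendsto_exp_mul_regExp (a s : ℝ) :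
    Tendsto (fun k : ℕ => Real.exp (a * s) * regExp a (1 / ((k : ℝ) + 1)) s) atTop (𝓝 1) := by
  have h := (tendsto_regExp a s).const_mul (Real.exp (a * s))
  rwa [← Real.exp_add, add_neg_cancel, Real.exp_zero] at h

theorem tendsto_deriv_regExp (a s : ℝ) :
    Tendsto (fun k : ℕ => deriv (regExp a (1 / ((k : ℝ) + 1))) s) atTop
      (𝓝 (-a * Real.exp (-(a * s)))) := by
  have h := (((tendsto_exp_mul_regExp a s).const_mul a).mul (tendsto_regExp a s)).neg
  rw [mul_one, ← neg_mul] at h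
  refine h.congr fun k => ?_
  rw [deriv_regExp (by positivity)]

theorem tendsto_deriv_deriv_regExp (a s : ℝ) :
    Tendsto (fun k : ℕ => deriv (deriv (regExp a (1 / ((k : ℝ) + 1)))) s) atTop
      (𝓝 (a ^ 2 * Real.exp (-(a * s)))) := by
  have h1 := tendsto_exp_mul_regExp a s
  have h := ((h1.mul ((h1.const_mul 2).sub_const 1)).const_mul (a ^ 2)).mul (tendsto_regExp a s)
  norm_num at h
  refine h.congr fun k => ?_
  rw [deriv_deriv_regExp (by positivity)]
  simp only [one_div]

end RegExp

/-! ### The chain rule for weak gradients -/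

section ChainRule

variable {d : ℕ}

local notation "𝔼" => EuclideanSpace ℝ (Fin d)

theorem MeasureTheory.LocallyIntegrable.integrable_indicator_closedBall {F : Type*}
    [NormedAddCommGroup F] {h : 𝔼 → F} (hh : LocallyIntegrable h) (R : ℝ) :
    Integrable ((Metric.closedBall (0 : 𝔼) R).indicator h) :=
  (hh.integrableOn_isCompact (isCompact_closedBall _ _)).integrable_indicator
    Metric.isClosed_closedBall.measurableSet

theorem HasCompactSupport.exists_eq_zero_of_norm_gt {F : Type*} [Zero F] {ψ : 𝔼 → F}
    (h : HasCompactSupport ψ) : ∃ R, ∀ x, R < ‖x‖ → x ∉ tsupport ψ := by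
  obtain ⟨R, hR⟩ := h.isCompact.isBounded.subset_closedBall (0 : 𝔼)
  exact ⟨R, fun x hx hxs => hx.not_ge (mem_closedBall_zero_iff.1 (hR hxs))⟩

theorem mollify_indicator_closedBall {F : Type*} [NormedAddCommGroup F] [NormedSpace ℝ F]
    (h : 𝔼 → F) (n : ℕ) {R : ℝ} {x : 𝔼} (hx : ‖x‖ ≤ R) :
    mollify n ((Metric.closedBall (0 : 𝔼) (R + 1)).indicator h) x = mollify n h x :=
  mollify_congr_of_ball n hx fun y hy => by
    rw [Set.indicator_of_mem (mem_closedBall_zero_iff.2 hy)]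

/-- For mollified `G` this is the classical chain rule. The left side converges boundedly, but the
mollified gradients are only controlled in `L¹` on bounded sets, so the right side needs dominating
functions that vary with `n`. -/
theorem IsWeakGradient.integral_comp {G : 𝔼 → ℝ} {b : 𝔼 → 𝔼} (h : IsWeakGradient G b) {F : ℝ → ℝ}
    (hF : ContDiff ℝ ∞ F) {C : ℝ} (hF0 : ∀ s, |F s| ≤ C) (hF1 : ∀ s, |deriv F s| ≤ C)
    {ψ : 𝔼 → ℝ} (hψ : ContDiff ℝ ∞ ψ) (hc : HasCompactSupport ψ) (e : 𝔼) :
    ∫ x, F (G x) * fderiv ℝ ψ x e = -∫ x, deriv F (G x) * ⟪b x, e⟫_ℝ * ψ x := by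
  obtain ⟨hG, hb, -⟩ := id h
  have hdF : Continuous (deriv F) := hF.continuous_deriv (by norm_num)
  obtain ⟨R, hR⟩ := hc.exists_eq_zero_of_norm_gt
  obtain ⟨M, hM, hψM⟩ := (hc.toSchwartzMap hψ).exists_norm_le
  have hC : 0 ≤ C := (abs_nonneg _).trans (hF0 0)
  have hGn : ∀ n, ContDiff ℝ ∞ (mollify n G) := fun n => contDiff_mollify n hG
  have hbn : ∀ n, ContDiff ℝ ∞ (mollify n b) := fun n => contDiff_mollify n hb
  have hdψ : Continuous fun x => fderiv ℝ ψ x e :=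
    (hψ.continuous_fderiv (by norm_num)).clm_apply continuous_const
  have hdψc : HasCompactSupport fun x => fderiv ℝ ψ x e := hc.fderiv_apply ℝ e
  have hder : ∀ n x, fderiv ℝ (fun y => F (mollify n G y)) x e =
      deriv F (mollify n G x) * ⟪mollify n b x, e⟫_ℝ := fun n x => by
    rw [fderiv_comp_apply_of_gradient hF.two_of_infty (hGn n).two_of_infty,
      fderiv_mollify_of_isWeakGradient h]
  have hcont1 : ∀ n, Continuous fun x => deriv F (mollify n G x) * ⟪mollify n b x, e⟫_ℝ := fun n =>
    (hdF.comp (hGn n).continuous).mul ((hbn n).continuous.inner continuous_const)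
  have hint : ∀ n, Integrable fun x => deriv F (mollify n G x) * ⟪mollify n b x, e⟫_ℝ * ψ x :=
    fun n => ((hcont1 n).mul hψ.continuous).integrable_of_hasCompactSupport hc.mul_left
  have step : ∀ n, ∫ x, F (mollify n G x) * fderiv ℝ ψ x e =
      -∫ x, deriv F (mollify n G x) * ⟪mollify n b x, e⟫_ℝ * ψ x := fun n => by
    have h1 := integral_mul_fderiv_eq_neg_fderiv_mul_of_integrable (μ := (volume : Measure 𝔼))
      (f := fun y => F (mollify n G y)) (g := ψ) (v := e)
      (by simp only [hder]; exact hint n)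
      (((hF.comp (hGn n)).continuous.mul hdψ).integrable_of_hasCompactSupport hdψc.mul_left)
      (((hF.comp (hGn n)).continuous.mul hψ.continuous).integrable_of_hasCompactSupport hc.mul_left)
      (fun x _ => (hF.comp (hGn n)).differentiable (by norm_num) x)
      (fun x _ => hψ.differentiable (by norm_num) x)
    simpa only [hder] using h1
  have lim1 : Tendsto (fun n => ∫ x, F (mollify n G x) * fderiv ℝ ψ x e) atTop
      (𝓝 (∫ x, F (G x) * fderiv ℝ ψ x e)) := by
    refine tendsto_integral_of_dominated_convergence (fun x => C * ‖fderiv ℝ ψ x e‖)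
      (fun n => ((hF.comp (hGn n)).continuous.mul hdψ).aestronglyMeasurable)
      ((hdψ.integrable_of_hasCompactSupport hdψc).norm.const_mul C)
      (fun n => Eventually.of_forall fun x => ?_) ?_
    · rw [norm_mul]
      exact mul_le_mul_of_nonneg_right (hF0 _) (norm_nonneg _)
    · filter_upwards [ae_tendsto_mollify hG] with x hx
      exact ((hF.continuous.tendsto _).comp hx).mul_const _
  -- Truncation makes `b` integrable and is invisible to mollification on the ball of radius `R`,
  -- which contains the support of `ψ`.
  set bt := (Metric.closedBall (0 : 𝔼) (R + 1)).indicator b with hbt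
  have hbti : Integrable bt := hb.integrable_indicator_closedBall _
  have hfm : AEStronglyMeasurable fun x => deriv F (G x) * ⟪b x, e⟫_ℝ * ψ x :=
    ((hdF.comp_aestronglyMeasurable hG.aestronglyMeasurable).mul
      (hb.aestronglyMeasurable.inner aestronglyMeasurable_const)).mul
        hψ.continuous.aestronglyMeasurable
  have hbound : ∀ s x (v v' : 𝔼), (‖x‖ ≤ R → v = v') →
      ‖deriv F s * ⟪v, e⟫_ℝ * ψ x‖ ≤ C * ‖e‖ * M * ‖v'‖ := fun s x v v' hv => by
    by_cases hx : ‖x‖ ≤ R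
    · rw [hv hx, norm_mul, norm_mul]
      calc ‖deriv F s‖ * ‖⟪v', e⟫_ℝ‖ * ‖ψ x‖ ≤ C * (‖v'‖ * ‖e‖) * M := by
            gcongr
            · exact hF1 s
            · exact norm_inner_le_norm _ _
            · exact hψM x
        _ = _ := by ring
    · rw [image_eq_zero_of_notMem_tsupport (hR x (not_le.1 hx)), mul_zero, norm_zero]
      positivity
  have hb1 : ∀ n x, ‖deriv F (mollify n G x) * ⟪mollify n b x, e⟫_ℝ * ψ x‖ ≤
      C * ‖e‖ * M * ‖mollify n bt x‖ := fun n x => hbound _ _ _ _ fun hx =>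
    (mollify_indicator_closedBall b n hx).symm
  have hb2 : ∀ x, ‖deriv F (G x) * ⟪b x, e⟫_ℝ * ψ x‖ ≤ C * ‖e‖ * M * ‖bt x‖ := fun x =>
    hbound _ _ _ _ fun hx => by
      rw [hbt, Set.indicator_of_mem (mem_closedBall_zero_iff.2 (by linarith))]
  have hfi : Integrable fun x => deriv F (G x) * ⟪b x, e⟫_ℝ * ψ x :=
    (hbti.norm.const_mul _).mono' hfm (Eventually.of_forall hb2)
  have lim2 : Tendsto (fun n => ∫ x, deriv F (mollify n G x) * ⟪mollify n b x, e⟫_ℝ * ψ x) atTop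
      (𝓝 (∫ x, deriv F (G x) * ⟪b x, e⟫_ℝ * ψ x)) := by
    refine tendsto_integral_of_L1 _ hfm (Eventually.of_forall hint) ?_
    have hmm : ∀ n, AEMeasurable fun x : 𝔼 => ‖mollify n bt x‖ₑ ^ 1 := fun n =>
      ((contDiff_mollify n hbti.locallyIntegrable).continuous.enorm.measurable.pow_const 1).aemeasurable
    have hmb : AEMeasurable fun x : 𝔼 => ‖bt x‖ₑ ^ 1 := hbti.aestronglyMeasurable.enorm.pow_const 1
    have hfin : ∫⁻ x, ‖bt x‖ₑ ^ 1 ≠ ⊤ := by simpa only [pow_one] using hbti.2.ne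
    refine tendsto_lintegral_zero_of_le_of_tendsto
      (k := fun n x => ENNReal.ofReal (C * ‖e‖ * M) * (‖mollify n bt x‖ₑ ^ 1 + ‖bt x‖ₑ ^ 1))
      (K := fun x => ENNReal.ofReal (C * ‖e‖ * M) * (‖bt x‖ₑ ^ 1 + ‖bt x‖ₑ ^ 1))
      (fun n => ((hint n).1.sub hfm).enorm) (fun n => ((hmm n).add hmb).const_mul _)
      (fun n => Eventually.of_forall fun x => ?_) ?_ ?_ ?_ ?_
    · refine (enorm_sub_le).trans ?_
      rw [mul_add, pow_one, pow_one]
      have hK : 0 ≤ C * ‖e‖ * M := by positivity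
      refine add_le_add ?_ ?_
      · rw [← ofReal_norm, ← ofReal_norm, ← ENNReal.ofReal_mul hK]
        exact ENNReal.ofReal_le_ofReal (hb1 n x)
      · rw [← ofReal_norm, ← ofReal_norm, ← ENNReal.ofReal_mul hK]
        exact ENNReal.ofReal_le_ofReal (hb2 x)
    · filter_upwards [ae_tendsto_mollify hG, ae_tendsto_mollify hb] with x hx hx'
      have h1 := (((hdF.tendsto _).comp hx).mul (hx'.inner (tendsto_const_nhds (x := e)))).mul_const
        (ψ x)
      have h2 := (h1.sub_const (deriv F (G x) * ⟪b x, e⟫_ℝ * ψ x)).enorm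
      simpa using h2
    · filter_upwards [ae_tendsto_mollify hbti.locallyIntegrable] with x hx
      refine ENNReal.Tendsto.const_mul ?_ (Or.inr ENNReal.ofReal_ne_top)
      exact (((ENNReal.continuous_pow 1).tendsto _).comp hx.enorm).add tendsto_const_nhds
    · have h1 := tendsto_lintegral_enorm_mollify_pow hbti.locallyIntegrable le_rfl
      have h2 : ∀ g : 𝔼 → ℝ≥0∞, AEMeasurable g →
          ∫⁻ x, ENNReal.ofReal (C * ‖e‖ * M) * (g x + ‖bt x‖ₑ ^ 1) =
            ENNReal.ofReal (C * ‖e‖ * M) * ((∫⁻ x, g x) + ∫⁻ x, ‖bt x‖ₑ ^ 1) := fun g hg => by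
        rw [lintegral_const_mul' _ _ ENNReal.ofReal_ne_top, lintegral_add_left' hg]
      rw [h2 _ hmb]
      simp only [fun n => h2 _ (hmm n)]
      exact ENNReal.Tendsto.const_mul (h1.add tendsto_const_nhds) (Or.inr ENNReal.ofReal_ne_top)
    · rw [lintegral_const_mul' _ _ ENNReal.ofReal_ne_top, lintegral_add_left' hmb]
      exact ENNReal.mul_ne_top ENNReal.ofReal_ne_top (ENNReal.add_ne_top.2 ⟨hfin, hfin⟩)
  simp only [step] at lim1
  exact tendsto_nhds_unique lim1 lim2.neg

end ChainRule

/-! ### The measure `e^{-G} dx` with drift `-∇G` -/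

section Gibbs

variable {d : ℕ}

local notation "𝔼" => EuclideanSpace ℝ (Fin d)

theorem gibbsMeasure_absolutelyContinuous (G : 𝔼 → ℝ) : gibbsMeasure G ≪ volume :=
  withDensity_absolutelyContinuous _ _

theorem aemeasurable_gibbsDensity {G : 𝔼 → ℝ} (hG : AEMeasurable G) :
    AEMeasurable fun x => ENNReal.ofReal (Real.exp (-G x)) :=
  (Real.measurable_exp.comp_aemeasurable hG.neg).ennreal_ofReal

theorem absolutelyContinuous_gibbsMeasure {G : 𝔼 → ℝ} (hG : AEMeasurable G) :
    (volume : Measure 𝔼) ≪ gibbsMeasure G :=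
  withDensity_absolutelyContinuous' (aemeasurable_gibbsDensity hG)
    (Eventually.of_forall fun _ => (ENNReal.ofReal_pos.2 (Real.exp_pos _)).ne')

theorem integral_gibbsMeasure {F : Type*} [NormedAddCommGroup F] [NormedSpace ℝ F] {G : 𝔼 → ℝ}
    (hG : AEMeasurable G) (f : 𝔼 → F) :
    ∫ x, f x ∂(gibbsMeasure G) = ∫ x, Real.exp (-G x) • f x := by
  rw [gibbsMeasure, integral_withDensity_eq_integral_toReal_smul₀ (aemeasurable_gibbsDensity hG)
    (Eventually.of_forall fun _ => ENNReal.ofReal_lt_top)]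
  simp only [ENNReal.toReal_ofReal (Real.exp_pos _).le]

theorem integrable_gibbsMeasure_iff {F : Type*} [NormedAddCommGroup F] [NormedSpace ℝ F]
    {G : 𝔼 → ℝ} (hG : AEMeasurable G) {f : 𝔼 → F} :
    Integrable f (gibbsMeasure G) ↔ Integrable fun x => Real.exp (-G x) • f x := by
  rw [gibbsMeasure, integrable_withDensity_iff_integrable_smul₀' (aemeasurable_gibbsDensity hG)
    (Eventually.of_forall fun _ => ENNReal.ofReal_lt_top)]
  simp only [ENNReal.toReal_ofReal (Real.exp_pos _).le]

theorem isFiniteMeasure_gibbsMeasure {G : 𝔼 → ℝ} (h : Integrable fun x => Real.exp (-G x)) :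
    IsFiniteMeasure (gibbsMeasure G) :=
  isFiniteMeasure_withDensity_ofReal h.2

theorem locallyIntegrable_of_forall_schwartz {F : Type*} [NormedAddCommGroup F] [NormedSpace ℝ F]
    {g : 𝔼 → F} (h : ∀ f : 𝓢(𝔼, ℝ), Integrable fun x => f x • g x) : LocallyIntegrable g := by
  intro x
  obtain ⟨N, hN⟩ := exists_nat_gt ‖x‖
  refine ⟨Metric.ball 0 N, Metric.isOpen_ball.mem_nhds (mem_ball_zero_iff.2 hN), ?_⟩
  refine (h ((hasCompactSupport_cutoff (E := 𝔼) N).toSchwartzMap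
    (contDiff_cutoff N))).integrableOn.congr_fun (fun y hy => ?_) measurableSet_ball
  have hy' := mem_ball_zero_iff.1 hy
  change cutoff 𝔼 N y • g y = g y
  rw [cutoff_eq_one (by linarith), one_smul]

theorem RCLike.norm_le_norm_re_add_norm_im {𝕜 : Type*} [RCLike 𝕜] (z : 𝕜) :
    ‖z‖ ≤ ‖RCLike.re z‖ + ‖RCLike.im z‖ := by
  refine le_of_sq_le_sq ?_ (by positivity)
  rw [RCLike.norm_sq_eq_def, Real.norm_eq_abs, Real.norm_eq_abs, add_sq, sq_abs, sq_abs]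
  have := mul_nonneg (abs_nonneg (RCLike.re z)) (abs_nonneg (RCLike.im z))
  nlinarith

/-- `β = -∇G` weakly, `e^{-G}` is integrable, and so is `f e^{-G} β` for all Schwartz
functions `f`. -/
structure IsGibbsDrift (β : EuclideanSpace ℝ (Fin d) → EuclideanSpace ℝ (Fin d))
    (G : EuclideanSpace ℝ (Fin d) → ℝ) : Prop where
  weak : IsWeakGradient G fun x => -β x
  integrable_exp : Integrable fun x => Real.exp (-G x)
  integrable_drift : ∀ f : 𝓢(EuclideanSpace ℝ (Fin d), ℝ),
    Integrable fun x => (f x * Real.exp (-G x)) • β x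

namespace IsGibbsDrift

variable {𝕜 : Type*} [RCLike 𝕜]

theorem aestronglyMeasurable {β : 𝔼 → 𝔼} {G : 𝔼 → ℝ} (h : IsGibbsDrift β G) :
    AEStronglyMeasurable β := by
  have h1 := h.weak.2.1.aestronglyMeasurable.neg
  rwa [show (-fun x => -β x) = β from neg_neg β] at h1

theorem locallyIntegrable {β : 𝔼 → 𝔼} {G : 𝔼 → ℝ} (h : IsGibbsDrift β G) :
    LocallyIntegrable β := by
  have h1 := h.weak.2.1.neg
  rwa [show (-fun x => -β x) = β from neg_neg β] at h1

theorem aemeasurable {β : 𝔼 → 𝔼} {G : 𝔼 → ℝ} (h : IsGibbsDrift β G) : AEMeasurable G :=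
  h.weak.1.aestronglyMeasurable.aemeasurable

theorem isFiniteMeasure {β : 𝔼 → 𝔼} {G : 𝔼 → ℝ} (h : IsGibbsDrift β G) :
    IsFiniteMeasure (gibbsMeasure G) :=
  isFiniteMeasure_gibbsMeasure h.integrable_exp

/-- The drift condition concerns real Schwartz functions; `f` is handled through its real and
imaginary parts. -/
theorem integrable_exp_mul_norm {β : 𝔼 → 𝔼} {G : 𝔼 → ℝ} (h : IsGibbsDrift β G) (f : 𝓢(𝔼, 𝕜)) :
    Integrable fun x => Real.exp (-G x) * (‖β x‖ * ‖f x‖) := by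
  have h1 := (h.integrable_drift (f.postcompCLM (RCLike.reCLM (K := 𝕜)))).norm
  have h2 := (h.integrable_drift (f.postcompCLM (RCLike.imCLM (K := 𝕜)))).norm
  refine (h1.add h2).mono' (h.integrable_exp.1.mul (h.aestronglyMeasurable.norm.mul
    f.continuous.norm.aestronglyMeasurable)) (Eventually.of_forall fun x => ?_)
  rw [Real.norm_of_nonneg (by positivity)]
  simp only [Pi.add_apply, norm_smul, norm_mul, SchwartzMap.postcompCLM_apply, RCLike.reCLM_apply,
    RCLike.imCLM_apply, Real.norm_of_nonneg (Real.exp_pos _).le]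
  have := RCLike.norm_le_norm_re_add_norm_im (f x)
  calc Real.exp (-G x) * (‖β x‖ * ‖f x‖)
      ≤ Real.exp (-G x) * (‖β x‖ * (‖RCLike.re (f x)‖ + ‖RCLike.im (f x)‖)) := by gcongr
    _ = _ := by ring

theorem locallyIntegrable_exp_smul {β : 𝔼 → 𝔼} {G : 𝔼 → ℝ} (h : IsGibbsDrift β G) :
    LocallyIntegrable fun x => Real.exp (-G x) • β x :=
  locallyIntegrable_of_forall_schwartz fun f => by
    simpa only [smul_smul] using h.integrable_drift f

/-- The weak gradient of `e^{-G}` is `e^{-G} β`. -/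
theorem isWeakDivergence {β : 𝔼 → 𝔼} {G : 𝔼 → ℝ} (h : IsGibbsDrift β G) (e : 𝔼) :
    IsWeakDivergence (fun x => Real.exp (-G x) • e) fun x => Real.exp (-G x) * ⟪β x, e⟫_ℝ := by
  have hGm := h.weak.1.aestronglyMeasurable
  have hm : AEStronglyMeasurable fun x => Real.exp (-G x) * ⟪β x, e⟫_ℝ :=
    h.integrable_exp.1.mul (h.aestronglyMeasurable.inner aestronglyMeasurable_const)
  have hle : ∀ x, ‖Real.exp (-G x) * ⟪β x, e⟫_ℝ‖ ≤ ‖‖e‖ • Real.exp (-G x) • β x‖ := fun x => by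
    rw [norm_mul, norm_smul, norm_smul, norm_norm, mul_left_comm, mul_comm ‖e‖]
    gcongr
    exact norm_inner_le_norm _ _
  refine ⟨(h.integrable_exp.smul_const e).locallyIntegrable,
    (h.locallyIntegrable_exp_smul.smul ‖e‖).mono hm (Eventually.of_forall hle), fun ψ hψ hc => ?_⟩
  have hck : ∀ k : ℕ, (0 : ℝ) < 1 / ((k : ℝ) + 1) := fun k => by positivity
  -- Each `F k` and its derivative are bounded, as the chain rule requires, and both are dominated
  -- by `e^{-s}` uniformly in `k`.
  set F : ℕ → ℝ → ℝ := fun k => regExp 1 (1 / ((k : ℝ) + 1)) with hF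
  have step : ∀ k, ∫ x, F k (G x) * fderiv ℝ ψ x e =
      -∫ x, deriv (F k) (G x) * ⟪-β x, e⟫_ℝ * ψ x := fun k => by
    obtain ⟨C, -, h0, h1, -⟩ := exists_bound_regExp 1 (hck k)
    exact h.weak.integral_comp (contDiff_regExp (hck k)) h0 h1 hψ hc e
  have hFw : ∀ k s, |F k s| ≤ Real.exp (-s) := fun k s => by
    simpa only [one_mul] using abs_regExp_le (a := 1) (hck k) s
  have hdFw : ∀ k s, |deriv (F k) s| ≤ Real.exp (-s) := fun k s => by
    refine (abs_deriv_regExp_le (hck k) s).trans ?_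
    simpa only [one_mul, abs_one] using regExp_le_exp (a := 1) (hck k) s
  have hdψ : Continuous fun x => fderiv ℝ ψ x e :=
    (hψ.continuous_fderiv (by norm_num)).clm_apply continuous_const
  obtain ⟨M, hM, hψM⟩ := (hc.toSchwartzMap hψ).exists_norm_fderiv_le
  have lim1 : Tendsto (fun k => ∫ x, F k (G x) * fderiv ℝ ψ x e) atTop
      (𝓝 (∫ x, Real.exp (-G x) * fderiv ℝ ψ x e)) := by
    refine tendsto_integral_of_dominated_convergence (fun x => Real.exp (-G x) * (M * ‖e‖))
      (fun k => ((contDiff_regExp (hck k)).continuous.comp_aestronglyMeasurable hGm).mul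
        hdψ.aestronglyMeasurable) (h.integrable_exp.mul_const _)
      (fun k => Eventually.of_forall fun x => ?_) (Eventually.of_forall fun x => ?_)
    · rw [norm_mul]
      refine mul_le_mul (hFw k _) (((fderiv ℝ ψ x).le_opNorm e).trans ?_) (norm_nonneg _)
        (Real.exp_pos _).le
      exact mul_le_mul_of_nonneg_right (hψM x) (norm_nonneg _)
    · simpa only [one_mul] using (tendsto_regExp 1 (G x)).mul_const (fderiv ℝ ψ x e)
  have lim2 : Tendsto (fun k => ∫ x, deriv (F k) (G x) * ⟪-β x, e⟫_ℝ * ψ x) atTop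
      (𝓝 (∫ x, Real.exp (-G x) * ⟪β x, e⟫_ℝ * ψ x)) := by
    refine tendsto_integral_of_dominated_convergence
      (fun x => ‖e‖ * (Real.exp (-G x) * (‖β x‖ * ‖ψ x‖)))
      (fun k => ((((contDiff_regExp (hck k)).continuous_deriv
        (by norm_num)).comp_aestronglyMeasurable hGm).mul (h.aestronglyMeasurable.neg.inner
          aestronglyMeasurable_const)).mul hψ.continuous.aestronglyMeasurable)
      ((h.integrable_exp_mul_norm (hc.toSchwartzMap hψ)).const_mul _)
      (fun k => Eventually.of_forall fun x => ?_) (Eventually.of_forall fun x => ?_)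
    · rw [norm_mul, norm_mul]
      calc ‖deriv (F k) (G x)‖ * ‖⟪-β x, e⟫_ℝ‖ * ‖ψ x‖
          ≤ Real.exp (-G x) * (‖-β x‖ * ‖e‖) * ‖ψ x‖ := by
            gcongr
            · exact hdFw k _
            · exact norm_inner_le_norm _ _
        _ = _ := by rw [norm_neg]; ring
    · have h1 := ((tendsto_deriv_regExp 1 (G x)).mul_const ⟪-β x, e⟫_ℝ).mul_const (ψ x)
      simpa only [one_mul, neg_mul, inner_neg_left, mul_neg, neg_neg] using h1
  simp only [step] at lim1
  have := tendsto_nhds_unique lim1 lim2.neg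
  simpa only [map_smul, smul_eq_mul] using this

theorem integrable_exp_mul {β : 𝔼 → 𝔼} {G : 𝔼 → ℝ} (h : IsGibbsDrift β G) {f : 𝔼 → 𝕜}
    (hf : Continuous f) {C : ℝ} (hC : ∀ x, ‖f x‖ ≤ C) :
    Integrable fun x => Real.exp (-G x) • f x :=
  (h.integrable_exp.mul_const C).mono' (h.integrable_exp.1.smul hf.aestronglyMeasurable)
    (Eventually.of_forall fun x => by
      rw [norm_smul, Real.norm_of_nonneg (Real.exp_pos _).le]
      gcongr
      exact hC x)

theorem integrable_exp_inner_smul {β : 𝔼 → 𝔼} {G : 𝔼 → ℝ} (h : IsGibbsDrift β G) {f : 𝔼 → 𝕜}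
    (hf : Continuous f) (hβ : Integrable fun x => Real.exp (-G x) * (‖β x‖ * ‖f x‖)) (e : 𝔼) :
    Integrable fun x => (Real.exp (-G x) * ⟪β x, e⟫_ℝ) • f x := by
  refine (hβ.const_mul ‖e‖).mono' ((h.integrable_exp.1.mul (h.aestronglyMeasurable.inner
    aestronglyMeasurable_const)).smul hf.aestronglyMeasurable)
    (Eventually.of_forall fun x => ?_)
  rw [norm_smul, norm_mul, Real.norm_of_nonneg (Real.exp_pos _).le]
  calc Real.exp (-G x) * ‖⟪β x, e⟫_ℝ‖ * ‖f x‖ ≤ Real.exp (-G x) * (‖β x‖ * ‖e‖) * ‖f x‖ := by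
        gcongr
        exact norm_inner_le_norm _ _
    _ = _ := by ring

/-- The derivative of `e^{-G}` along `e` was phrased as the divergence of the field `e^{-G} e` so
that `IsWeakDivergence.integral_eq`, free of compact support, applies here. -/
theorem integral_exp_smul_fderiv {β : 𝔼 → 𝔼} {G : 𝔼 → ℝ} (h : IsGibbsDrift β G) {f : 𝔼 → 𝕜}
    (hf : ContDiff ℝ ∞ f) {C : ℝ} (hf0 : ∀ x, ‖f x‖ ≤ C) (hf1 : ∀ x, ‖fderiv ℝ f x‖ ≤ C)
    (hβ : Integrable fun x => Real.exp (-G x) * (‖β x‖ * ‖f x‖)) (e : 𝔼) :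
    ∫ x, Real.exp (-G x) • fderiv ℝ f x e = -∫ x, (Real.exp (-G x) * ⟪β x, e⟫_ℝ) • f x := by
  have h1 : Integrable fun x => Real.exp (-G x) • fderiv ℝ f x e :=
    h.integrable_exp_mul (C := C * ‖e‖) ((hf.continuous_fderiv (by norm_num)).clm_apply
      continuous_const) fun x => ((fderiv ℝ f x).le_opNorm e).trans (by gcongr; exact hf1 x)
  have h2 := h.integrable_exp_inner_smul hf.continuous hβ e
  have h3 : Integrable fun x => ‖Real.exp (-G x) • e‖ * ‖f x‖ := by
    refine ((h.integrable_exp_mul hf.continuous hf0).norm.const_mul ‖e‖).congr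
      (Eventually.of_forall fun x => ?_)
    simp only [norm_smul]
    ring
  have := (h.isWeakDivergence e).integral_eq hf (by simpa only [map_smul] using h1) h2 h3
  simpa only [map_smul] using this

end IsGibbsDrift

end Gibbs

/-! ### Dirichlet form, invariance and symmetry for `e^{-G} dx`. -/

section Gibbs

variable {d : ℕ} {𝕜 : Type*} [RCLike 𝕜]

local notation "𝔼" => EuclideanSpace ℝ (Fin d)

/-- The derivative of a Schwartz function in a fixed direction. -/
def SchwartzMap.dirDeriv (f : 𝓢(EuclideanSpace ℝ (Fin d), 𝕜)) (e : EuclideanSpace ℝ (Fin d)) :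
    𝓢(EuclideanSpace ℝ (Fin d), 𝕜) :=
  (SchwartzMap.fderivCLM ℝ (EuclideanSpace ℝ (Fin d)) 𝕜 f).postcompCLM
    (ContinuousLinearMap.apply ℝ 𝕜 e)

/-- Each summand is `(∂ᵢ + βᵢ) ∂ᵢf`, and `∂ᵢ + βᵢ` is formally `e^{G} ∂ᵢ e^{-G}`. As `∂ᵢf` is again
Schwartz, the summands can be integrated by parts one at a time. -/
theorem driftFun_eq_sum {ι : Type*} [Fintype ι] (b : OrthonormalBasis ι ℝ 𝔼) (β : 𝔼 → 𝔼)
    (f : 𝓢(𝔼, 𝕜)) (x : 𝔼) : driftFun β f x =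
      ∑ i, (fderiv ℝ (f.dirDeriv (b i)) x (b i) + ⟪β x, b i⟫_ℝ • f.dirDeriv (b i) x) := by
  have hfs : ContDiff ℝ ∞ (f : 𝔼 → 𝕜) := f.smooth'
  rw [driftFun, hfs.two_of_infty.laplacian_eq_sum_fderiv b, ← b.sum_inner_smul_apply (fderiv ℝ f x),
    Finset.sum_add_distrib]
  rfl

namespace IsGibbsDrift

theorem integrable_driftExpr {β : 𝔼 → 𝔼} {G : 𝔼 → ℝ} (h : IsGibbsDrift β G) (f : 𝓢(𝔼, 𝕜)) :
    Integrable (driftExpr 𝕜 β f) (gibbsMeasure G) := by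
  rw [integrable_gibbsMeasure_iff h.aemeasurable, driftExpr_eq]
  simp only [driftFun_eq_sum (stdOrthonormalBasis ℝ 𝔼), Finset.smul_sum, smul_add, smul_smul]
  refine integrable_finsetSum _ fun i _ => Integrable.add ?_ ?_
  · obtain ⟨C, -, hC⟩ := ((f.dirDeriv (stdOrthonormalBasis ℝ 𝔼 i)).dirDeriv
      (stdOrthonormalBasis ℝ 𝔼 i)).exists_norm_le
    exact h.integrable_exp_mul (f := (f.dirDeriv (stdOrthonormalBasis ℝ 𝔼 i)).dirDeriv
      (stdOrthonormalBasis ℝ 𝔼 i)) (SchwartzMap.continuous _) hC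
  · exact h.integrable_exp_inner_smul (SchwartzMap.continuous _) (h.integrable_exp_mul_norm _) _

/-- Integration by parts: the Dirichlet form of `Δ + β · ∇` with respect to `e^{-G} dx`. -/
theorem integral_inner_driftExpr {β : 𝔼 → 𝔼} {G : 𝔼 → ℝ} (h : IsGibbsDrift β G) (f : 𝓢(𝔼, 𝕜))
    {g : 𝔼 → 𝕜} (hg : ContDiff ℝ ∞ g) {C : ℝ} (hg0 : ∀ x, ‖g x‖ ≤ C)
    (hg1 : ∀ x, ‖fderiv ℝ g x‖ ≤ C) :
    ∫ x, ⟪driftExpr 𝕜 β f x, g x⟫_𝕜 ∂(gibbsMeasure G) =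
      -∑ i, ∫ x, ⟪fderiv ℝ f x (stdOrthonormalBasis ℝ 𝔼 i),
        fderiv ℝ g x (stdOrthonormalBasis ℝ 𝔼 i)⟫_𝕜 ∂(gibbsMeasure G) := by
  have hC : 0 ≤ C := (norm_nonneg _).trans (hg0 0)
  set b := stdOrthonormalBasis ℝ 𝔼 with hb
  have hdg : ∀ e, Continuous fun x => fderiv ℝ g x e := fun e =>
    (hg.continuous_fderiv (by norm_num)).clm_apply continuous_const
  have hdgb : ∀ e x, ‖fderiv ℝ g x e‖ ≤ C * ‖e‖ := fun e x =>
    ((fderiv ℝ g x).le_opNorm e).trans (by gcongr; exact hg1 x)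
  -- Integration by parts for `⟨∂ᵢf, g⟩`. Decay is needed of `f` only; `g` and its derivative are
  -- merely bounded, which admits `g = 1`.
  have main : ∀ i, Integrable (fun x => Real.exp (-G x) •
      (⟪fderiv ℝ (f.dirDeriv (b i)) x (b i), g x⟫_𝕜 +
        ⟪β x, b i⟫_ℝ • ⟪f.dirDeriv (b i) x, g x⟫_𝕜)) ∧
      ∫ x, Real.exp (-G x) • (⟪fderiv ℝ (f.dirDeriv (b i)) x (b i), g x⟫_𝕜 +
        ⟪β x, b i⟫_ℝ • ⟪f.dirDeriv (b i) x, g x⟫_𝕜) =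
      -∫ x, Real.exp (-G x) • ⟪f.dirDeriv (b i) x, fderiv ℝ g x (b i)⟫_𝕜 := fun i => by
    set u := f.dirDeriv (b i) with hu
    have hus : ContDiff ℝ ∞ (u : 𝔼 → 𝕜) := u.smooth'
    obtain ⟨M0, hM0, hu0⟩ := u.exists_norm_le
    obtain ⟨M1, hM1, hu1⟩ := u.exists_norm_fderiv_le
    have hp : ContDiff ℝ ∞ fun x => ⟪u x, g x⟫_𝕜 := hus.inner 𝕜 hg
    have hpb : ∀ x, ‖⟪u x, g x⟫_𝕜‖ ≤ C * ‖u x‖ := fun x => by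
      rw [mul_comm]
      exact (norm_inner_le_norm _ _).trans (by gcongr; exact hg0 x)
    have hder : ∀ x e, fderiv ℝ (fun x => ⟪u x, g x⟫_𝕜) x e =
        ⟪u x, fderiv ℝ g x e⟫_𝕜 + ⟪fderiv ℝ u x e, g x⟫_𝕜 := fun x e =>
      fderiv_inner_apply 𝕜 u.differentiableAt (hg.differentiable (by norm_num) x) e
    have hp1 : ∀ x, ‖fderiv ℝ (fun x => ⟪u x, g x⟫_𝕜) x‖ ≤ C * M0 + C * M1 := fun x => by
      refine ContinuousLinearMap.opNorm_le_bound _ (by positivity) fun e => ?_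
      rw [hder]
      calc _ ≤ ‖u x‖ * ‖fderiv ℝ g x e‖ + ‖fderiv ℝ u x e‖ * ‖g x‖ :=
            (norm_add_le _ _).trans (add_le_add (norm_inner_le_norm _ _) (norm_inner_le_norm _ _))
        _ ≤ M0 * (C * ‖e‖) + M1 * ‖e‖ * C := by
            gcongr
            · exact hu0 x
            · exact hdgb e x
            · exact ((fderiv ℝ u x).le_opNorm e).trans (by gcongr; exact hu1 x)
            · exact hg0 x
        _ = _ := by ring
    have hp0 : ∀ x, ‖⟪u x, g x⟫_𝕜‖ ≤ C * M0 + C * M1 := fun x =>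
      (hpb x).trans ((mul_le_mul_of_nonneg_left (hu0 x) hC).trans (by nlinarith [mul_nonneg hC hM1]))
    have hβ : Integrable fun x => Real.exp (-G x) * (‖β x‖ * ‖⟪u x, g x⟫_𝕜‖) := by
      refine ((h.integrable_exp_mul_norm u).const_mul C).mono' (h.integrable_exp.1.mul
        (h.aestronglyMeasurable.norm.mul hp.continuous.norm.aestronglyMeasurable))
        (Eventually.of_forall fun x => ?_)
      rw [Real.norm_of_nonneg (by positivity)]
      calc Real.exp (-G x) * (‖β x‖ * ‖⟪u x, g x⟫_𝕜‖)
          ≤ Real.exp (-G x) * (‖β x‖ * (C * ‖u x‖)) := by gcongr; exact hpb x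
        _ = _ := by ring
    have key := h.integral_exp_smul_fderiv hp hp0 hp1 hβ (b i)
    have i1 : Integrable fun x => Real.exp (-G x) • ⟪fderiv ℝ u x (b i), g x⟫_𝕜 :=
      h.integrable_exp_mul (C := M1 * ‖b i‖ * C) (((hus.continuous_fderiv (by norm_num)).clm_apply
        continuous_const).inner hg.continuous) fun x => (norm_inner_le_norm _ _).trans
          (mul_le_mul (((fderiv ℝ u x).le_opNorm _).trans (by gcongr; exact hu1 x)) (hg0 x)
            (norm_nonneg _) (by positivity))
    have i2 : Integrable fun x => Real.exp (-G x) • ⟪u x, fderiv ℝ g x (b i)⟫_𝕜 :=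
      h.integrable_exp_mul (C := M0 * (C * ‖b i‖)) (u.continuous.inner (hdg _)) fun x =>
        (norm_inner_le_norm _ _).trans (mul_le_mul (hu0 x) (hdgb _ x) (norm_nonneg _) hM0)
    have i3 := h.integrable_exp_inner_smul hp.continuous hβ (b i)
    simp only [smul_add, smul_smul]
    refine ⟨i1.add i3, ?_⟩
    simp only [hder, smul_add] at key
    rw [integral_add i2 i1] at key
    rw [integral_add i1 i3]
    linear_combination key
  have e1 : ∀ x, Real.exp (-G x) • ⟪driftExpr 𝕜 β f x, g x⟫_𝕜 =
      ∑ i, Real.exp (-G x) • (⟪fderiv ℝ (f.dirDeriv (b i)) x (b i), g x⟫_𝕜 +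
        ⟪β x, b i⟫_ℝ • ⟪f.dirDeriv (b i) x, g x⟫_𝕜) := fun x => by
    rw [driftExpr_apply, driftFun_eq_sum b, sum_inner, Finset.smul_sum]
    refine Finset.sum_congr rfl fun i _ => ?_
    rw [inner_add_left, RCLike.real_smul_eq_coe_smul (K := 𝕜) ⟪β x, b i⟫_ℝ,
      RCLike.real_smul_eq_coe_smul (K := 𝕜) ⟪β x, b i⟫_ℝ, inner_smul_left, RCLike.conj_ofReal,
      smul_eq_mul]
  rw [integral_gibbsMeasure h.aemeasurable]
  simp only [e1, integral_gibbsMeasure h.aemeasurable]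
  rw [integral_finsetSum _ fun i _ => (main i).1, ← Finset.sum_neg_distrib]
  exact Finset.sum_congr rfl fun i _ => (main i).2

theorem isInfinitesimallyInvariant {β : 𝔼 → 𝔼} {G : 𝔼 → ℝ} (h : IsGibbsDrift β G) :
    IsInfinitesimallyInvariant (gibbsMeasure G) (driftExpr 𝕜 β) := fun f => by
  refine ⟨h.integrable_driftExpr f, ?_⟩
  have h1 := h.integral_inner_driftExpr f (g := fun _ => 1) contDiff_const (C := 1) (by simp)
    (by simp)
  simp only [RCLike.inner_apply, one_mul, fderiv_fun_const, Pi.zero_apply, zero_apply,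
    zero_mul, integral_zero, Finset.sum_const_zero, neg_zero, integral_conj] at h1
  simpa using h1

theorem integral_inner_driftExpr_comm {β : 𝔼 → 𝔼} {G : 𝔼 → ℝ} (h : IsGibbsDrift β G)
    (f g : 𝓢(𝔼, 𝕜)) : ∫ x, ⟪driftExpr 𝕜 β f x, g x⟫_𝕜 ∂(gibbsMeasure G) =
      ∫ x, ⟪f x, driftExpr 𝕜 β g x⟫_𝕜 ∂(gibbsMeasure G) := by
  have key : ∀ f g : 𝓢(𝔼, 𝕜), ∫ x, ⟪driftExpr 𝕜 β f x, g x⟫_𝕜 ∂(gibbsMeasure G) =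
      -∑ i, ∫ x, ⟪fderiv ℝ f x (stdOrthonormalBasis ℝ 𝔼 i),
        fderiv ℝ g x (stdOrthonormalBasis ℝ 𝔼 i)⟫_𝕜 ∂(gibbsMeasure G) := fun f g => by
    obtain ⟨C0, h0, hC0⟩ := g.exists_norm_le
    obtain ⟨C1, h1, hC1⟩ := g.exists_norm_fderiv_le
    exact h.integral_inner_driftExpr f g.smooth' (C := C0 + C1)
      (fun x => (hC0 x).trans (by linarith)) (fun x => (hC1 x).trans (by linarith))
  have h2 := congrArg (starRingEnd 𝕜) (key g f)
  simp only [map_neg, map_sum, ← integral_conj, inner_conj_symm] at h2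
  rw [key f g, h2]

theorem re_integral_inner_driftExpr_nonpos {β : 𝔼 → 𝔼} {G : 𝔼 → ℝ} (h : IsGibbsDrift β G)
    (f : 𝓢(𝔼, 𝕜)) : RCLike.re (∫ x, ⟪driftExpr 𝕜 β f x, f x⟫_𝕜 ∂(gibbsMeasure G)) ≤ 0 := by
  obtain ⟨C0, h0, hC0⟩ := f.exists_norm_le
  obtain ⟨C1, h1, hC1⟩ := f.exists_norm_fderiv_le
  have hfs : ContDiff ℝ ∞ (f : 𝔼 → 𝕜) := f.smooth'
  rw [h.integral_inner_driftExpr f hfs (C := C0 + C1)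
    (fun x => (hC0 x).trans (by linarith)) (fun x => (hC1 x).trans (by linarith)), map_neg, map_sum,
    neg_nonpos]
  refine Finset.sum_nonneg fun i _ => ?_
  have e1 : ∀ x, ⟪fderiv ℝ f x (stdOrthonormalBasis ℝ 𝔼 i),
      fderiv ℝ f x (stdOrthonormalBasis ℝ 𝔼 i)⟫_𝕜 =
        ((‖fderiv ℝ f x (stdOrthonormalBasis ℝ 𝔼 i)‖ ^ 2 : ℝ) : 𝕜) := fun x => by
    rw [inner_self_eq_norm_sq_to_K]
    norm_cast
  simp only [e1]
  rw [integral_ofReal, RCLike.ofReal_re]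
  exact integral_nonneg fun x => by positivity

theorem dense_domain {β : 𝔼 → 𝔼} {G : 𝔼 → ℝ} (h : IsGibbsDrift β G)
    (hβ : ∀ f : 𝓢(𝔼, 𝕜), MemLp (fun x => fderiv ℝ f x (β x)) 2 (gibbsMeasure G)) :
    Dense ((schwartzOp (gibbsMeasure G) (driftExpr 𝕜 β)).domain :
      Set (Lp 𝕜 2 (gibbsMeasure G))) := by
  have := h.isFiniteMeasure
  exact dense_domain_schwartzOp (memLp_driftExpr hβ)

theorem isSymmetricOp {β : 𝔼 → 𝔼} {G : 𝔼 → ℝ} (h : IsGibbsDrift β G)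
    (hβ : ∀ f : 𝓢(𝔼, 𝕜), MemLp (fun x => fderiv ℝ f x (β x)) 2 (gibbsMeasure G)) :
    IsSymmetricOp (schwartzOp (gibbsMeasure G) (driftExpr 𝕜 β)) := by
  have := h.isFiniteMeasure
  have hac := absolutelyContinuous_gibbsMeasure h.aemeasurable
  refine ⟨h.dense_domain hβ, LinearPMap.le_of_le_graph ?_⟩
  rw [graph_schwartzOp hac]
  rintro ⟨u, v⟩ ⟨g, hg1, hg2⟩
  rw [mem_adjoint_graph_schwartzOp_iff hac (memLp_driftExpr hβ)]
  intro f
  refine Eq.trans (integral_congr_ae ?_) ((h.integral_inner_driftExpr_comm f g).trans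
    (integral_congr_ae ?_))
  · filter_upwards [hg1] with x hx
    rw [← hx]
  · filter_upwards [hg2] with x hx
    rw [← hx]

theorem re_inner_nonpos {β : 𝔼 → 𝔼} {G : 𝔼 → ℝ} (h : IsGibbsDrift β G)
    {p : Lp 𝕜 2 (gibbsMeasure G) × Lp 𝕜 2 (gibbsMeasure G)}
    (hp : p ∈ (schwartzOp (gibbsMeasure G) (driftExpr 𝕜 β)).graph) :
    RCLike.re ⟪p.2, p.1⟫_𝕜 ≤ 0 := by
  rw [graph_schwartzOp (absolutelyContinuous_gibbsMeasure h.aemeasurable)] at hp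
  obtain ⟨f, hf1, hf2⟩ := hp
  rw [L2.inner_eq_integral_of_ae_eq hf2 hf1]
  exact h.re_integral_inner_driftExpr_nonpos f

end IsGibbsDrift

end Gibbs

/-! ### Square integrability and graph closures -/

section GraphClosure

theorem MeasureTheory.memLp_two_iff_lintegral {α F : Type*} [MeasurableSpace α] {μ : Measure α}
    [NormedAddCommGroup F] {f : α → F} (hf : AEStronglyMeasurable f μ) :
    MemLp f 2 μ ↔ ∫⁻ x, ‖f x‖ₑ ^ 2 ∂μ ≠ ⊤ := by
  have h := eLpNorm_lt_top_iff_lintegral_rpow_enorm_lt_top (f := f) (μ := μ) (p := 2) (by simp)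
    (by simp)
  simp only [ENNReal.toReal_ofNat, ENNReal.rpow_ofNat] at h
  rw [← lt_top_iff_ne_top, ← h]
  exact ⟨fun h => h.2, fun h => ⟨hf, h⟩⟩

theorem enorm_pow_eq_ofReal {F : Type*} [NormedAddCommGroup F] (x : F) (k : ℕ) :
    ‖x‖ₑ ^ k = ENNReal.ofReal (‖x‖ ^ k) := by
  rw [ENNReal.ofReal_pow (norm_nonneg _), ofReal_norm]

variable {d : ℕ} {𝕜 : Type*} [RCLike 𝕜]

local notation "𝔼" => EuclideanSpace ℝ (Fin d)

/-- The pair of functions `(f, g)` represents an element of the closure in `L²(μ) × L²(μ)` of the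
graph of `T` on Schwartz functions. -/
def InGraphClosure (μ : Measure (EuclideanSpace ℝ (Fin d)))
    (T : 𝓢(EuclideanSpace ℝ (Fin d), 𝕜) →ₗ[𝕜] (EuclideanSpace ℝ (Fin d) → 𝕜))
    (f g : EuclideanSpace ℝ (Fin d) → 𝕜) : Prop :=
  ∃ p ∈ (schwartzGraph μ T).topologicalClosure, p.1 =ᵐ[μ] f ∧ p.2 =ᵐ[μ] g

theorem inGraphClosure_schwartz {μ : Measure 𝔼} [μ.HasTemperateGrowth]
    {T : 𝓢(𝔼, 𝕜) →ₗ[𝕜] (𝔼 → 𝕜)} (f : 𝓢(𝔼, 𝕜)) (hT : MemLp (T f) 2 μ) :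
    InGraphClosure μ T f (T f) :=
  ⟨_, Submodule.le_topologicalClosure _ (toLp_mem_schwartzGraph (f.memLp 2 μ) hT),
    (f.memLp 2 μ).coeFn_toLp, hT.coeFn_toLp⟩

theorem tendsto_Lp_two_of_lintegral {μ : Measure 𝔼} {u : ℕ → Lp 𝕜 2 μ} {v : Lp 𝕜 2 μ}
    {f : ℕ → 𝔼 → 𝕜} {g : 𝔼 → 𝕜} (hu : ∀ n, u n =ᵐ[μ] f n) (hv : v =ᵐ[μ] g)
    (h : Tendsto (fun n => ∫⁻ x, ‖f n x - g x‖ₑ ^ 2 ∂μ) atTop (𝓝 0)) :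
    Tendsto u atTop (𝓝 v) := by
  rw [Lp.tendsto_Lp_iff_tendsto_eLpNorm']
  have e : ∀ n, eLpNorm ((u n : 𝔼 → 𝕜) - (v : 𝔼 → 𝕜)) 2 μ = (∫⁻ x, ‖f n x - g x‖ₑ ^ 2 ∂μ) ^ (1 / 2 : ℝ) := fun n => by
    rw [eLpNorm_eq_lintegral_rpow_enorm_toReal (by simp) (by simp)]
    simp only [ENNReal.toReal_ofNat, ENNReal.rpow_ofNat]
    congr 1
    refine lintegral_congr_ae ?_
    filter_upwards [hu n, hv] with x h1 h2
    rw [Pi.sub_apply, h1, h2]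
  simp only [e]
  have := (ENNReal.continuous_rpow_const (y := (1 / 2 : ℝ))).tendsto 0 |>.comp h
  simpa using! this

theorem InGraphClosure.of_tendsto {μ : Measure 𝔼} {T : 𝓢(𝔼, 𝕜) →ₗ[𝕜] (𝔼 → 𝕜)}
    {f g : ℕ → 𝔼 → 𝕜} {f' g' : 𝔼 → 𝕜} (h : ∀ n, InGraphClosure μ T (f n) (g n))
    (hf' : MemLp f' 2 μ) (hg' : MemLp g' 2 μ)
    (hf : Tendsto (fun n => ∫⁻ x, ‖f n x - f' x‖ₑ ^ 2 ∂μ) atTop (𝓝 0))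
    (hg : Tendsto (fun n => ∫⁻ x, ‖g n x - g' x‖ₑ ^ 2 ∂μ) atTop (𝓝 0)) :
    InGraphClosure μ T f' g' := by
  choose p hp hp1 hp2 using h
  refine ⟨(hf'.toLp f', hg'.toLp g'), ?_, hf'.coeFn_toLp, hg'.coeFn_toLp⟩
  have h1 := tendsto_Lp_two_of_lintegral hp1 hf'.coeFn_toLp hf
  have h2 := tendsto_Lp_two_of_lintegral hp2 hg'.coeFn_toLp hg
  exact (Submodule.isClosed_topologicalClosure _).mem_of_tendsto (h1.prodMk_nhds h2)
    (Eventually.of_forall hp)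

/-- Applying the operator to a function of `G` produces `|∇G|²` and `ΔG`, so `L²` convergence
requires `b ∈ L⁴` and `q ∈ L²`. The squared bound is split by `(s + t² + r)² ≤ 3 (s² + t⁴ + r²)`,
and the integrals of the varying majorants converge. -/
theorem tendsto_lintegral_sq_of_mollify_bound {F : Type*} [NormedAddCommGroup F]
    {b : 𝔼 → 𝔼} {q g : 𝔼 → ℝ} (hb : LocallyIntegrable b) (hq : LocallyIntegrable q)
    (hb4 : ∫⁻ x, ‖b x‖ₑ ^ 4 ≠ ⊤) (hq2 : ∫⁻ x, ‖q x‖ₑ ^ 2 ≠ ⊤) (hg : MemLp g 2)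
    {f : ℕ → 𝔼 → F} (hf : ∀ n, AEStronglyMeasurable (f n)) {K : ℝ}
    (hle : ∀ n x, ‖f n x‖ ≤ K * (g x + ‖mollify n b x‖ ^ 2 + ‖mollify n q x‖))
    (hlim : ∀ᵐ x, Tendsto (fun n => f n x) atTop (𝓝 0)) :
    Tendsto (fun n => ∫⁻ x, ‖f n x‖ₑ ^ 2) atTop (𝓝 0) := by
  have mb : ∀ n, AEMeasurable fun x : 𝔼 => ‖mollify n b x‖ₑ ^ 4 := fun n =>
    ((contDiff_mollify n hb).continuous.enorm.measurable.pow_const 4).aemeasurable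
  have mq : ∀ n, AEMeasurable fun x : 𝔼 => ‖mollify n q x‖ₑ ^ 2 := fun n =>
    ((contDiff_mollify n hq).continuous.enorm.measurable.pow_const 2).aemeasurable
  have mb' : AEMeasurable fun x : 𝔼 => ‖b x‖ₑ ^ 4 := hb.aestronglyMeasurable.enorm.pow_const 4
  have mg : AEMeasurable fun x : 𝔼 => ‖g x‖ₑ ^ 2 := hg.1.enorm.pow_const 2
  have hg2 := (memLp_two_iff_lintegral hg.1).1 hg
  have split : ∀ s t : 𝔼 → ℝ≥0∞, AEMeasurable s →
      ∫⁻ x, ENNReal.ofReal (3 * K ^ 2) * (‖g x‖ₑ ^ 2 + s x + t x) =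
        ENNReal.ofReal (3 * K ^ 2) * ((∫⁻ x, ‖g x‖ₑ ^ 2) + (∫⁻ x, s x) + ∫⁻ x, t x) :=
    fun s t hs => by
      have mgs : AEMeasurable fun x => ‖g x‖ₑ ^ 2 + s x := mg.add hs
      rw [lintegral_const_mul' _ _ ENNReal.ofReal_ne_top, lintegral_add_left' mgs,
        lintegral_add_left' mg]
  refine tendsto_lintegral_zero_of_le_of_tendsto
    (k := fun n x => ENNReal.ofReal (3 * K ^ 2) *
      (‖g x‖ₑ ^ 2 + ‖mollify n b x‖ₑ ^ 4 + ‖mollify n q x‖ₑ ^ 2))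
    (K := fun x => ENNReal.ofReal (3 * K ^ 2) * (‖g x‖ₑ ^ 2 + ‖b x‖ₑ ^ 4 + ‖q x‖ₑ ^ 2))
    (fun n => (hf n).enorm.pow_const 2) (fun n => ((mg.add (mb n)).add (mq n)).const_mul _)
    (fun n => Eventually.of_forall fun x => ?_) ?_ ?_ ?_ ?_
  · simp only [enorm_pow_eq_ofReal]
    rw [← ENNReal.ofReal_add (by positivity) (by positivity),
      ← ENNReal.ofReal_add (by positivity) (by positivity), ← ENNReal.ofReal_mul (by positivity)]
    refine ENNReal.ofReal_le_ofReal ?_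
    refine (pow_le_pow_left₀ (norm_nonneg _) (hle n x) 2).trans ?_
    have h3 : ∀ s t r : ℝ, (s + t ^ 2 + r) ^ 2 ≤ 3 * (‖s‖ ^ 2 + t ^ 4 + r ^ 2) := fun s t r => by
      rw [Real.norm_eq_abs, sq_abs]
      nlinarith [sq_nonneg (s - t ^ 2), sq_nonneg (s - r), sq_nonneg (t ^ 2 - r)]
    rw [mul_pow, mul_comm 3, mul_assoc]
    exact mul_le_mul_of_nonneg_left (h3 _ _ _) (sq_nonneg K)
  · filter_upwards [hlim] with x hx
    have := ((ENNReal.continuous_pow 2).tendsto _).comp hx.enorm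
    simpa using! this
  · filter_upwards [ae_tendsto_mollify hb, ae_tendsto_mollify hq] with x h1 h2
    refine ENNReal.Tendsto.const_mul ?_ (Or.inr ENNReal.ofReal_ne_top)
    exact (tendsto_const_nhds.add (((ENNReal.continuous_pow 4).tendsto _).comp h1.enorm)).add
      (((ENNReal.continuous_pow 2).tendsto _).comp h2.enorm)
  · rw [split _ _ mb']
    simp only [fun n => split _ (fun x => ‖mollify n q x‖ₑ ^ 2) (mb n)]
    refine ENNReal.Tendsto.const_mul ?_ (Or.inr ENNReal.ofReal_ne_top)
    exact (tendsto_const_nhds.add (tendsto_lintegral_enorm_mollify_pow hb (by norm_num))).add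
      (tendsto_lintegral_enorm_mollify_pow hq (by norm_num))
  · rw [split _ _ mb']
    exact ENNReal.mul_ne_top ENNReal.ofReal_ne_top
      (ENNReal.add_ne_top.2 ⟨ENNReal.add_ne_top.2 ⟨hg2, hb4⟩, hq2⟩)

end GraphClosure

/-! ### Conjugation of the drift operator by a function of the potential -/

section Conjugation

variable {d : ℕ} {𝕜 : Type*} [RCLike 𝕜]

local notation "𝔼" => EuclideanSpace ℝ (Fin d)

/-- The value of `Δ + β · ∇` at `F(G) φ`, where `F₀, F₁, F₂` are the values of `F, F', F''` at `G`,
`p` is the gradient and `q` the Laplacian of `G`. -/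
def driftComp (β : EuclideanSpace ℝ (Fin d) → EuclideanSpace ℝ (Fin d))
    (φ : EuclideanSpace ℝ (Fin d) → 𝕜) (F₀ F₁ F₂ : ℝ) (p : EuclideanSpace ℝ (Fin d)) (q : ℝ)
    (x : EuclideanSpace ℝ (Fin d)) : 𝕜 :=
  F₀ • driftFun β φ x + (2 * F₁) • fderiv ℝ φ x p +
    (F₂ * ‖p‖ ^ 2 + F₁ * q + F₁ * ⟪p, β x⟫_ℝ) • φ x

theorem driftFun_comp_smul {β : 𝔼 → 𝔼} {φ : 𝔼 → 𝕜} {F : ℝ → ℝ} {g : 𝔼 → ℝ} (hF : ContDiff ℝ ∞ F)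
    (hg : ContDiff ℝ ∞ g) (hφ : ContDiff ℝ ∞ φ) {x p : 𝔼} (hp : ∀ e, fderiv ℝ g x e = ⟪p, e⟫_ℝ) :
    driftFun β (fun y => F (g y) • φ y) x = driftComp β φ (F (g x)) (deriv F (g x))
      (deriv (deriv F) (g x)) p (Laplacian.laplacian g x) x := by
  have hv : ∀ e, fderiv ℝ (fun y => F (g y)) x e = ⟪deriv F (g x) • p, e⟫_ℝ := fun e => by
    rw [fderiv_comp_apply_of_gradient hF.two_of_infty hg.two_of_infty, hp, real_inner_smul_left]
  rw [driftFun_smul (a := fun y => F (g y)) (hF.comp hg).two_of_infty hφ.two_of_infty hv, map_smul, smul_smul]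
  congr 2
  rw [driftFun, hv, real_inner_smul_left, laplacian_comp_of_gradient hF.two_of_infty
    hg.two_of_infty hp]

theorem norm_driftComp_le (β : 𝔼 → 𝔼) (φ : 𝔼 → 𝕜) {F₀ F₁ F₂ C : ℝ} (h₀ : |F₀| ≤ C)
    (h₁ : |F₁| ≤ C) (h₂ : |F₂| ≤ C) (p : 𝔼) (q : ℝ) (x : 𝔼) :
    ‖driftComp β φ F₀ F₁ F₂ p q x‖ ≤ C * (‖driftFun β φ x‖ + 2 * (‖fderiv ℝ φ x‖ * ‖p‖) +
      (‖p‖ ^ 2 + |q| + ‖p‖ * ‖β x‖) * ‖φ x‖) := by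
  have hC : 0 ≤ C := (abs_nonneg _).trans h₀
  have e1 : ‖F₀ • driftFun β φ x‖ ≤ C * ‖driftFun β φ x‖ := by
    rw [norm_smul]
    gcongr
    exact h₀
  have e2 : ‖(2 * F₁) • fderiv ℝ φ x p‖ ≤ C * (2 * (‖fderiv ℝ φ x‖ * ‖p‖)) := by
    rw [norm_smul, norm_mul, Real.norm_of_nonneg zero_le_two]
    calc 2 * ‖F₁‖ * ‖fderiv ℝ φ x p‖ ≤ 2 * C * (‖fderiv ℝ φ x‖ * ‖p‖) := by
          gcongr
          · exact h₁
          · exact (fderiv ℝ φ x).le_opNorm p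
      _ = _ := by ring
  have e3 : ‖(F₂ * ‖p‖ ^ 2 + F₁ * q + F₁ * ⟪p, β x⟫_ℝ) • φ x‖ ≤
      C * ((‖p‖ ^ 2 + |q| + ‖p‖ * ‖β x‖) * ‖φ x‖) := by
    rw [norm_smul, ← mul_assoc]
    gcongr
    calc ‖F₂ * ‖p‖ ^ 2 + F₁ * q + F₁ * ⟪p, β x⟫_ℝ‖
        ≤ |F₂| * ‖p‖ ^ 2 + |F₁| * |q| + |F₁| * |⟪p, β x⟫_ℝ| := by
          refine (norm_add₃_le).trans (le_of_eq ?_)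
          simp only [Real.norm_eq_abs, abs_mul, abs_pow, abs_norm]
      _ ≤ C * ‖p‖ ^ 2 + C * |q| + C * (‖p‖ * ‖β x‖) := by
          gcongr
          exact abs_real_inner_le_norm _ _
      _ = _ := by ring
  rw [mul_add, mul_add]
  exact (norm_add₃_le).trans (add_le_add (add_le_add e1 e2) e3)

theorem tendsto_driftComp (β : 𝔼 → 𝔼) (φ : 𝔼 → 𝕜) {F₀ F₁ F₂ q : ℕ → ℝ} {p : ℕ → 𝔼}
    {a₀ a₁ a₂ r : ℝ} {v : 𝔼} (h₀ : Tendsto F₀ atTop (𝓝 a₀)) (h₁ : Tendsto F₁ atTop (𝓝 a₁))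
    (h₂ : Tendsto F₂ atTop (𝓝 a₂)) (hp : Tendsto p atTop (𝓝 v)) (hq : Tendsto q atTop (𝓝 r))
    (x : 𝔼) : Tendsto (fun n => driftComp β φ (F₀ n) (F₁ n) (F₂ n) (p n) (q n) x) atTop
      (𝓝 (driftComp β φ a₀ a₁ a₂ v r x)) :=
  ((h₀.smul_const _).add ((h₁.const_mul 2).smul (((fderiv ℝ φ x).continuous.tendsto v).comp hp))).add
    ((((h₂.mul (hp.norm.pow 2)).add (h₁.mul hq)).add
      (h₁.mul (hp.inner tendsto_const_nhds))).smul_const _)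

theorem aestronglyMeasurable_driftFun {β : 𝔼 → 𝔼} (hβ : AEStronglyMeasurable β) {φ : 𝔼 → 𝕜}
    (hφ : ContDiff ℝ ∞ φ) : AEStronglyMeasurable (driftFun β φ) := by
  have hΔ : Continuous (Laplacian.laplacian φ) := by
    rw [show Laplacian.laplacian φ = _ from
      funext (hφ.two_of_infty.laplacian_eq_sum_fderiv (stdOrthonormalBasis ℝ 𝔼))]
    refine continuous_finsetSum _ fun i _ => ?_
    have h1 : ContDiff ℝ ∞ fun y => fderiv ℝ φ y (stdOrthonormalBasis ℝ 𝔼 i) :=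
      (hφ.fderiv_right (m := ∞) (by norm_cast)).clm_apply contDiff_const
    exact (h1.continuous_fderiv (by norm_num)).clm_apply continuous_const
  exact hΔ.aestronglyMeasurable.add (hβ.clm_apply_continuous
    (hφ.continuous_fderiv (by norm_num)).aestronglyMeasurable)

theorem aestronglyMeasurable_driftComp {β : 𝔼 → 𝔼} (hβ : AEStronglyMeasurable β) {φ : 𝔼 → 𝕜}
    (hφ : ContDiff ℝ ∞ φ) {F₀ F₁ F₂ q : 𝔼 → ℝ} {p : 𝔼 → 𝔼} (h₀ : AEStronglyMeasurable F₀)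
    (h₁ : AEStronglyMeasurable F₁) (h₂ : AEStronglyMeasurable F₂) (hp : AEStronglyMeasurable p)
    (hq : AEStronglyMeasurable q) :
    AEStronglyMeasurable fun x => driftComp β φ (F₀ x) (F₁ x) (F₂ x) (p x) (q x) x :=
  ((h₀.smul (aestronglyMeasurable_driftFun hβ hφ)).add ((h₁.const_mul 2).smul
    (hp.clm_apply_continuous (hφ.continuous_fderiv (by norm_num)).aestronglyMeasurable))).add
      ((((h₂.mul (hp.norm.pow 2)).add (h₁.mul hq)).add (h₁.mul (hp.inner hβ))).smul
        hφ.continuous.aestronglyMeasurable)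

end Conjugation

/-! ### Bounded functions of `G` in the closure of the graph. -/

section Regularization

variable {d : ℕ} {𝕜 : Type*} [RCLike 𝕜]

local notation "𝔼" => EuclideanSpace ℝ (Fin d)

theorem lintegral_gibbsMeasure {G : 𝔼 → ℝ} (hG : AEMeasurable G) {f : 𝔼 → ℝ≥0∞}
    (hf : AEMeasurable f) :
    ∫⁻ x, f x ∂(gibbsMeasure G) = ∫⁻ x, ENNReal.ofReal (Real.exp (-G x)) * f x := by
  rw [gibbsMeasure, lintegral_withDensity_eq_lintegral_mul₀ (aemeasurable_gibbsDensity hG) hf]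
  rfl

/-- Local boundedness of `e^{-G}` is exploited here: on functions supported in a fixed ball,
convergence in `L²(dx)` implies convergence in `L²(μ)`. -/
theorem lintegral_enorm_sq_gibbsMeasure_le {F : Type*} [NormedAddCommGroup F] {G : 𝔼 → ℝ}
    (hG : AEMeasurable G) {R C : ℝ} (hC : ∀ᵐ x : 𝔼, ‖x‖ ≤ R → Real.exp (-G x) ≤ C) {f : 𝔼 → F}
    (hf : AEStronglyMeasurable f) (h0 : ∀ x, R < ‖x‖ → f x = 0) :
    ∫⁻ x, ‖f x‖ₑ ^ 2 ∂(gibbsMeasure G) ≤ ENNReal.ofReal C * ∫⁻ x, ‖f x‖ₑ ^ 2 := by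
  rw [lintegral_gibbsMeasure hG (hf.enorm.pow_const 2),
    ← lintegral_const_mul' _ _ ENNReal.ofReal_ne_top]
  refine lintegral_mono_ae ?_
  filter_upwards [hC] with x hx
  rcases le_or_gt ‖x‖ R with hxR | hxR
  · gcongr
    exact hx hxR
  · simp [h0 x hxR]

theorem norm_driftComp_le_of_bound (β : 𝔼 → 𝔼) (φ : 𝔼 → 𝕜) {F₀ F₁ F₂ C M : ℝ} (h₀ : |F₀| ≤ C)
    (h₁ : |F₁| ≤ C) (h₂ : |F₂| ≤ C) (p : 𝔼) (q : ℝ) {x : 𝔼} (m₀ : ‖φ x‖ ≤ M)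
    (m₁ : ‖fderiv ℝ φ x‖ ≤ M) (m₂ : ‖Laplacian.laplacian φ x‖ ≤ M) :
    ‖driftComp β φ F₀ F₁ F₂ p q x‖ ≤ 3 * C * M * (1 + ‖β x‖ ^ 2 + ‖p‖ ^ 2 + |q|) := by
  have hC : 0 ≤ C := (abs_nonneg _).trans h₀
  have hM : 0 ≤ M := (norm_nonneg _).trans m₀
  have hd : ‖driftFun β φ x‖ ≤ M + M * ‖β x‖ :=
    (norm_add_le _ _).trans (add_le_add m₂ (((fderiv ℝ φ x).le_opNorm _).trans (by gcongr)))
  refine (norm_driftComp_le β φ h₀ h₁ h₂ p q x).trans ?_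
  calc C * (‖driftFun β φ x‖ + 2 * (‖fderiv ℝ φ x‖ * ‖p‖) +
        (‖p‖ ^ 2 + |q| + ‖p‖ * ‖β x‖) * ‖φ x‖)
      ≤ C * (M + M * ‖β x‖ + 2 * (M * ‖p‖) + (‖p‖ ^ 2 + |q| + ‖p‖ * ‖β x‖) * M) := by gcongr
    _ = C * M * (1 + ‖β x‖ + 2 * ‖p‖ + ‖p‖ ^ 2 + |q| + ‖p‖ * ‖β x‖) := by ring
    -- The first-order terms and the cross term are absorbed by `2ab ≤ a² + b²`.
    _ ≤ C * M * (3 * (1 + ‖β x‖ ^ 2 + ‖p‖ ^ 2 + |q|)) := by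
        gcongr
        nlinarith [sq_nonneg (‖β x‖ - 1), sq_nonneg (‖p‖ - 1), sq_nonneg (‖p‖ - ‖β x‖),
          abs_nonneg q]
    _ = _ := by ring

theorem norm_indicator_neg {F : Type*} [NormedAddCommGroup F] (s : Set 𝔼) (b : 𝔼 → F) (x : 𝔼) :
    ‖s.indicator (fun x => -b x) x‖ = ‖s.indicator b x‖ := by
  rw [norm_indicator_eq_indicator_norm, norm_indicator_eq_indicator_norm]
  simp only [norm_neg]

theorem inGraphClosure_driftFun {μ : Measure 𝔼} [μ.HasTemperateGrowth] {β : 𝔼 → 𝔼}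
    (hβ : ∀ f : 𝓢(𝔼, 𝕜), MemLp (fun x => fderiv ℝ f x (β x)) 2 μ) {f : 𝔼 → 𝕜}
    (hf : ContDiff ℝ ∞ f) (hc : HasCompactSupport f) :
    InGraphClosure μ (driftExpr 𝕜 β) f (driftFun β f) := by
  have h1 := inGraphClosure_schwartz (μ := μ) (T := driftExpr 𝕜 β) (hc.toSchwartzMap hf)
    (memLp_driftExpr hβ _)
  rw [driftExpr_eq] at h1
  exact h1

-- `F(G) φ` is not smooth, but with `G_n` the mollifications of `G`, `F(G_n) φ` is smooth with
-- compact support, hence in the domain. Its image involves the mollifications of `∇G = -β` and `ΔG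
-- = -D`, and both it and the function converge in `L²(dx)` on a fixed ball, thus in `L²(μ)`.
set_option maxHeartbeats 400000 in
theorem IsGibbsDrift.inGraphClosure_comp {β : 𝔼 → 𝔼} {G D : 𝔼 → ℝ} (h : IsGibbsDrift β G)
    (hD : IsWeakDivergence β D)
    (hβ : ∀ f : 𝓢(𝔼, 𝕜), MemLp (fun x => fderiv ℝ f x (β x)) 2 (gibbsMeasure G))
    (hβ4 : ∀ R, MemLp (fun x => ‖(Metric.closedBall 0 R).indicator β x‖ ^ 2) 2)
    (hD2 : ∀ R, MemLp ((Metric.closedBall 0 R).indicator D) 2)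
    (hw : ∀ R : ℝ, ∃ C : ℝ, ∀ᵐ x : 𝔼, ‖x‖ ≤ R → Real.exp (-G x) ≤ C)
    {F : ℝ → ℝ} (hF : ContDiff ℝ ∞ F) {C : ℝ} (hF0 : ∀ s, |F s| ≤ C)
    (hF1 : ∀ s, |deriv F s| ≤ C) (hF2 : ∀ s, |deriv (deriv F) s| ≤ C) {φ : 𝔼 → 𝕜}
    (hφ : ContDiff ℝ ∞ φ) (hφc : HasCompactSupport φ) :
    InGraphClosure (gibbsMeasure G) (driftExpr 𝕜 β) (fun x => F (G x) • φ x) fun x =>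
      driftComp β φ (F (G x)) (deriv F (G x)) (deriv (deriv F) (G x)) (-β x) (-D x) x := by
  have := h.isFiniteMeasure
  have hC : 0 ≤ C := (abs_nonneg _).trans (hF0 0)
  have hDw := hD.neg
  have hGm := h.weak.1.aestronglyMeasurable
  have hcF0 := hF.continuous
  have hcF1 : Continuous (deriv F) := hF.continuous_deriv (by norm_num)
  have hcF2 : Continuous (deriv (deriv F)) :=
    (contDiff_infty_iff_deriv.1 hF).2.continuous_deriv (by norm_num)
  set b : 𝔼 → 𝔼 := fun x => -β x with hb
  set q : 𝔼 → ℝ := fun x => -D x with hq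
  obtain ⟨R, hR⟩ := hφc.exists_eq_zero_of_norm_gt
  obtain ⟨Cw, hCw⟩ := hw R
  obtain ⟨M0, hM0, hm0⟩ := (hφc.toSchwartzMap hφ).exists_norm_le
  obtain ⟨M1, hM1, hm1⟩ := (hφc.toSchwartzMap hφ).exists_norm_fderiv_le
  obtain ⟨M2, hM2, hm2⟩ := (hφc.toSchwartzMap hφ).exists_norm_laplacian_le
  set M := M0 + M1 + M2 with hM
  have m0 : ∀ x, ‖φ x‖ ≤ M := fun x => (hm0 x).trans (by linarith)
  have m1 : ∀ x, ‖fderiv ℝ φ x‖ ≤ M := fun x => (hm1 x).trans (by linarith)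
  have m2 : ∀ x, ‖Laplacian.laplacian φ x‖ ≤ M := fun x => (hm2 x).trans (by linarith)
  have hMnn : 0 ≤ M := by positivity
  set bt := (Metric.closedBall (0 : 𝔼) (R + 1)).indicator b with hbt
  set qt := (Metric.closedBall (0 : 𝔼) (R + 1)).indicator q with hqt
  have hbti : LocallyIntegrable bt :=
    (h.weak.2.1.integrable_indicator_closedBall _).locallyIntegrable
  have hqti : LocallyIntegrable qt :=
    (hDw.2.1.integrable_indicator_closedBall _).locallyIntegrable
  have hbt2 : MemLp (fun x => ‖bt x‖ ^ 2) 2 := by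
    simpa only [hbt, hb, norm_indicator_neg] using hβ4 (R + 1)
  have hqt2 : MemLp qt 2 :=
    (hD2 (R + 1)).of_le hqti.aestronglyMeasurable (Eventually.of_forall fun x =>
      (norm_indicator_neg _ D x).le)
  have hb4 : ∫⁻ x, ‖bt x‖ₑ ^ 4 ≠ ⊤ := by
    have := (memLp_two_iff_lintegral hbt2.1).1 hbt2
    simpa only [enorm_pow, enorm_norm, ← pow_mul] using this
  have hq2 := (memLp_two_iff_lintegral hqt2.1).1 hqt2
  -- On the ball, `g = 2 + 3|β|² + |D|` is what remains when the bounds for `Λ n` and `Λ'` are added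
  -- and the mollified terms are set aside.
  set g : 𝔼 → ℝ := fun x => (Metric.closedBall (0 : 𝔼) R).indicator (fun _ => (2 : ℝ)) x +
    3 * ‖bt x‖ ^ 2 + ‖qt x‖ with hg
  have hball : MemLp ((Metric.closedBall (0 : 𝔼) R).indicator fun _ => (2 : ℝ)) 2 volume :=
    memLp_indicator_const _ measurableSet_closedBall _
      (Or.inr (isCompact_closedBall (0 : 𝔼) R).measure_lt_top.ne)
  have hbt3 : MemLp (fun x => 3 * ‖bt x‖ ^ 2) 2 volume := hbt2.const_mul 3
  have hg2 : MemLp g 2 volume := (hball.add hbt3).add hqt2.norm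
  have hg0 : ∀ x, 0 ≤ g x := fun x => by
    have : 0 ≤ (Metric.closedBall (0 : 𝔼) R).indicator (fun _ => (2 : ℝ)) x :=
      Set.indicator_nonneg (fun _ _ => zero_le_two) x
    positivity
  have hgR : ∀ x, ‖x‖ ≤ R → g x = 2 + 3 * ‖β x‖ ^ 2 + ‖q x‖ := fun x hx => by
    simp only [hg, hbt, hqt]
    rw [Set.indicator_of_mem (mem_closedBall_zero_iff.2 hx),
      Set.indicator_of_mem (mem_closedBall_zero_iff.2 (by linarith)),
      Set.indicator_of_mem (mem_closedBall_zero_iff.2 (by linarith)), hb, norm_neg]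
  have z0 : ∀ x, R < ‖x‖ → φ x = 0 := fun x hx => image_eq_zero_of_notMem_tsupport (hR x hx)
  have z1 : ∀ x, R < ‖x‖ → fderiv ℝ φ x = 0 := fun x hx => fderiv_of_notMem_tsupport ℝ (hR x hx)
  have z2 : ∀ x, R < ‖x‖ → Laplacian.laplacian φ x = 0 := fun x hx => by
    have hev : φ =ᶠ[𝓝 x] fun _ => 0 := notMem_tsupport_iff_eventuallyEq.1 (hR x hx)
    rw [(InnerProductSpace.laplacian_congr_nhds hev).eq_of_nhds]
    exact congrFun (InnerProductSpace.laplacian_const (E := 𝔼) (c := (0 : 𝕜))) x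
  have zL : ∀ x, R < ‖x‖ → ∀ F₀ F₁ F₂ p r, driftComp β φ F₀ F₁ F₂ p r x = 0 :=
    fun x hx F₀ F₁ F₂ p r => by
      simp only [driftComp, driftFun, z0 x hx, z1 x hx, z2 x hx, zero_apply, smul_zero, add_zero]
  set Gn := fun n => mollify n G with hGn
  have hGs : ∀ n, ContDiff ℝ ∞ (Gn n) := fun n => contDiff_mollify n h.weak.1
  set f : ℕ → 𝔼 → 𝕜 := fun n x => F (Gn n x) • φ x with hf
  set Λ : ℕ → 𝔼 → 𝕜 := fun n x => driftComp β φ (F (Gn n x)) (deriv F (Gn n x))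
    (deriv (deriv F) (Gn n x)) (mollify n b x) (mollify n q x) x with hΛ
  set f' : 𝔼 → 𝕜 := fun x => F (G x) • φ x with hf'
  set Λ' : 𝔼 → 𝕜 := fun x => driftComp β φ (F (G x)) (deriv F (G x)) (deriv (deriv F) (G x))
    (b x) (q x) x with hΛ'
  have hfs : ∀ n, ContDiff ℝ ∞ (f n) := fun n => (hF.comp (hGs n)).smul hφ
  have hfc : ∀ n, HasCompactSupport (f n) := fun n =>
    HasCompactSupport.smul_left (f := fun x => F (Gn n x)) hφc
  have hmem : ∀ n, InGraphClosure (gibbsMeasure G) (driftExpr 𝕜 β) (f n) (Λ n) := fun n => by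
    have h2 : driftFun β (f n) = Λ n := funext fun x => by
      have h3 := driftFun_comp_smul (β := β) hF (hGs n) hφ
        (fderiv_mollify_of_isWeakGradient h.weak n x)
      rw [laplacian_mollify_of_isWeakGradient h.weak hDw n x] at h3
      exact h3
    rw [← h2]
    exact inGraphClosure_driftFun hβ (hfs n) (hfc n)
  have mf : ∀ n, AEStronglyMeasurable (f n) := fun n => (hfs n).continuous.aestronglyMeasurable
  have mf' : AEStronglyMeasurable f' :=
    (hcF0.comp_aestronglyMeasurable hGm).smul hφ.continuous.aestronglyMeasurable
  have mΛ : ∀ n, AEStronglyMeasurable (Λ n) := fun n =>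
    aestronglyMeasurable_driftComp h.aestronglyMeasurable hφ
      (hcF0.comp (hGs n).continuous).aestronglyMeasurable
      (hcF1.comp (hGs n).continuous).aestronglyMeasurable
      (hcF2.comp (hGs n).continuous).aestronglyMeasurable
      (contDiff_mollify n h.weak.2.1).continuous.aestronglyMeasurable
      (contDiff_mollify n hDw.2.1).continuous.aestronglyMeasurable
  have mΛ' : AEStronglyMeasurable Λ' :=
    aestronglyMeasurable_driftComp h.aestronglyMeasurable hφ
      (hcF0.comp_aestronglyMeasurable hGm) (hcF1.comp_aestronglyMeasurable hGm)
      (hcF2.comp_aestronglyMeasurable hGm) h.weak.2.1.aestronglyMeasurable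
      hDw.2.1.aestronglyMeasurable
  have hCM : 0 ≤ C * M := by positivity
  have bf : ∀ s x, ‖F s • φ x‖ ≤ C * M := fun s x => by
    rw [norm_smul]
    exact mul_le_mul (hF0 s) (m0 x) (norm_nonneg _) hC
  have bf' : ∀ x, ‖f' x‖ ≤ 3 * C * M * g x := fun x => by
    rcases le_or_gt ‖x‖ R with hx | hx
    · refine (bf _ x).trans ?_
      rw [hgR x hx]
      nlinarith [mul_nonneg hCM (sq_nonneg ‖β x‖), mul_nonneg hCM (norm_nonneg (q x))]
    · simp only [hf', z0 x hx, smul_zero, norm_zero]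
      exact mul_nonneg (by positivity) (hg0 x)
  have bΛ' : ∀ x, ‖Λ' x‖ ≤ 3 * C * M * g x := fun x => by
    rcases le_or_gt ‖x‖ R with hx | hx
    · refine (norm_driftComp_le_of_bound β φ (hF0 _) (hF1 _) (hF2 _) _ _ (m0 x) (m1 x)
        (m2 x)).trans ?_
      rw [hgR x hx, hb, norm_neg, Real.norm_eq_abs]
      refine mul_le_mul_of_nonneg_left ?_ (by positivity)
      linarith [sq_nonneg ‖β x‖]
    · simp only [hΛ', zL x hx, norm_zero]
      exact mul_nonneg (by positivity) (hg0 x)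
  have bfn : ∀ n x, ‖f n x - f' x‖ ≤
      3 * C * M * (g x + ‖mollify n bt x‖ ^ 2 + ‖mollify n qt x‖) := fun n x => by
    rcases le_or_gt ‖x‖ R with hx | hx
    · refine (norm_sub_le _ _).trans ((add_le_add (bf _ x) (bf _ x)).trans ?_)
      rw [hgR x hx]
      nlinarith [mul_nonneg hCM (sq_nonneg ‖β x‖), mul_nonneg hCM (norm_nonneg (q x)),
        mul_nonneg hCM (sq_nonneg ‖mollify n bt x‖), mul_nonneg hCM (norm_nonneg (mollify n qt x))]
    · simp only [hf, hf', z0 x hx, smul_zero, sub_zero, norm_zero]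
      have := hg0 x
      positivity
  have bΛn : ∀ n x, ‖Λ n x - Λ' x‖ ≤
      3 * C * M * (g x + ‖mollify n bt x‖ ^ 2 + ‖mollify n qt x‖) := fun n x => by
    rcases le_or_gt ‖x‖ R with hx | hx
    · refine (norm_sub_le _ _).trans ((add_le_add
        (norm_driftComp_le_of_bound β φ (hF0 _) (hF1 _) (hF2 _) _ _ (m0 x) (m1 x) (m2 x))
        (norm_driftComp_le_of_bound β φ (hF0 _) (hF1 _) (hF2 _) _ _ (m0 x) (m1 x) (m2 x))).trans ?_)
      rw [hgR x hx, hbt, hqt, mollify_indicator_closedBall b n hx,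
        mollify_indicator_closedBall q n hx, ← mul_add]
      refine mul_le_mul_of_nonneg_left (le_of_eq ?_) (by positivity)
      simp only [hb, norm_neg, Real.norm_eq_abs]
      ring
    · simp only [hΛ, hΛ', zL x hx, sub_zero, norm_zero]
      have := hg0 x
      positivity
  have hlim0 : ∀ᵐ x, Tendsto (fun n => f n x - f' x) atTop (𝓝 0) := by
    filter_upwards [ae_tendsto_mollify h.weak.1] with x hx
    have := (((hcF0.tendsto _).comp hx).smul_const (φ x)).sub_const (f' x)
    simpa only [hf', sub_self] using! this
  have hlim1 : ∀ᵐ x, Tendsto (fun n => Λ n x - Λ' x) atTop (𝓝 0) := by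
    filter_upwards [ae_tendsto_mollify h.weak.1, ae_tendsto_mollify h.weak.2.1,
      ae_tendsto_mollify hDw.2.1] with x hx1 hx2 hx3
    exact tendsto_sub_nhds_zero_iff.2 (tendsto_driftComp β φ ((hcF0.tendsto _).comp hx1)
      ((hcF1.tendsto _).comp hx1) ((hcF2.tendsto _).comp hx1) hx2 hx3 x)
  have memL2 : ∀ u : 𝔼 → 𝕜, AEStronglyMeasurable u → (∀ x, ‖u x‖ ≤ 3 * C * M * g x) →
      (∀ x, R < ‖x‖ → u x = 0) → MemLp u 2 (gibbsMeasure G) := fun u hu hub hu0 => by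
    have h1 : MemLp u 2 volume := (hg2.const_mul (3 * C * M)).of_le hu (Eventually.of_forall
      fun x => (hub x).trans (le_abs_self _))
    rw [memLp_two_iff_lintegral (hu.mono_ac (gibbsMeasure_absolutelyContinuous G))]
    exact ((lintegral_enorm_sq_gibbsMeasure_le h.aemeasurable hCw hu hu0).trans_lt
      (ENNReal.mul_lt_top ENNReal.ofReal_lt_top
        ((memLp_two_iff_lintegral hu).1 h1).lt_top)).ne
  have limμ : ∀ u : ℕ → 𝔼 → 𝕜, (∀ n, AEStronglyMeasurable (u n)) →
      (∀ n x, ‖u n x‖ ≤ 3 * C * M * (g x + ‖mollify n bt x‖ ^ 2 + ‖mollify n qt x‖)) →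
      (∀ᵐ x, Tendsto (fun n => u n x) atTop (𝓝 0)) → (∀ n x, R < ‖x‖ → u n x = 0) →
      Tendsto (fun n => ∫⁻ x, ‖u n x‖ₑ ^ 2 ∂(gibbsMeasure G)) atTop (𝓝 0) :=
    fun u hu hub hul hu0 => by
      have h1 := tendsto_lintegral_sq_of_mollify_bound hbti hqti hb4 hq2 hg2 hu hub hul
      have h2 := ENNReal.Tendsto.const_mul (a := ENNReal.ofReal Cw) h1
        (Or.inr ENNReal.ofReal_ne_top)
      rw [mul_zero] at h2
      exact tendsto_of_tendsto_of_tendsto_of_le_of_le tendsto_const_nhds h2 (fun _ => zero_le)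
        fun n => lintegral_enorm_sq_gibbsMeasure_le h.aemeasurable hCw (hu n) (hu0 n)
  have zf' : ∀ x, R < ‖x‖ → f' x = 0 := fun x hx => by simp only [hf', z0 x hx, smul_zero]
  have zΛ' : ∀ x, R < ‖x‖ → Λ' x = 0 := fun x hx => by simp only [hΛ', zL x hx]
  refine InGraphClosure.of_tendsto hmem (memL2 _ mf' bf' zf') (memL2 _ mΛ' bΛ' zΛ')
    (limμ (fun n x => f n x - f' x) (fun n => (mf n).sub mf') bfn hlim0 fun n x hx => ?_)
    (limμ (fun n x => Λ n x - Λ' x) (fun n => (mΛ n).sub mΛ') bΛn hlim1 fun n x hx => ?_)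
  · simp only [hf, hf', z0 x hx, smul_zero, sub_zero]
  · simp only [hΛ, hΛ', zL x hx, sub_zero]

end Regularization

/-! ### The unitary map `u ↦ e^{G/2} u`. -/

section ExpIsometry

variable {d : ℕ} {𝕜 : Type*} [RCLike 𝕜]

local notation "𝔼" => EuclideanSpace ℝ (Fin d)

theorem MeasureTheory.eLpNorm_two_eq_lintegral {α F : Type*} [MeasurableSpace α] {μ : Measure α}
    [NormedAddCommGroup F] (f : α → F) :
    eLpNorm f 2 μ = (∫⁻ x, ‖f x‖ₑ ^ 2 ∂μ) ^ (1 / 2 : ℝ) := by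
  rw [eLpNorm_eq_lintegral_rpow_enorm_toReal (by simp) (by simp)]
  simp only [ENNReal.toReal_ofNat, ENNReal.rpow_ofNat]

theorem ofReal_exp_neg_mul_enorm_sq (s : ℝ) (z : 𝕜) :
    ENNReal.ofReal (Real.exp (-s)) * ‖Real.exp (s / 2) • z‖ₑ ^ 2 = ‖z‖ₑ ^ 2 := by
  rw [enorm_pow_eq_ofReal, enorm_pow_eq_ofReal, ← ENNReal.ofReal_mul (Real.exp_pos _).le,
    norm_smul, mul_pow, ← mul_assoc, Real.norm_of_nonneg (Real.exp_pos _).le, sq (Real.exp _),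
    ← Real.exp_add, ← Real.exp_add]
  simp

theorem aestronglyMeasurable_exp_half {G : 𝔼 → ℝ} (hG : AEMeasurable G) :
    AEStronglyMeasurable fun x => Real.exp (G x / 2) :=
  (Real.measurable_exp.comp_aemeasurable (hG.div_const 2)).aestronglyMeasurable

theorem eLpNorm_exp_half_smul {G : 𝔼 → ℝ} (hG : AEMeasurable G) {u : 𝔼 → 𝕜}
    (hu : AEStronglyMeasurable u) :
    eLpNorm (fun x => Real.exp (G x / 2) • u x) 2 (gibbsMeasure G) = eLpNorm u 2 volume := by
  have hm : AEMeasurable fun x => ‖Real.exp (G x / 2) • u x‖ₑ ^ 2 :=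
    ((aestronglyMeasurable_exp_half hG).smul hu).enorm.pow_const 2
  rw [eLpNorm_two_eq_lintegral, eLpNorm_two_eq_lintegral, lintegral_gibbsMeasure hG hm]
  simp only [ofReal_exp_neg_mul_enorm_sq]

theorem MeasureTheory.MemLp.exp_half_smul {G : 𝔼 → ℝ} (hG : AEMeasurable G) {u : 𝔼 → 𝕜}
    (hu : MemLp u 2 volume) : MemLp (fun x => Real.exp (G x / 2) • u x) 2 (gibbsMeasure G) :=
  ⟨((aestronglyMeasurable_exp_half hG).smul hu.1).mono_ac (gibbsMeasure_absolutelyContinuous G), by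
    rw [eLpNorm_exp_half_smul hG hu.1]
    exact hu.2⟩

variable (𝕜) in
/-- Multiplication by `e^{G/2}` as an isometry from `L²(dx)` to `L²(e^{-G} dx)`. -/
def expIsometry {G : EuclideanSpace ℝ (Fin d) → ℝ} (hG : AEMeasurable G) :
    Lp 𝕜 2 (volume : Measure (EuclideanSpace ℝ (Fin d))) →ₗᵢ[𝕜] Lp 𝕜 2 (gibbsMeasure G) where
  toFun u := ((Lp.memLp u).exp_half_smul hG).toLp _
  map_add' u v := by
    apply Lp.ext
    filter_upwards [((Lp.memLp (u + v)).exp_half_smul hG).coeFn_toLp,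
      ((Lp.memLp u).exp_half_smul hG).coeFn_toLp, ((Lp.memLp v).exp_half_smul hG).coeFn_toLp,
      Lp.coeFn_add (((Lp.memLp u).exp_half_smul hG).toLp _)
        (((Lp.memLp v).exp_half_smul hG).toLp _),
      (gibbsMeasure_absolutelyContinuous G).ae_le (Lp.coeFn_add u v)] with x h1 h2 h3 h4 h5
    rw [h1, h4, Pi.add_apply, h2, h3, h5, Pi.add_apply, smul_add]
  map_smul' c u := by
    apply Lp.ext
    filter_upwards [((Lp.memLp (c • u)).exp_half_smul hG).coeFn_toLp,
      ((Lp.memLp u).exp_half_smul hG).coeFn_toLp,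
      Lp.coeFn_smul c (((Lp.memLp u).exp_half_smul hG).toLp _),
      (gibbsMeasure_absolutelyContinuous G).ae_le (Lp.coeFn_smul c u)] with x h1 h2 h3 h4
    rw [h1, RingHom.id_apply, h3, Pi.smul_apply, h2, h4, Pi.smul_apply, smul_comm]
  norm_map' u := by
    change ‖((Lp.memLp u).exp_half_smul hG).toLp _‖ = ‖u‖
    rw [Lp.norm_toLp, eLpNorm_exp_half_smul hG (Lp.aestronglyMeasurable u), Lp.norm_def]

theorem expIsometry_ae_eq {G : 𝔼 → ℝ} (hG : AEMeasurable G)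
    {u : Lp 𝕜 2 (volume : Measure 𝔼)} {f : 𝔼 → 𝕜} (hu : u =ᵐ[volume] f) :
    expIsometry 𝕜 hG u =ᵐ[gibbsMeasure G] fun x => Real.exp (G x / 2) • f x := by
  filter_upwards [((Lp.memLp u).exp_half_smul hG).coeFn_toLp,
    (gibbsMeasure_absolutelyContinuous G).ae_le hu] with x h1 h2
  rw [← h2]
  exact h1

theorem surjective_expIsometry {G : 𝔼 → ℝ} (hG : AEMeasurable G) :
    Function.Surjective (expIsometry 𝕜 hG) := fun v => by
  have hvm : AEStronglyMeasurable (v : 𝔼 → 𝕜) volume :=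
    (Lp.aestronglyMeasurable v).mono_ac (absolutelyContinuous_gibbsMeasure hG)
  have hem : AEStronglyMeasurable fun x => Real.exp (-(G x / 2)) • (v : 𝔼 → 𝕜) x :=
    (Real.measurable_exp.comp_aemeasurable (hG.div_const 2).neg).aestronglyMeasurable.smul hvm
  have hcancel : ∀ x, Real.exp (G x / 2) • Real.exp (-(G x / 2)) • (v : 𝔼 → 𝕜) x = v x := fun x => by
    rw [smul_smul, ← Real.exp_add, add_neg_cancel, Real.exp_zero, one_smul]
  have hmem : MemLp (fun x => Real.exp (-(G x / 2)) • (v : 𝔼 → 𝕜) x) 2 volume := by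
    refine ⟨hem, ?_⟩
    rw [← eLpNorm_exp_half_smul hG hem]
    simp only [hcancel]
    exact (Lp.memLp v).2
  refine ⟨hmem.toLp _, Lp.ext ?_⟩
  filter_upwards [expIsometry_ae_eq hG hmem.coeFn_toLp] with x h1
  rw [h1, hcancel]

/-- Dominated convergence in `L²(e^{-G} dx)`. -/
theorem memLp_and_tendsto_of_exp_half_bound {G : 𝔼 → ℝ} (hG : AEMeasurable G) {H : 𝔼 → ℝ}
    (hH : MemLp H 2 volume) {u : ℕ → 𝔼 → 𝕜} {v : 𝔼 → 𝕜} (hu : ∀ n, AEStronglyMeasurable (u n))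
    (hle : ∀ n x, ‖u n x‖ ≤ Real.exp (G x / 2) * H x)
    (hlim : ∀ x, Tendsto (fun n => u n x) atTop (𝓝 (v x))) :
    MemLp v 2 (gibbsMeasure G) ∧
      Tendsto (fun n => ∫⁻ x, ‖u n x - v x‖ₑ ^ 2 ∂(gibbsMeasure G)) atTop (𝓝 0) := by
  have hv : AEStronglyMeasurable v :=
    aestronglyMeasurable_of_tendsto_ae atTop hu (Eventually.of_forall hlim)
  have hvle : ∀ x, ‖v x‖ ≤ Real.exp (G x / 2) * H x := fun x =>
    le_of_tendsto (hlim x).norm (Eventually.of_forall fun n => hle n x)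
  have hac := gibbsMeasure_absolutelyContinuous G
  have hb := hH.exp_half_smul hG
  have hb2 := (memLp_two_iff_lintegral (hb.const_smul (2 : ℝ)).1).1 (hb.const_smul (2 : ℝ))
  refine ⟨hb.of_le (hv.mono_ac hac) (Eventually.of_forall fun x =>
    (hvle x).trans (le_abs_self _)), ?_⟩
  have h0 : ∫⁻ _, 0 ∂(gibbsMeasure G) = 0 := lintegral_zero
  rw [← h0]
  refine tendsto_lintegral_of_dominated_convergence' _
    (fun n => (((hu n).sub hv).mono_ac hac).enorm.pow_const 2)
    (fun n => Eventually.of_forall fun x => ?_) hb2 (Eventually.of_forall fun x => ?_)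
  · refine pow_le_pow_left₀ (zero_le) ?_ 2
    rw [← ofReal_norm, ← ofReal_norm]
    refine ENNReal.ofReal_le_ofReal ((norm_sub_le _ _).trans ((add_le_add (hle n x)
      (hvle x)).trans ((le_of_eq ?_).trans (le_abs_self _))))
    simp only [Pi.smul_apply, smul_eq_mul]
    ring
  · have h1 := ((hlim x).sub_const (v x)).enorm
    rw [sub_self, enorm_zero] at h1
    simpa using! ((ENNReal.continuous_pow 2).tendsto _).comp h1

end ExpIsometry

/-! ### The ground state transformation. -/

section Schroedinger

variable {d : ℕ} {𝕜 : Type*} [RCLike 𝕜]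

local notation "𝔼" => EuclideanSpace ℝ (Fin d)

theorem norm_fderiv_le_sum {ι : Type*} [Fintype ι] (b : OrthonormalBasis ι ℝ 𝔼)
    (L : 𝔼 →L[ℝ] 𝕜) : ‖L‖ ≤ ∑ i, ‖L (b i)‖ := by
  refine L.opNorm_le_bound (Finset.sum_nonneg fun _ _ => norm_nonneg _) fun v => ?_
  rw [← b.sum_inner_smul_apply L v, Finset.sum_mul]
  refine (norm_sum_le _ _).trans (Finset.sum_le_sum fun i _ => ?_)
  rw [norm_smul, mul_comm]
  gcongr
  simpa using norm_inner_le_norm (𝕜 := ℝ) v (b i)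

/-- The hypothesis is applied to the directional derivatives and the Laplacian of `f`, which are
again Schwartz functions. -/
theorem memLp_weight_mul_schwartz_jet {W : 𝔼 → ℝ} (hWm : AEStronglyMeasurable W)
    (hW : ∀ f : 𝓢(𝔼, 𝕜), MemLp (fun x => W x * ‖f x‖) 2 volume)
    (f : 𝓢(𝔼, 𝕜)) : MemLp (fun x => W x * (‖f x‖ + ‖fderiv ℝ f x‖ +
      ‖Laplacian.laplacian (f : 𝔼 → 𝕜) x‖)) 2 volume := by
  have hfs : ContDiff ℝ ∞ (f : 𝔼 → 𝕜) := f.smooth'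
  have h1 : MemLp (fun x => W x * ‖fderiv ℝ f x‖) 2 volume := by
    have hs : MemLp (fun x => ∑ i, W x * ‖f.dirDeriv (stdOrthonormalBasis ℝ 𝔼 i) x‖) 2 volume :=
      memLp_finsetSum _ fun i _ => hW _
    refine hs.of_le (hWm.mul (hfs.continuous_fderiv (by norm_num)).norm.aestronglyMeasurable)
      (Eventually.of_forall fun x => ?_)
    rw [← Finset.mul_sum, norm_mul, norm_mul, norm_norm]
    gcongr
    exact (norm_fderiv_le_sum (stdOrthonormalBasis ℝ 𝔼) _).trans (le_abs_self _)
  have h2 := hW (Laplacian.laplacian f)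
  simp only [SchwartzMap.laplacian_apply] at h2
  simp only [mul_add]
  exact ((hW f).add h1).add h2

/-- The case `F(s) = e^{s/2}`, `∇G = -β`, `ΔG = -r`. The first-order terms `β · ∇f` and `2 · (1/2)
(-β) · ∇f` cancel, and the potential is `|β|²/4 - r/2 - |β|²/2 = -(|β|²/4 + r/2)`. -/
theorem driftComp_exp_half (β : 𝔼 → 𝔼) (f : 𝔼 → 𝕜) (s r : ℝ) (x : 𝔼) :
    driftComp β f s (1 / 2 * s) (1 / 4 * s) (-β x) (-r) x =
      s • (Laplacian.laplacian f x - ((‖β x‖ ^ 2 / 4 + r / 2 : ℝ) : 𝕜) * f x) := by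
  rw [driftComp, driftFun, map_neg, norm_neg, inner_neg_left, real_inner_self_eq_norm_sq,
    ← RCLike.real_smul_eq_coe_mul]
  module

/-- Both `e^{s/2}` and `f` are cut down: `regExp (-1/2)` makes the exponential bounded and a cutoff
makes `f` compactly supported. Everything is dominated by `e^{G/2}` times the weight times the
derivatives of `f` up to order two, and this majorant is in `L²(μ)` because the factor `e^{G/2}` is
an isometry. -/
theorem IsGibbsDrift.inGraphClosure_exp_half {β : 𝔼 → 𝔼} {G D : 𝔼 → ℝ} (h : IsGibbsDrift β G)
    (hD : IsWeakDivergence β D)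
    (hβ : ∀ f : 𝓢(𝔼, 𝕜), MemLp (fun x => fderiv ℝ f x (β x)) 2 (gibbsMeasure G))
    (hW : ∀ f : 𝓢(𝔼, 𝕜), MemLp (fun x => (1 + ‖β x‖ ^ 2 + |D x|) * ‖f x‖) 2 volume)
    (hw : ∀ R : ℝ, ∃ C : ℝ, ∀ᵐ x : 𝔼, ‖x‖ ≤ R → Real.exp (-G x) ≤ C) (f : 𝓢(𝔼, 𝕜)) :
    InGraphClosure (gibbsMeasure G) (driftExpr 𝕜 β) (fun x => Real.exp (G x / 2) • f x) fun x =>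
      Real.exp (G x / 2) • (Laplacian.laplacian (f : 𝔼 → 𝕜) x -
        ((‖β x‖ ^ 2 / 4 + D x / 2 : ℝ) : 𝕜) * f x) := by
  have hfs : ContDiff ℝ ∞ (f : 𝔼 → 𝕜) := f.smooth'
  have hGm := h.weak.1.aestronglyMeasurable
  have hWm : AEStronglyMeasurable fun x => 1 + ‖β x‖ ^ 2 + |D x| :=
    (aestronglyMeasurable_const.add (h.aestronglyMeasurable.norm.pow 2)).add
      hD.2.1.aestronglyMeasurable.norm
  -- Schwartz functions of modulus `1` on a ball turn `hW` into the local conditions `β ∈ L⁴` and `D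
  -- ∈ L²`.
  have hcut : ∀ R : ℝ, ∃ g : 𝓢(𝔼, 𝕜), ∀ x, ‖x‖ ≤ R → ‖g x‖ = 1 := fun R => by
    obtain ⟨N, hN⟩ := exists_nat_gt R
    have hs : ContDiff ℝ ∞ fun x => (cutoff 𝔼 N x : 𝕜) :=
      (RCLike.ofRealCLM (K := 𝕜)).contDiff.comp (contDiff_cutoff N)
    have hc : HasCompactSupport fun x => (cutoff 𝔼 N x : 𝕜) :=
      (hasCompactSupport_cutoff N).comp_left RCLike.ofReal_zero
    refine ⟨hc.toSchwartzMap hs, fun x hx => ?_⟩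
    change ‖(cutoff 𝔼 N x : 𝕜)‖ = 1
    rw [cutoff_eq_one (by linarith), RCLike.ofReal_one, norm_one]
  have hβ4 : ∀ R, MemLp (fun x => ‖(Metric.closedBall 0 R).indicator β x‖ ^ 2) 2 volume :=
    fun R => by
      obtain ⟨g, hg⟩ := hcut R
      refine (hW g).of_le ((h.locallyIntegrable.integrable_indicator_closedBall R).1.norm.pow 2)
        (Eventually.of_forall fun x => ?_)
      by_cases hx : x ∈ Metric.closedBall (0 : 𝔼) R
      · rw [Set.indicator_of_mem hx, hg x (mem_closedBall_zero_iff.1 hx), mul_one, norm_pow,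
          norm_norm, Real.norm_of_nonneg (by positivity)]
        linarith [abs_nonneg (D x)]
      · simp only [Set.indicator_of_notMem hx, norm_zero, ne_eq, OfNat.ofNat_ne_zero,
          not_false_eq_true, zero_pow]
        positivity
  have hD2 : ∀ R, MemLp ((Metric.closedBall 0 R).indicator D) 2 volume := fun R => by
    obtain ⟨g, hg⟩ := hcut R
    refine (hW g).of_le (hD.2.1.integrable_indicator_closedBall R).1
      (Eventually.of_forall fun x => ?_)
    by_cases hx : x ∈ Metric.closedBall (0 : 𝔼) R
    · rw [Set.indicator_of_mem hx, hg x (mem_closedBall_zero_iff.1 hx), mul_one,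
        Real.norm_of_nonneg (show 0 ≤ 1 + ‖β x‖ ^ 2 + |D x| by positivity), Real.norm_eq_abs]
      linarith [sq_nonneg ‖β x‖]
    · simp only [Set.indicator_of_notMem hx, norm_zero]
      positivity
  obtain ⟨C₁, hC₁, hcut₁⟩ := exists_norm_fderiv_cutoff_le 𝔼
  obtain ⟨C₂, hC₂, hcut₂⟩ := exists_abs_laplacian_cutoff_le 𝔼
  have hck : ∀ k : ℕ, (0 : ℝ) < 1 / ((k : ℝ) + 1) := fun k => by positivity
  set F : ℕ → ℝ → ℝ := fun k => regExp (-1 / 2) (1 / ((k : ℝ) + 1)) with hF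
  have hφs : ∀ k, ContDiff ℝ ∞ fun x => cutoff 𝔼 k x • f x := fun k =>
    (contDiff_cutoff k).smul hfs
  have hφc : ∀ k, HasCompactSupport fun x => cutoff 𝔼 k x • f x := fun k =>
    (hasCompactSupport_cutoff k).smul_right
  set φ : ℕ → 𝔼 → 𝕜 := fun k x => cutoff 𝔼 k x • f x with hφ
  have hFs : ∀ k, ContDiff ℝ ∞ (F k) := fun k => contDiff_regExp (hck k)
  have hmem : ∀ k, InGraphClosure (gibbsMeasure G) (driftExpr 𝕜 β) (fun x => F k (G x) • φ k x)
      fun x => driftComp β (φ k) (F k (G x)) (deriv (F k) (G x)) (deriv (deriv (F k)) (G x))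
        (-β x) (-D x) x := fun k => by
    obtain ⟨C, -, h0, h1, h2⟩ := exists_bound_regExp (-1 / 2) (hck k)
    exact h.inGraphClosure_comp hD hβ hβ4 hD2 hw (hFs k) h0 h1 h2 (hφs k) (hφc k)
  have hexp : ∀ s, Real.exp (-(-1 / 2 * s)) = Real.exp (s / 2) := fun s => by congr 1; ring
  have hF0 : ∀ k s, |F k s| ≤ Real.exp (s / 2) := fun k s => by
    rw [← hexp]
    exact abs_regExp_le (hck k) s
  have hF1 : ∀ k s, |deriv (F k) s| ≤ Real.exp (s / 2) := fun k s => by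
    refine (abs_deriv_regExp_le (hck k) s).trans ?_
    have h1 := regExp_pos (a := -1 / 2) (hck k) s
    have h2 := regExp_le_exp (a := -1 / 2) (hck k) s
    rw [hexp] at h2
    have : |(-1 / 2 : ℝ)| = 1 / 2 := by norm_num
    rw [this]
    linarith
  have hF2 : ∀ k s, |deriv (deriv (F k)) s| ≤ Real.exp (s / 2) := fun k s => by
    refine (abs_deriv_deriv_regExp_le (hck k) s).trans ?_
    have h1 := regExp_pos (a := -1 / 2) (hck k) s
    have h2 := regExp_le_exp (a := -1 / 2) (hck k) s
    rw [hexp] at h2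
    linarith
  set N : 𝔼 → ℝ := fun x => ‖f x‖ + ‖fderiv ℝ f x‖ + ‖Laplacian.laplacian (f : 𝔼 → 𝕜) x‖ with hN
  -- The Leibniz constants of `Δ(χ f)`: `1` for `χ Δf`, `2 C₁` for `2 ∇χ · ∇f`, `C₂` for `f Δχ`;
  -- they also cover the lower derivatives.
  set M := 1 + 2 * C₁ + C₂ with hM
  have hN0 : ∀ x, 0 ≤ N x := fun x => by positivity
  have hφ0 : ∀ k x, ‖φ k x‖ ≤ ‖f x‖ := fun k x => by
    rw [norm_smul]
    exact mul_le_of_le_one_left (norm_nonneg _) (abs_cutoff_le_one k x)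
  have m0 : ∀ k x, ‖φ k x‖ ≤ M * N x := fun k x => by
    refine (hφ0 k x).trans ?_
    simp only [hM, hN]
    nlinarith [norm_nonneg (f x), norm_nonneg (fderiv ℝ f x),
      norm_nonneg (Laplacian.laplacian (f : 𝔼 → 𝕜) x), mul_nonneg hC₁ (hN0 x),
      mul_nonneg hC₂ (hN0 x)]
  have m1 : ∀ k x, ‖fderiv ℝ (φ k) x‖ ≤ M * N x := fun k x => by
    refine ContinuousLinearMap.opNorm_le_bound _ (by positivity) fun e => ?_
    rw [hφ, fderiv_smul_apply' ((contDiff_cutoff k).differentiable (by norm_num) x)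
      f.differentiableAt]
    calc _ ≤ 1 * (‖fderiv ℝ f x‖ * ‖e‖) + C₁ * ‖e‖ * ‖f x‖ := by
          refine (norm_add_le _ _).trans (add_le_add ?_ ?_)
          · rw [norm_smul]
            gcongr
            · exact abs_cutoff_le_one k x
            · exact (fderiv ℝ f x).le_opNorm e
          · rw [norm_smul]
            gcongr
            exact ((fderiv ℝ (cutoff 𝔼 k) x).le_opNorm e).trans (by gcongr; exact hcut₁ k x)
      _ = (‖fderiv ℝ f x‖ + C₁ * ‖f x‖) * ‖e‖ := by ring
      _ ≤ M * N x * ‖e‖ := by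
          gcongr
          simp only [hM, hN]
          nlinarith [norm_nonneg (f x), norm_nonneg (fderiv ℝ f x),
            norm_nonneg (Laplacian.laplacian (f : 𝔼 → 𝕜) x), mul_nonneg hC₁ (norm_nonneg (f x)),
            mul_nonneg hC₁ (norm_nonneg (fderiv ℝ f x)), mul_nonneg hC₂ (hN0 x),
            mul_nonneg hC₁ (norm_nonneg (Laplacian.laplacian (f : 𝔼 → 𝕜) x))]
  have m2 : ∀ k x, ‖Laplacian.laplacian (φ k) x‖ ≤ M * N x := fun k x => by
    obtain ⟨v, hv, hvn⟩ := exists_gradient (cutoff 𝔼 k) x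
    rw [hφ, laplacian_smul_apply_of_gradient (contDiff_cutoff k).two_of_infty hfs.two_of_infty hv]
    calc _ ≤ 1 * ‖Laplacian.laplacian (f : 𝔼 → 𝕜) x‖ + 2 * (‖fderiv ℝ f x‖ * C₁) +
          C₂ * ‖f x‖ := by
          refine norm_add₃_le.trans (add_le_add (add_le_add ?_ ?_) ?_)
          · rw [norm_smul]
            gcongr
            exact abs_cutoff_le_one k x
          · rw [norm_smul, Real.norm_of_nonneg zero_le_two]
            gcongr
            exact ((fderiv ℝ f x).le_opNorm v).trans (by gcongr; exact hvn ▸ hcut₁ k x)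
          · rw [norm_smul]
            gcongr
            exact hcut₂ k x
      _ ≤ M * N x := by
          simp only [hM, hN]
          nlinarith [norm_nonneg (f x), norm_nonneg (fderiv ℝ f x),
            norm_nonneg (Laplacian.laplacian (f : 𝔼 → 𝕜) x), mul_nonneg hC₁ (norm_nonneg (f x)),
            mul_nonneg hC₂ (norm_nonneg (fderiv ℝ f x)),
            mul_nonneg hC₂ (norm_nonneg (Laplacian.laplacian (f : 𝔼 → 𝕜) x)),
            mul_nonneg hC₁ (norm_nonneg (Laplacian.laplacian (f : 𝔼 → 𝕜) x))]
  -- The factor `3` comes from `norm_driftComp_le_of_bound`; it doubles because `p = -β` makes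
  -- `|β|²` occur twice.
  set H : 𝔼 → ℝ := fun x => 6 * M * ((1 + ‖β x‖ ^ 2 + |D x|) * N x) with hH
  have hH2 : MemLp H 2 volume :=
    (memLp_weight_mul_schwartz_jet hWm hW f).const_mul _
  have hM1 : 1 ≤ M := by linarith
  have lim0 := memLp_and_tendsto_of_exp_half_bound h.aemeasurable hH2
    (u := fun k x => F k (G x) • φ k x) (v := fun x => Real.exp (G x / 2) • f x)
    (fun k => ((hFs k).continuous.comp_aestronglyMeasurable hGm).smul
      (hφs k).continuous.aestronglyMeasurable)
    (fun k x => by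
      rw [norm_smul]
      refine mul_le_mul (hF0 k _) ((m0 k x).trans ?_) (norm_nonneg _) (Real.exp_pos _).le
      simp only [hH]
      have := mul_nonneg (zero_le_one.trans hM1) (hN0 x)
      nlinarith [mul_nonneg this (sq_nonneg ‖β x‖), mul_nonneg this (abs_nonneg (D x))])
    (fun x => by
      have h1 := (tendsto_regExp (-1 / 2) (G x)).smul ((tendsto_cutoff x).smul_const (f x))
      rwa [hexp, one_smul] at h1)
  have lim1 := memLp_and_tendsto_of_exp_half_bound h.aemeasurable hH2
    (u := fun k x => driftComp β (φ k) (F k (G x)) (deriv (F k) (G x)) (deriv (deriv (F k)) (G x))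
      (-β x) (-D x) x)
    (v := fun x => Real.exp (G x / 2) • (Laplacian.laplacian (f : 𝔼 → 𝕜) x -
        ((‖β x‖ ^ 2 / 4 + D x / 2 : ℝ) : 𝕜) * f x))
    (fun k => aestronglyMeasurable_driftComp h.aestronglyMeasurable (hφs k)
      ((hFs k).continuous.comp_aestronglyMeasurable hGm)
      (((hFs k).continuous_deriv (by norm_num)).comp_aestronglyMeasurable hGm)
      (((contDiff_infty_iff_deriv.1 (hFs k)).2.continuous_deriv
        (by norm_num)).comp_aestronglyMeasurable hGm)
      h.aestronglyMeasurable.neg hD.2.1.aestronglyMeasurable.neg)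
    (fun k x => by
      refine (norm_driftComp_le_of_bound β (φ k) (hF0 k _) (hF1 k _) (hF2 k _) _ _ (m0 k x)
        (m1 k x) (m2 k x)).trans ?_
      rw [norm_neg, abs_neg, mul_comm 3, mul_assoc, mul_assoc]
      refine mul_le_mul_of_nonneg_left ?_ (Real.exp_pos _).le
      simp only [hH]
      have := mul_nonneg (zero_le_one.trans hM1) (hN0 x)
      nlinarith [mul_nonneg this (sq_nonneg ‖β x‖), mul_nonneg this (abs_nonneg (D x))])
    (fun x => by
      have t0 := tendsto_regExp (-1 / 2) (G x)
      have t1 := tendsto_deriv_regExp (-1 / 2) (G x)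
      have t2 := tendsto_deriv_deriv_regExp (-1 / 2) (G x)
      rw [hexp] at t0 t1 t2
      rw [← driftComp_exp_half β (f : 𝔼 → 𝕜)]
      rw [show -(-1 / 2 : ℝ) = 1 / 2 by norm_num] at t1
      rw [show (-1 / 2 : ℝ) ^ 2 = 1 / 4 by norm_num] at t2
      refine (tendsto_driftComp β f t0 t1 t2 tendsto_const_nhds tendsto_const_nhds x).congr' ?_
      -- Near a fixed point the cutoff is eventually `1`, so `φ k` and its derivatives there are
      -- those of `f`.
      filter_upwards [eventually_cutoff_eq_one x] with k hk
      have hev : φ k =ᶠ[𝓝 x] (f : 𝔼 → 𝕜) := by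
        filter_upwards [hk] with y hy
        simp only [hφ, hy, one_smul]
      simp only [driftComp, driftFun, hev.fderiv_eq, hev.eq_of_nhds,
        (InnerProductSpace.laplacian_congr_nhds hev).eq_of_nhds]
      rfl)
  exact InGraphClosure.of_tendsto hmem lim0.1 lim1.1 lim0.2 lim1.2

end Schroedinger

/-! ### Self-adjointness of the closure and the invariant semigroup. -/

section SelfAdjointness

variable {d : ℕ} {𝕜 : Type*} [RCLike 𝕜]

local notation "𝔼" => EuclideanSpace ℝ (Fin d)

/-- Since `|β|² = 4V - 2D`, square integrability of `V f` and `D f` also controls `|β|² f`. -/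
theorem memLp_weight_of_potential {β : 𝔼 → 𝔼} {D V : 𝔼 → ℝ} (hβm : AEStronglyMeasurable β)
    (hDm : AEStronglyMeasurable D) (hV : ∀ x, V x = ‖β x‖ ^ 2 / 4 + D x / 2)
    (hDf : ∀ f : 𝓢(𝔼, 𝕜), MemLp (fun x => (D x : 𝕜) * f x) 2 volume)
    (hVf : ∀ f : 𝓢(𝔼, 𝕜), MemLp (fun x => (V x : 𝕜) * f x) 2 volume) (f : 𝓢(𝔼, 𝕜)) :
    MemLp (fun x => (1 + ‖β x‖ ^ 2 + |D x|) * ‖f x‖) 2 volume := by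
  have h1 : MemLp (fun x => ‖f x‖) 2 volume := (f.memLp 2 volume).norm
  have h2 : MemLp (fun x => 3 * ‖(D x : 𝕜) * f x‖) 2 volume := (hDf f).norm.const_mul 3
  have h3 : MemLp (fun x => 4 * ‖(V x : 𝕜) * f x‖) 2 volume := (hVf f).norm.const_mul 4
  refine ((h1.add h2).add h3).of_le (((aestronglyMeasurable_const.add (hβm.norm.pow 2)).add
    hDm.norm).mul f.continuous.norm.aestronglyMeasurable) (Eventually.of_forall fun x => ?_)
  rw [Real.norm_of_nonneg (by positivity)]
  refine le_trans ?_ (le_abs_self _)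
  simp only [Pi.add_apply, norm_mul, RCLike.norm_ofReal]
  have h4 : ‖β x‖ ^ 2 ≤ 4 * |V x| + 2 * |D x| := by
    have := hV x
    linarith [le_abs_self (V x), neg_abs_le (D x)]
  nlinarith [norm_nonneg (f x)]

namespace IsGibbsDrift

/-- Transplantation along `expIsometry`: the sign in the abstract criterion accounts for `L`
corresponding to `-(-Δ + V)`. -/
theorem isEssentiallySelfAdjoint {β : 𝔼 → 𝔼} {G D V : 𝔼 → ℝ} (h : IsGibbsDrift β G)
    (hD : IsWeakDivergence β D)
    (hβ : ∀ f : 𝓢(𝔼, 𝕜), MemLp (fun x => fderiv ℝ f x (β x)) 2 (gibbsMeasure G))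
    (hV : ∀ x, V x = ‖β x‖ ^ 2 / 4 + D x / 2)
    (hDf : ∀ f : 𝓢(𝔼, 𝕜), MemLp (fun x => (D x : 𝕜) * f x) 2 volume)
    (hVf : ∀ f : 𝓢(𝔼, 𝕜), MemLp (fun x => (V x : 𝕜) * f x) 2 volume)
    (hw : ∀ R : ℝ, ∃ C : ℝ, ∀ᵐ x : 𝔼, ‖x‖ ≤ R → Real.exp (-G x) ≤ C)
    (hS : IsEssentiallySelfAdjoint (schwartzOp (volume : Measure 𝔼) (schrodingerExpr 𝕜 V))) :
    IsEssentiallySelfAdjoint (schwartzOp (gibbsMeasure G) (driftExpr 𝕜 β)) := by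
  have hG := h.aemeasurable
  have hWf := memLp_weight_of_potential h.aestronglyMeasurable hD.2.1.aestronglyMeasurable hV hDf hVf
  refine (h.isSymmetricOp hβ).isEssentiallySelfAdjoint_of_transplant hS (expIsometry 𝕜 hG)
    (surjective_expIsometry hG) ?_
  rw [graph_schwartzOp Measure.AbsolutelyContinuous.rfl,
    graph_schwartzOp (absolutelyContinuous_gibbsMeasure hG)]
  rintro p ⟨f, hf1, hf2⟩
  obtain ⟨q, hq, hq1, hq2⟩ := h.inGraphClosure_exp_half hD hβ hWf hw f
  have e1 : expIsometry 𝕜 hG p.1 = q.1 := Lp.ext ((expIsometry_ae_eq hG hf1).trans hq1.symm)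
  have e2 : -expIsometry 𝕜 hG p.2 = q.2 := by
    apply Lp.ext
    filter_upwards [expIsometry_ae_eq hG hf2, hq2, Lp.coeFn_neg (expIsometry 𝕜 hG p.2)]
      with x h1 h2 h3
    rw [h3, Pi.neg_apply, h1, h2, ← hV, ← smul_neg]
    congr 1
    simp only [schrodingerExpr, diffExpr, LinearMap.coe_mk, AddHom.coe_mk, map_zero,
      RCLike.ofReal_neg, RCLike.ofReal_one]
    ring
  rw [e1, e2]
  exact hq

theorem inner_snd_one_eq_zero {β : 𝔼 → 𝔼} {G : 𝔼 → ℝ} (h : IsGibbsDrift β G)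
    {e : Lp 𝕜 2 (gibbsMeasure G)} (he : e =ᵐ[gibbsMeasure G] fun _ => 1)
    {p : Lp 𝕜 2 (gibbsMeasure G) × Lp 𝕜 2 (gibbsMeasure G)}
    (hp : p ∈ (schwartzOp (gibbsMeasure G) (driftExpr 𝕜 β)).graph) : ⟪p.2, e⟫_𝕜 = 0 := by
  rw [graph_schwartzOp (absolutelyContinuous_gibbsMeasure h.aemeasurable)] at hp
  obtain ⟨f, hf1, hf2⟩ := hp
  rw [L2.inner_eq_integral_of_ae_eq hf2 he]
  simp only [RCLike.inner_apply, one_mul, integral_conj]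
  rw [(h.isInfinitesimallyInvariant f).2, map_zero]

theorem existsUnique_semigroup {β : 𝔼 → 𝔼} {G : 𝔼 → ℝ} (h : IsGibbsDrift β G)
    (hA : IsEssentiallySelfAdjoint (schwartzOp (gibbsMeasure G) (driftExpr 𝕜 β))) :
    ∃ T : ℝ≥0 → Lp 𝕜 2 (gibbsMeasure G) →L[𝕜] Lp 𝕜 2 (gibbsMeasure G),
      IsC0Semigroup T ∧
      IsGeneratorOf (schwartzOp (gibbsMeasure G) (driftExpr 𝕜 β)).closure T ∧
      (∀ T' : ℝ≥0 → Lp 𝕜 2 (gibbsMeasure G) →L[𝕜] Lp 𝕜 2 (gibbsMeasure G),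
        IsC0Semigroup T' →
        IsGeneratorOf (schwartzOp (gibbsMeasure G) (driftExpr 𝕜 β)).closure T' → T' = T) ∧
      (∀ t, ‖T t‖ ≤ 1) ∧
      ∀ (t : ℝ≥0) (u : Lp 𝕜 2 (gibbsMeasure G)),
        ∫ x, T t u x ∂(gibbsMeasure G) = ∫ x, u x ∂(gibbsMeasure G) := by
  have := h.isFiniteMeasure
  obtain ⟨T, hT1, hT2, hT3, hT4, hT5⟩ := hA.existsUnique_semigroup fun p hp => h.re_inner_nonpos hp
  refine ⟨T, hT1, hT2, hT3, hT4, fun t u => ?_⟩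
  -- The constant `1` is in `L²(μ)` as `μ` is finite; by infinitesimal invariance it is annihilated
  -- by the adjoint, and pairing with it is integration.
  have hone : MemLp (fun _ : 𝔼 => (1 : 𝕜)) 2 (gibbsMeasure G) := memLp_const 1
  have key := hT5 (hone.toLp _) (fun p hp => h.inner_snd_one_eq_zero hone.coeFn_toLp hp) t u
  have hin : ∀ v : Lp 𝕜 2 (gibbsMeasure G),
      ⟪hone.toLp _, v⟫_𝕜 = ∫ x, v x ∂(gibbsMeasure G) := fun v => by
    rw [L2.inner_eq_integral_of_ae_eq (g := v) hone.coeFn_toLp EventuallyEq.rfl]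
    simp only [RCLike.inner_apply, map_one, mul_one]
  rwa [hin, hin] at key

end IsGibbsDrift

end SelfAdjointness

end

theorem proposition2p16 {𝕜 : Type*} [RCLike 𝕜] {d : ℕ}
    (β : EuclideanSpace ℝ (Fin d) → EuclideanSpace ℝ (Fin d))
    (D : EuclideanSpace ℝ (Fin d) → ℝ) (hD : IsWeakDivergence β D) :
    -- (i) the adjoint of `Δ + β · ∇` in `L²(dx)`
    ((∀ f : 𝓢(EuclideanSpace ℝ (Fin d), 𝕜), MemLp (fun x => fderiv ℝ f x (β x)) 2 volume) →
      (∀ f : 𝓢(EuclideanSpace ℝ (Fin d), 𝕜), MemLp (fun x => (D x : 𝕜) * f x) 2 volume) →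
      Dense ((schwartzOp volume (driftExpr 𝕜 β)).domain :
        Set (Lp 𝕜 2 (volume : Measure (EuclideanSpace ℝ (Fin d))))) ∧
      schwartzOp volume (driftAdjointExpr 𝕜 β D) ≤
        (schwartzOp volume (driftExpr 𝕜 β)).adjoint ∧
      ∀ u v : Lp 𝕜 2 (volume : Measure (EuclideanSpace ℝ (Fin d))),
        (u, v) ∈ (schwartzOp volume (driftExpr 𝕜 β)).adjoint.graph ↔
          ∀ ψ : EuclideanSpace ℝ (Fin d) → ℝ, ContDiff ℝ ∞ ψ → HasCompactSupport ψ →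
            ∫ x, ((Laplacian.laplacian ψ x + fderiv ℝ ψ x (β x) : ℝ) : 𝕜) * u x =
              ∫ x, (ψ x : 𝕜) * v x) ∧
    -- the gradient case
    (∀ G : EuclideanSpace ℝ (Fin d) → ℝ,
      IsWeakGradient G (fun x => - β x) →
      Integrable (fun x => Real.exp (- G x)) →
      (∀ f : 𝓢(EuclideanSpace ℝ (Fin d), ℝ),
        Integrable (fun x => (f x * Real.exp (- G x)) • β x)) →
      (∀ f : 𝓢(EuclideanSpace ℝ (Fin d), ℝ),
        Integrable (fun x => f x * Real.exp (- G x) * D x)) →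
      -- (ii) infinitesimal invariance
      IsInfinitesimallyInvariant (gibbsMeasure G) (driftExpr 𝕜 β) ∧
      ((∀ f : 𝓢(EuclideanSpace ℝ (Fin d), 𝕜),
          MemLp (fun x => fderiv ℝ f x (β x)) 2 (gibbsMeasure G)) →
        -- (iii) symmetry in `L²(e^{-G} dx)`
        IsSymmetricOp (schwartzOp (gibbsMeasure G) (driftExpr 𝕜 β)) ∧
        -- (iv), (v) self-adjointness of the closure, invariance under the generated semigroup
        ∀ V : EuclideanSpace ℝ (Fin d) → ℝ,
          (∀ x, V x = ‖β x‖ ^ 2 / 4 + D x / 2) →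
          (∀ f : 𝓢(EuclideanSpace ℝ (Fin d), 𝕜), MemLp (fun x => (D x : 𝕜) * f x) 2 volume) →
          (∀ f : 𝓢(EuclideanSpace ℝ (Fin d), 𝕜), MemLp (fun x => (V x : 𝕜) * f x) 2 volume) →
          (∀ R : ℝ, ∃ C : ℝ, ∀ᵐ x : EuclideanSpace ℝ (Fin d), ‖x‖ ≤ R → Real.exp (- G x) ≤ C) →
          IsEssentiallySelfAdjoint
            (schwartzOp (volume : Measure (EuclideanSpace ℝ (Fin d))) (schrodingerExpr 𝕜 V)) →
          IsEssentiallySelfAdjoint (schwartzOp (gibbsMeasure G) (driftExpr 𝕜 β)) ∧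
          ∃ T : ℝ≥0 → Lp 𝕜 2 (gibbsMeasure G) →L[𝕜] Lp 𝕜 2 (gibbsMeasure G),
            IsC0Semigroup T ∧
            IsGeneratorOf (schwartzOp (gibbsMeasure G) (driftExpr 𝕜 β)).closure T ∧
            (∀ T' : ℝ≥0 → Lp 𝕜 2 (gibbsMeasure G) →L[𝕜] Lp 𝕜 2 (gibbsMeasure G),
              IsC0Semigroup T' →
              IsGeneratorOf (schwartzOp (gibbsMeasure G) (driftExpr 𝕜 β)).closure T' →
              T' = T) ∧
            (∀ t, ‖T t‖ ≤ 1) ∧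
            ∀ (t : ℝ≥0) (u : Lp 𝕜 2 (gibbsMeasure G)),
              ∫ x, T t u x ∂(gibbsMeasure G) = ∫ x, u x ∂(gibbsMeasure G))) := by
  refine ⟨fun hβ hDf => ⟨dense_domain_schwartzOp (memLp_driftExpr hβ),
    driftAdjointExpr_le_adjoint hD hβ hDf, mem_adjoint_graph_driftExpr_iff hD.1 hβ⟩,
    fun G hG hexp hdrift _ => ?_⟩
  have h : IsGibbsDrift β G := ⟨hG, hexp, hdrift⟩
  refine ⟨h.isInfinitesimallyInvariant, fun hβ => ⟨h.isSymmetricOp hβ, fun V hV hDf hVf hw hS => ?_⟩⟩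
  have hA := h.isEssentiallySelfAdjoint hD hβ hV hDf hVf hw hS
  exact ⟨hA, h.existsUnique_semigroup hA⟩
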